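/- Let $k\ge 0$ and $d\ge 1$ be integers, and let $\mathcal H_d$ be the set of holomorphic endomorphisms of $\mathbb P^k=\mathbb P^k(\mathbb C)$ of algebraic degree $d$, i.e. of the maps $f=[F_0:\dots:F_k]$, where the $F_i$ are homogeneous polynomials of degree $d$ in $k+1$ variables whose only common zero is the origin. Endow $\mathcal H_d$ with its usual topology, the quotient of the topology of the coefficients of $(F_0,\dots,F_k)$. For $f\in\mathcal H_d$, a trapping region is an open set $U\subset\mathbb P^k$ such that $f(U)\Subset U$; the set $\mathscr A=\bigcap_{n\ge 0}f^n(U)$ is then called an attracting set, and $U$ a trapping region of $\mathscr A$. The attracting set $\mathscr A$ is of dimension $l$ if it supports a nonzero positive closed current of bidimension $(l,l)$, but none of bidimension $(l',l')$ with $l'>l$. The map $f$ is of small topological degree on the attracting set $\mathscr A$ if, for some trapping region $U$ of $\mathscr A$ and with $l$ the dimension of $\mathscr A$, $$\limsup_{n\to\infty}\bigl(\operatorname{card}(f^{-n}(p)\cap U)\bigr)^{1/n}<d^{\,l}\qquad\text{for every } p\in f(U),$$ where $\operatorname{card}(f^{-n}(p)\cap U)$ is the number of preimages of $p$ under $f^n$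 in $U$, counted with multiplicity (a preimage $y$ counts as often as the local topological degree of $f^n$ at $y$). Then the set of all $f\in\mathcal H_d$ that are of small topological degree on some attracting set is open in $\mathcal H_d$. -/

import Mathlib

open scoped LinearAlgebra.Projectivization ContDiff Topology

noncomputable section

namespace ProjDyn

/-- The vector space `ℂ^(k+1)`. -/
abbrev E (k : ℕ) : Type := Fin (k + 1) → ℂ

/-- The complex projective space `ℙ^k`. -/
abbrev P (k : ℕ) : Type := ℙ ℂ (E k)

/-- The usual topology of `ℙ^k`, the quotient topology from `ℂ^(k+1) ∖ {0}`. -/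
instance instTopologicalSpaceP (k : ℕ) : TopologicalSpace (P k) :=
  TopologicalSpace.coinduced (Projectivization.mk' ℂ : {v : E k // v ≠ 0} → P k) inferInstance

/-! ### Endomorphisms of `ℙ^k` of degree `d` -/

/-- `(k+1)`-tuples of homogeneous polynomials of degree `d` in `k+1` variables whose only common
zero is the origin. -/
def Lift (k d : ℕ) : Type :=
  {F : Fin (k + 1) → MvPolynomial (Fin (k + 1)) ℂ //
    (∀ i, (F i).IsHomogeneous d) ∧
      ∀ x : E k, (∀ i, MvPolynomial.eval x (F i) = 0) → x = 0}

/-- The topology of (finitely many) coefficients on the space of tuples. -/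
instance instTopologicalSpaceLift (k d : ℕ) : TopologicalSpace (Lift k d) :=
  TopologicalSpace.induced
    (fun F => fun (i : Fin (k + 1)) (m : Fin (k + 1) →₀ ℕ) => MvPolynomial.coeff m (F.1 i))
    inferInstance

theorem eval_smul_of_isHomogeneous {k d : ℕ} {p : MvPolynomial (Fin (k + 1)) ℂ}
    (hp : p.IsHomogeneous d) (t : ℂ) (x : E k) :
    MvPolynomial.eval (t • x) p = t ^ d * MvPolynomial.eval x p := by
  rw [MvPolynomial.eval_eq, MvPolynomial.eval_eq, Finset.mul_sum]
  refine Finset.sum_congr rfl fun m hm => ?_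
  have h : ∑ i ∈ m.support, m i = d := by
    have := hp (MvPolynomial.mem_support_iff.1 hm)
    simpa [Finsupp.weight_apply, Finsupp.sum] using this
  simp only [Pi.smul_apply, smul_eq_mul, mul_pow, Finset.prod_mul_distrib,
    Finset.prod_pow_eq_pow_sum, h]
  ring

/-- The map `[x_0 : ... : x_k] ↦ [F_0(x) : ... : F_k(x)]` of `ℙ^k`. -/
def Lift.map {k d : ℕ} (F : Lift k d) : P k → P k :=
  Projectivization.lift
    (fun v => Projectivization.mk ℂ (fun i => MvPolynomial.eval v.1 (F.1 i))
      (fun h => v.2 (F.2.2 v.1 (fun i => congrFun h i))))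
    (by
      rintro ⟨a, ha⟩ ⟨b, hb⟩ t hab
      simp only at hab
      have ht : t ≠ 0 := by
        rintro rfl
        exact ha (by simpa using hab)
      refine (Projectivization.mk_eq_mk_iff' ℂ _ _ _ _).2 ⟨t ^ d, ?_⟩
      funext i
      simp only [Pi.smul_apply, smul_eq_mul, hab]
      rw [eval_smul_of_isHomogeneous (F.2.1 i)])

/-- The set of (holomorphic) endomorphisms of `ℙ^k` of algebraic degree `d`. -/
def HolEnd (k d : ℕ) : Type := {f : P k → P k // ∃ F : Lift k d, F.map = f}

/-- The endomorphism given by a tuple of homogeneous polynomials. -/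
def Lift.toHolEnd {k d : ℕ} (F : Lift k d) : HolEnd k d := ⟨F.map, F, rfl⟩

/-- The usual topology on the space of endomorphisms of degree `d`: the quotient of the topology
of coefficients. As two tuples give the same endomorphism exactly when they are proportional
(for `k ≥ 1`), it is the topology of this space as an open subset of a projective space. -/
instance instTopologicalSpaceHolEnd (k d : ℕ) : TopologicalSpace (HolEnd k d) :=
  TopologicalSpace.coinduced (Lift.toHolEnd : Lift k d → HolEnd k d) inferInstance

/-! ### Differential forms and currents on `ℙ^k` -/

/-- Smooth real differential `n`-forms on `ℙ^k`. They are described by their pull-backs to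
`ℂ^(k+1) ∖ {0}`, which are exactly the smooth forms that are horizontal (zero as soon as one
of the arguments is tangent to the fibre `ℂ x`) and invariant under all homotheties.
The value at the origin carries no information and is fixed to be `0`. -/
def Form (k n : ℕ) : Submodule ℝ (E k → E k [⋀^Fin n]→L[ℝ] ℝ) where
  carrier := {φ | ContDiffOn ℝ ∞ φ {0}ᶜ ∧ φ 0 = 0 ∧
    (∀ x : E k, x ≠ 0 → ∀ v : Fin n → E k, (∃ i, ∃ c : ℂ, v i = c • x) → φ x v = 0) ∧
    (∀ c : ℂ, c ≠ 0 → ∀ x : E k, x ≠ 0 → ∀ v : Fin n → E k,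
      φ (c • x) (fun i => c • v i) = φ x v)}
  zero_mem' := ⟨contDiffOn_const, rfl, fun _ _ _ _ => rfl, fun _ _ _ _ _ => rfl⟩
  add_mem' := by
    rintro φ η ⟨h1, h2, h3, h4⟩ ⟨g1, g2, g3, g4⟩
    refine ⟨h1.add g1, by simp [h2, g2], fun x hx v hv => ?_, fun c hc x hx v => ?_⟩
    · simp [h3 x hx v hv, g3 x hx v hv]
    · simp [h4 c hc x hx v, g4 c hc x hx v]
  smul_mem' := by
    rintro r φ ⟨h1, h2, h3, h4⟩
    refine ⟨h1.const_smul r, by simp [h2], fun x hx v hv => ?_, fun c hc x hx v => ?_⟩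
    · simp [h3 x hx v hv]
    · simp [h4 c hc x hx v]

/-- Real currents of (real) dimension `n` on `ℙ^k`: linear forms on the space of smooth
`n`-forms that are continuous for the `C^∞` topology (the space `ℙ^k` being compact, all forms
are test forms). The topology is given by the `C^N` norms over the unit sphere of `ℂ^(k+1)`. -/
structure Current (k n : ℕ) where
  /-- the underlying linear form -/
  toLinearMap : Form k n →ₗ[ℝ] ℝ
  continuous' : ∃ (N : ℕ) (C : ℝ), ∀ (φ : Form k n) (B : ℝ),
    (∀ j ≤ N, ∀ x : E k, ‖x‖ = 1 → ‖iteratedFDeriv ℝ j φ.1 x‖ ≤ B) →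
      |toLinearMap φ| ≤ C * B

/-- A current is closed if it vanishes on exact forms `η = dψ`. -/
def Current.IsClosed {k : ℕ} : {n : ℕ} → Current k n → Prop
  | 0, _ => True
  | n + 1, T => ∀ (ψ : Form k n) (η : Form k (n + 1)),
      (∀ x : E k, x ≠ 0 → η.1 x = extDeriv ψ.1 x) → T.toLinearMap η = 0

/-- A current of dimension `2l` has bidimension `(l,l)` if it vanishes on the `(p,q)` components
with `p ≠ q` of forms, that is, if it is invariant under the action of the rotations `e^{iθ}` of
the tangent spaces, which act on forms of bidegree `(p,q)` as multiplication
by `e^{i(p-q)θ}`. -/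
def Current.IsBidim {k l : ℕ} (T : Current k (l * 2)) : Prop :=
  ∀ c : ℂ, ‖c‖ = 1 → ∀ φ η : Form k (l * 2),
    (∀ (x : E k) (v : Fin (l * 2) → E k), η.1 x v = φ.1 x (fun i => c • v i)) →
      T.toLinearMap η = T.toLinearMap φ

/-- The form `dx₁ ∧ dy₁ ∧ ... ∧ dx_l ∧ dy_l` on `ℂ^l`. -/
def stdVol (l : ℕ) (v : Fin (l * 2) → Fin l → ℂ) : ℝ :=
  Matrix.det (Matrix.of fun a b : Fin (l * 2) =>
    if (finProdFinEquiv.symm b).2 = 0 then (v a (finProdFinEquiv.symm b).1).re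
    else (v a (finProdFinEquiv.symm b).1).im)

/-- The convex cone of strongly positive `(l,l)`-covectors: it is generated by the
`iα₁ ∧ \bar α₁ ∧ ... ∧ iα_l ∧ \bar α_l`, where the `α_j` are `ℂ`-linear forms, that is,
by the pull-backs of the volume form of `ℂ^l` under the `ℂ`-linear maps
`A = (α₁, ..., α_l)`. -/
def strongPosCone (k l : ℕ) : AddSubmonoid (E k [⋀^Fin (l * 2)]→L[ℝ] ℝ) :=
  AddSubmonoid.closure {η | ∃ (r : ℝ) (A : E k →ₗ[ℂ] (Fin l → ℂ)), 0 ≤ r ∧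
    ∀ v, η v = r * stdVol l (fun i => A (v i))}

/-- A current of bidimension `(l,l)` is positive if it is non-negative on the forms which are
strongly positive at every point. -/
def Current.IsPositive {k l : ℕ} (T : Current k (l * 2)) : Prop :=
  T.IsBidim ∧ ∀ φ : Form k (l * 2), (∀ x : E k, x ≠ 0 → φ.1 x ∈ strongPosCone k l) →
    0 ≤ T.toLinearMap φ

/-- The support of `T` is contained in the (closed) set `A`. -/
def Current.IsSupportedIn {k n : ℕ} (T : Current k n) (A : Set (P k)) : Prop :=
  ∀ φ : Form k n, (∃ O : Set (P k), IsOpen O ∧ A ⊆ O ∧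
    ∀ (x : E k) (hx : x ≠ 0), Projectivization.mk ℂ x hx ∈ O → φ.1 x = 0) →
      T.toLinearMap φ = 0

/-- `A` supports a (nonzero) positive closed current of bidimension `(l,l)`. -/
def SupportsPositiveClosedCurrent {k : ℕ} (A : Set (P k)) (l : ℕ) : Prop :=
  ∃ T : Current k (l * 2), T.toLinearMap ≠ 0 ∧ T.IsPositive ∧ T.IsClosed ∧ T.IsSupportedIn A

/-- `A` is of dimension `l`: it supports a positive closed current of bidimension `(l,l)`, but
none of bidimension `(l',l')` with `l' > l`. -/
def HasDimension {k : ℕ} (A : Set (P k)) (l : ℕ) : Prop :=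
  SupportsPositiveClosedCurrent A l ∧ ∀ l', l < l' → ¬ SupportsPositiveClosedCurrent A l'

/-! ### Attracting sets and small topological degree -/

/-- `U` is a trapping region: it is open and `f(U)` is relatively compact in `U`. -/
def IsTrappingRegion {k : ℕ} (f : P k → P k) (U : Set (P k)) : Prop :=
  IsOpen U ∧ IsCompact (closure (f '' U)) ∧ closure (f '' U) ⊆ U

/-- `U` is a trapping region for the attracting set `A = ⋂ f^n(U)`. -/
def IsTrappingRegionFor {k : ℕ} (f : P k → P k) (U A : Set (P k)) : Prop :=
  IsTrappingRegion f U ∧ A = ⋂ n : ℕ, f^[n] '' U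

/-- `A` is an attracting set of `f`. -/
def IsAttractingSet {k : ℕ} (f : P k → P k) (A : Set (P k)) : Prop :=
  ∃ U, IsTrappingRegionFor f U A

/-- The multiplicity of `f` at `y` (its local topological degree): the maximal number of
preimages in a small neighbourhood of `y` of the points close to `f(y)`. -/
def mult {k : ℕ} (f : P k → P k) (y : P k) : ℕ∞ :=
  ⨅ W ∈ 𝓝 y, Filter.limsup (fun q => (f ⁻¹' {q} ∩ W).encard) (𝓝 (f y))

/-- The number of preimages of `p` under `f` in `U`, counted with multiplicity. -/
def numPreimages {k : ℕ} (f : P k → P k) (U : Set (P k)) (p : P k) : ENNReal :=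
  ∑' y : ↥(f ⁻¹' {p} ∩ U), (mult f y : ENNReal)

/-- `f`, of algebraic degree `d`, is asymptotically of small topological degree on the trapping
region `U` of `A`: with `l` the dimension of `A`, every `p ∈ f(U)` satisfies
`limsup (card (f^{-n}(p) ∩ U))^{1/n} < d^l`. -/
def IsAsymptoticallySmall {k d : ℕ} (f : HolEnd k d) (U A : Set (P k)) : Prop :=
  IsTrappingRegionFor f.1 U A ∧ ∃ l : ℕ, HasDimension A l ∧ ∀ p ∈ f.1 '' U,
    Filter.limsup (fun n : ℕ => numPreimages (f.1^[n]) U p ^ (1 / (n : ℝ))) Filter.atTop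
      < (d : ENNReal) ^ l

/-- `f` is of small topological degree on the attracting set `A`. -/
def IsSmallTopDegreeOn {k d : ℕ} (f : HolEnd k d) (A : Set (P k)) : Prop :=
  IsAttractingSet f.1 A ∧ ∃ U, IsAsymptoticallySmall f U A

end ProjDyn

end

noncomputable section

namespace ProjDyn

/-! ### Zeros of holomorphic families: continuation and the maximum principle -/

section LocalDegree

open Set Filter Metric

variable {V : Type*} [NormedAddCommGroup V] [NormedSpace ℂ V] [FiniteDimensional ℂ V]

/-! The topology of `HolEnd` is a quotient topology, so it suffices to perturb a homogeneous lift
`F`. Let `U` be the trapping region of the attracting set `A` of `F`, of dimension `l`. A slightly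
smaller region `U'` must be shown to trap all nearby `F'`, with the same growth bound, and the new
attracting set `A'` must be shown to have dimension `l` as well.

Growth (`exists_stable_trappingRegion`). The limsup condition gives, at each point `p`, one time `n`
and some `c < d ^ l` such that `p` has at most `c ^ n` preimages of order `n` in `U`. The number of
preimages in a compact set, counted with multiplicity, is upper semicontinuous in the map and the
point jointly (`IsLift.eventually_numPreimages_le`). By compactness finitely many times serve for
all points and all nearby maps, and counting fibrewise along compositions gives a bound `C' * Λ ^ m`
with `Λ < d ^ l`.

The semicontinuity is a local statement about holomorphic maps, obtained on lifts to `ℂ^(k+1)`. Its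
core is a Rouché-type inequality (`encard_zeros_add_le`). Instead of a degree theory it uses the
maximum principle: non-degenerate zeros of a family `H (t, ·)` that cannot leave through the
boundary continue holomorphically in `t`, and the product of their Jacobians divided by `t ^ m` has
no interior maximum (`not_injective_of_no_zeros_near`). Sard's theorem supplies the regular values.

Dimension (`SupportsPositiveClosedCurrent.iInter_image`). Let `T` be a positive closed current of
bidimension `(l,l)` supported in a trapping region of a map `g` of degree `D`. The normalized
push-forwards `D ^ (-n * l) (g^n)_* T` all have the same mass against the power of the Fubini–Study
form `ω`, since `g^* ω - D ω` is the differential of a form that descends to projective space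
(`IsLift.apply_pullback_fubiniStudy`). Positive currents have order zero with a bound given by that
mass (`exists_order_zero_bound`), so a nonzero limit exists, and it lives on the attracting set. As
`A ⊆ U'` and `A' ⊆ U`, pushing by `F'` carries currents from `A` to `A'`, and pushing by `F` carries
them back. Hence the two dimensions agree. -/

theorem contDiff_continuousLinearMap_det {n : WithTop ℕ∞} :
    ContDiff ℂ n (fun A : V →L[ℂ] V => A.det) := by
  let b := Module.finBasis ℂ V
  have h : (fun A : V →L[ℂ] V => A.det) = fun A => Matrix.det
      (Matrix.of fun i j => LinearMap.toContinuousLinearMap (b.coord i) (A (b j))) := by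
    funext A
    rw [ContinuousLinearMap.det, ← LinearMap.det_toMatrix b]
    congr 1
    ext i j
    simp [LinearMap.toMatrix_apply]
  rw [h]
  simp only [Matrix.det_apply]
  refine ContDiff.sum fun σ _ => ContDiff.const_smul _ ?_
  refine contDiff_prod fun i _ => ?_
  simp only [Matrix.of_apply]
  exact (ContinuousLinearMap.contDiff _).comp (contDiff_id.clm_apply contDiff_const)

/-- The Jacobian determinant in the second variable. -/
def jac (H : ℂ × V → V) (z : ℂ × V) : ℂ :=
  ((fderiv ℂ H z).comp (ContinuousLinearMap.inr ℂ ℂ V)).det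

theorem contDiff_jac {H : ℂ × V → V} (hH : ContDiff ℂ ∞ H) : ContDiff ℂ ∞ (jac H) := by
  unfold jac
  refine contDiff_continuousLinearMap_det.comp ?_
  exact (hH.fderiv_right (m := ∞) le_rfl).clm_comp contDiff_const

theorem jac_eq {H : ℂ × V → V} (hH : ContDiff ℂ ∞ H) (t : ℂ) (x : V) :
    jac H (t, x) = (fderiv ℂ (fun y => H (t, y)) x).det := by
  unfold jac
  congr 1
  have h1 : HasFDerivAt H (fderiv ℂ H (t, x)) (t, x) :=
    (hH.differentiable (by simp)).differentiableAt.hasFDerivAt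
  have := h1.comp x (hasFDerivAt_prodMk_right t x)
  exact this.fderiv.symm

theorem isInvertible_of_det_ne_zero {A : V →L[ℂ] V} (h : A.det ≠ 0) : A.IsInvertible :=
  ⟨A.toContinuousLinearEquivOfDetNeZero h, by ext; rfl⟩

/-- A zero which is non-degenerate in the second variable persists as a curve, locally unique. -/
theorem exists_curve_of_jac_ne_zero {H : ℂ × V → V} (hH : ContDiff ℂ ∞ H) {z : ℂ × V}
    (hz : H z = 0) (hj : jac H z ≠ 0) :
    ∃ φ : ℂ → V, φ z.1 = z.2 ∧ (∀ᶠ t in 𝓝 z.1, H (t, φ t) = 0) ∧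
      ContinuousAt φ z.1 ∧ (∀ᶠ w in 𝓝 z, H w = 0 → φ w.1 = w.2) := by
  have : CompleteSpace V := FiniteDimensional.complete ℂ V
  have hd : HasStrictFDerivAt H (fderiv ℂ H z) z :=
    hH.contDiffAt.hasStrictFDerivAt (by simp)
  have hi := isInvertible_of_det_ne_zero hj
  refine ⟨hd.implicitFunctionOfProdDomain hi, ?_, ?_, ?_, ?_⟩
  · exact (hd.eventually_apply_eq_iff_implicitFunctionOfProdDomain hi).self_of_nhds.mp rfl
  · filter_upwards [hd.eventually_apply_implicitFunctionOfProdDomain hi] with t ht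
    rw [ht, hz]
  · exact (hd.hasStrictFDerivAt_implicitFunctionOfProdDomain hi).continuousAt
  · filter_upwards [hd.eventually_apply_eq_iff_implicitFunctionOfProdDomain hi] with w hw h
    exact hw.1 (h.trans hz.symm)

/-- The persistent curve of zeros is holomorphic. -/
theorem exists_holomorphic_curve {H : ℂ × V → V} (hH : ContDiff ℂ ∞ H) {z : ℂ × V}
    (hz : H z = 0) (hj : jac H z ≠ 0) :
    ∃ φ : ℂ → V, φ z.1 = z.2 ∧ (∀ᶠ t in 𝓝 z.1, H (t, φ t) = 0) ∧
      (∀ᶠ t in 𝓝 z.1, DifferentiableAt ℂ φ t) := by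
  have : CompleteSpace V := FiniteDimensional.complete ℂ V
  obtain ⟨φ, h0, h1, h2, h3⟩ := exists_curve_of_jac_ne_zero hH hz hj
  refine ⟨φ, h0, h1, ?_⟩
  have hcont : ContinuousAt (fun t => (t, φ t)) z.1 := continuousAt_id.prodMk h2
  have hz' : (z.1, φ z.1) = z := by rw [h0]
  have h3' : ∀ᶠ t in 𝓝 z.1, ∀ᶠ w in 𝓝 (t, φ t), H w = 0 → φ w.1 = w.2 := by
    have : ∀ᶠ w in 𝓝 (z.1, φ z.1), ∀ᶠ w' in 𝓝 w, H w' = 0 → φ w'.1 = w'.2 := by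
      rw [hz']; exact h3.eventually_nhds
    exact hcont.eventually this
  have hj' : ∀ᶠ t in 𝓝 z.1, jac H (t, φ t) ≠ 0 := by
    have : ContinuousAt (fun t => jac H (t, φ t)) z.1 :=
      ((contDiff_jac hH).continuous.continuousAt).comp hcont
    exact this.eventually_ne (by rw [hz']; exact hj)
  filter_upwards [h1, h3', hj'] with t ht1 ht3 htj
  -- The implicit function theorem gives differentiability only at its base point, so it is applied
  -- again at each nearby zero `(t, φ t)`; local uniqueness identifies the new curve with `φ`.
  have hd : HasStrictFDerivAt H (fderiv ℂ H (t, φ t)) (t, φ t) :=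
    hH.contDiffAt.hasStrictFDerivAt (by simp)
  have hi := isInvertible_of_det_ne_zero htj
  have hψ := hd.hasStrictFDerivAt_implicitFunctionOfProdDomain hi
  have hψ0 : hd.implicitFunctionOfProdDomain hi t = φ t :=
    (hd.eventually_apply_eq_iff_implicitFunctionOfProdDomain hi).self_of_nhds.mp rfl
  refine (hψ.hasFDerivAt.congr_of_eventuallyEq ?_).differentiableAt
  have hc2 : Tendsto (fun s => (s, hd.implicitFunctionOfProdDomain hi s)) (𝓝 t)
      (𝓝 (t, φ t)) := by
    have := (continuousAt_id (x := t)).prodMk (hψ.continuousAt)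
    simpa [ContinuousAt, hψ0] using this
  filter_upwards [hd.eventually_apply_implicitFunctionOfProdDomain hi,
    hc2.eventually ht3] with s hs1 hs2
  exact hs2 (by rw [hs1, ht1])

/-- Two zeros of `H (t, ·)` near a non-degenerate one coincide. -/
theorem eventually_unique_of_jac_ne_zero {H : ℂ × V → V} (hH : ContDiff ℂ ∞ H) {z : ℂ × V}
    (hz : H z = 0) (hj : jac H z ≠ 0) :
    ∃ N ∈ 𝓝 z, ∀ t x y, (t, x) ∈ N → (t, y) ∈ N → H (t, x) = 0 → H (t, y) = 0 → x = y := by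
  obtain ⟨φ, -, -, -, h3⟩ := exists_curve_of_jac_ne_zero hH hz hj
  exact ⟨_, h3, fun t x y hx hy h1 h2 => (hx h1).symm.trans (hy h2)⟩

/-- The tuples of distinct zeros with Jacobian product bounded below form a closed set. -/
theorem isClosed_injective_zeros {H : ℂ × V → V} (hH : ContDiff ℂ ∞ H) {n : ℕ} {ε : ℝ}
    (hε : 0 < ε) {W : Set V} (hW : IsClosed W) :
    IsClosed {p : ℂ × (Fin n → V) | (∀ i, p.2 i ∈ W ∧ H (p.1, p.2 i) = 0) ∧
      Function.Injective p.2 ∧ ε ≤ ∏ i, ‖jac H (p.1, p.2 i)‖} := by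
  have hcH := hH.continuous
  have hcj := (contDiff_jac hH).continuous
  refine isClosed_of_closure_subset fun p hp => ?_
  have hcl : IsClosed {p : ℂ × (Fin n → V) | (∀ i, p.2 i ∈ W ∧ H (p.1, p.2 i) = 0) ∧
      ε ≤ ∏ i, ‖jac H (p.1, p.2 i)‖} := by
    simp only [Set.ofPred_and, Set.ofPred_forall]
    refine IsClosed.inter (isClosed_iInter fun i => IsClosed.inter ?_ ?_) ?_
    · exact hW.preimage (by fun_prop)
    · exact isClosed_eq (by fun_prop) continuous_const
    · exact isClosed_le continuous_const (by fun_prop)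
  have h1 := closure_minimal (t := {p : ℂ × (Fin n → V) | (∀ i, p.2 i ∈ W ∧ H (p.1, p.2 i) = 0) ∧
      ε ≤ ∏ i, ‖jac H (p.1, p.2 i)‖}) (fun q hq => ⟨hq.1, hq.2.2⟩) hcl hp
  refine ⟨h1.1, fun a b hab => ?_, h1.2⟩
  -- Two coordinates that merge in the limit would be distinct zeros arbitrarily close to a zero
  -- which the bound `ε` keeps non-degenerate, contradicting local uniqueness.
  by_contra hne
  have hja : jac H (p.1, p.2 a) ≠ 0 := by
    intro h0
    have : ∏ i, ‖jac H (p.1, p.2 i)‖ = 0 := Finset.prod_eq_zero (Finset.mem_univ a) (by simp [h0])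
    linarith [h1.2]
  obtain ⟨N, hN, hu⟩ := eventually_unique_of_jac_ne_zero hH (h1.1 a).2 hja
  have ha : Tendsto (fun q : ℂ × (Fin n → V) => (q.1, q.2 a)) (𝓝 p) (𝓝 (p.1, p.2 a)) :=
    Continuous.tendsto (by fun_prop) p
  have hb : Tendsto (fun q : ℂ × (Fin n → V) => (q.1, q.2 b)) (𝓝 p) (𝓝 (p.1, p.2 a)) := by
    rw [hab]; exact Continuous.tendsto (f := fun q : ℂ × (Fin n → V) => (q.1, q.2 b)) (by fun_prop) p
  obtain ⟨q, ⟨hq1, hq2⟩, hq⟩ := mem_closure_iff_nhds.1 hp _ (inter_mem (ha hN) (hb hN))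
  exact hne (hq.2.1 (hu _ _ _ hq1 hq2 (hq.1 a).2 (hq.1 b).2))

/-- If there are no `n` distinct zeros for parameters close to `0`, there are no `n` distinct
non-degenerate zeros for any parameter, as long as no zero crosses the boundary of `W`. -/
theorem not_injective_of_no_zeros_near {H : ℂ × V → V} (hH : ContDiff ℂ ∞ H) {n : ℕ}
    {W : Set V} (hW : IsCompact W) {R : ℝ}
    (hb : ∀ t : ℂ, ‖t‖ < R → ∀ x ∈ W, H (t, x) = 0 → x ∈ interior W)
    {δ : ℝ} (hδ : 0 < δ)
    (h0 : ∀ t : ℂ, ‖t‖ < δ → ∀ x : Fin n → V, (∀ i, x i ∈ W ∧ H (t, x i) = 0) →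
      ¬ Function.Injective x)
    {t₁ : ℂ} (ht₁ : ‖t₁‖ < R) {x₁ : Fin n → V} (hx₁ : ∀ i, x₁ i ∈ W ∧ H (t₁, x₁ i) = 0)
    (hj₁ : ∀ i, jac H (t₁, x₁ i) ≠ 0) : ¬ Function.Injective x₁ := by
  intro hinj₁
  have hcH := hH.continuous
  have hcj := (contDiff_jac hH).continuous
  obtain ⟨r, hr1, hr2⟩ := exists_between ht₁
  have hr0 : 0 < r := (norm_nonneg _).trans_lt hr1
  have ht₁δ : δ ≤ ‖t₁‖ := by
    by_contra h
    exact h0 t₁ (not_le.1 h) x₁ hx₁ hinj₁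
  have ht₁0 : 0 < ‖t₁‖ := hδ.trans_le ht₁δ
  set D : ℂ × (Fin n → V) → ℝ := fun p => ∏ i, ‖jac H (p.1, p.2 i)‖ with hD
  have hDc : Continuous D := by simp only [hD]; fun_prop
  have hD0 : ∀ p, 0 ≤ D p := fun p => Finset.prod_nonneg fun _ _ => norm_nonneg _
  have hD₁ : 0 < D (t₁, x₁) := Finset.prod_pos fun i _ => norm_pos_iff.2 (hj₁ i)
  -- the product domain
  have hKc : IsCompact (closedBall (0 : ℂ) r ×ˢ (Set.univ.pi fun _ : Fin n => W)) :=
    (isCompact_closedBall _ _).prod (isCompact_univ_pi fun _ => hW)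
  obtain ⟨C, hC⟩ : ∃ C, ∀ p ∈ closedBall (0 : ℂ) r ×ˢ (Set.univ.pi fun _ : Fin n => W), D p ≤ C := by
    obtain ⟨C, hC⟩ := hKc.bddAbove_image hDc.continuousOn
    exact ⟨C, fun p hp => hC (mem_image_of_mem _ hp)⟩
  -- It is shown that `D / ‖t‖ ^ m` over injective tuples of zeros attains its maximum on `‖t‖ = r`.
  -- Letting `m` tend to infinity then forces `D (t₁, x₁) = 0`.
  have key : ∀ m : ℕ, D (t₁, x₁) ≤ C * (‖t₁‖ / r) ^ m := by
    intro m
    -- The threshold is such that a tuple with `D < ε` has `Φ < ε / δ ^ m = Φ (t₁, x₁)`, because `δ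
    -- ≤ ‖t‖` for every injective tuple. Discarding such tuples makes the domain compact without
    -- losing the maximum.
    set ε : ℝ := D (t₁, x₁) * (δ / ‖t₁‖) ^ m with hε
    have hε0 : 0 < ε := by positivity
    set Q : Set (ℂ × (Fin n → V)) :=
      {p | (∀ i, p.2 i ∈ W ∧ H (p.1, p.2 i) = 0) ∧ Function.Injective p.2 ∧
        ε ≤ ∏ i, ‖jac H (p.1, p.2 i)‖} ∩ {p | ‖p.1‖ ≤ r} with hQ
    have hQcl : IsClosed Q := (isClosed_injective_zeros hH hε0 hW.isClosed).inter
      (isClosed_le (by fun_prop) continuous_const)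
    have hQsub : Q ⊆ closedBall (0 : ℂ) r ×ˢ (Set.univ.pi fun _ : Fin n => W) :=
      fun p hp => ⟨by simpa using hp.2, fun i _ => (hp.1.1 i).1⟩
    have hQc : IsCompact Q := hKc.of_isClosed_subset hQcl hQsub
    have hQδ : ∀ p ∈ Q, δ ≤ ‖p.1‖ := fun p hp => by
      by_contra h
      exact h0 p.1 (not_le.1 h) p.2 hp.1.1 hp.1.2.1
    have hQ1 : (t₁, x₁) ∈ Q := by
      refine ⟨⟨hx₁, hinj₁, ?_⟩, hr1.le⟩
      have : (δ / ‖t₁‖) ^ m ≤ 1 := pow_le_one₀ (by positivity) ((div_le_one ht₁0).2 ht₁δ)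
      calc ε ≤ D (t₁, x₁) * 1 := by rw [hε]; gcongr
        _ = _ := mul_one _
    set Φ : ℂ × (Fin n → V) → ℝ := fun p => D p / ‖p.1‖ ^ m with hΦ
    have hΦc : ContinuousOn Φ Q := by
      refine hDc.continuousOn.div (by fun_prop) fun p hp => ?_
      have := hδ.trans_le (hQδ p hp)
      positivity
    obtain ⟨p₀, hp₀, hmax₀⟩ := hQc.exists_isMaxOn ⟨_, hQ1⟩ hΦc
    -- the maximizers
    have hQ'c : IsCompact (Q ∩ Φ ⁻¹' {Φ p₀}) := by
      refine hQc.of_isClosed_subset ?_ inter_subset_left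
      exact hΦc.preimage_isClosed_of_isClosed hQcl isClosed_singleton
    -- Among the maximizers of `Φ`, one with the largest `‖t‖`; this is contradicted below if it is
    -- interior.
    obtain ⟨p, ⟨hpQ, hpΦ⟩, hpmax⟩ := hQ'c.exists_isMaxOn ⟨p₀, hp₀, rfl⟩
      (f := fun p : ℂ × (Fin n → V) => ‖p.1‖) (by fun_prop)
    have hpΦ' : Φ p = Φ p₀ := hpΦ
    have hΦ1 : Φ (t₁, x₁) ≤ Φ p := hpΦ' ▸ hmax₀ hQ1
    -- all tuples of zeros are dominated
    have hall : ∀ q : ℂ × (Fin n → V), (∀ i, q.2 i ∈ W ∧ H (q.1, q.2 i) = 0) →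
        Function.Injective q.2 → ‖q.1‖ ≤ r → Φ q ≤ Φ p ∧ (Φ q = Φ p → ‖q.1‖ ≤ ‖p.1‖) := by
      intro q hq1 hq2 hq3
      have hqδ : δ ≤ ‖q.1‖ := by
        by_contra h
        exact h0 q.1 (not_le.1 h) q.2 hq1 hq2
      by_cases hq4 : ε ≤ D q
      · have hqQ : q ∈ Q := ⟨⟨hq1, hq2, hq4⟩, hq3⟩
        exact ⟨hpΦ' ▸ hmax₀ hqQ, fun h => hpmax ⟨hqQ, h.trans hpΦ'⟩⟩
      · have hlt : Φ q < Φ p := by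
          have hq0 : 0 < ‖q.1‖ := hδ.trans_le hqδ
          calc Φ q < ε / ‖q.1‖ ^ m := by
                simp only [hΦ]; exact div_lt_div_of_pos_right (not_le.1 hq4) (by positivity)
            _ ≤ ε / δ ^ m := by gcongr
            _ = Φ (t₁, x₁) := by
                simp only [hΦ, hε, div_pow]; field_simp
            _ ≤ Φ p := hΦ1
        exact ⟨hlt.le, fun h => absurd h hlt.ne⟩
    -- At an interior maximizer the zeros continue holomorphically, and `J` is a holomorphic
    -- function whose modulus has a local maximum. Its modulus is then locally constant, so
    -- maximizers with larger `‖t‖` exist.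
    have hpr : ‖p.1‖ = r := by
      refine le_antisymm hpQ.2 (not_lt.1 fun hlt => ?_)
      have hp0 : 0 < ‖p.1‖ := hδ.trans_le (hQδ p hpQ)
      have hDp : 0 < D p := hε0.trans_le hpQ.1.2.2
      have hjp : ∀ i, jac H (p.1, p.2 i) ≠ 0 := fun i h => by
        have : D p = 0 := Finset.prod_eq_zero (Finset.mem_univ i) (by simp [h])
        linarith
      choose φ hφ0 hφ1 hφ2 using fun i =>
        exists_holomorphic_curve hH (hpQ.1.1 i).2 (hjp i)
      simp only at hφ0 hφ1 hφ2
      have hφc : ∀ i, ContinuousAt (φ i) p.1 := fun i => (hφ2 i).self_of_nhds.continuousAt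
      have hφc' : ContinuousAt (fun t => fun i => φ i t) p.1 := continuousAt_pi.2 hφc
      have hφp : (fun i => φ i p.1) = p.2 := funext hφ0
      -- eventually a tuple of zeros
      have e1 : ∀ᶠ t in 𝓝 p.1, ∀ i, φ i t ∈ W := by
        refine eventually_all.2 fun i => ?_
        have : interior W ∈ 𝓝 (φ i p.1) := by
          rw [hφ0]
          exact isOpen_interior.mem_nhds (hb _ (hlt.trans hr2) _ (hpQ.1.1 i).1 (hpQ.1.1 i).2)
        filter_upwards [(hφc i) this] with t ht using interior_subset ht
      have e2 : ∀ᶠ t in 𝓝 p.1, ∀ i, H (t, φ i t) = 0 := eventually_all.2 hφ1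
      have e3 : ∀ᶠ t in 𝓝 p.1, Function.Injective fun i => φ i t := by
        have : ∀ a b : Fin n, ∀ᶠ t in 𝓝 p.1, φ a t = φ b t → a = b := by
          intro a b
          by_cases hab : a = b
          · exact Eventually.of_forall fun _ _ => hab
          · have hne : φ a p.1 ≠ φ b p.1 := by
              rw [hφ0, hφ0]; exact fun h => hab (hpQ.1.2.1 h)
            filter_upwards [((hφc a).sub (hφc b)).eventually_ne (sub_ne_zero.2 hne)] with t ht h
            exact absurd (sub_eq_zero.2 h) ht
        filter_upwards [eventually_all.2 fun a => eventually_all.2 (this a)] with t ht a b h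
        exact ht a b h
      have e4 : ∀ᶠ t in 𝓝 p.1, ‖t‖ < r :=
        (continuous_norm.tendsto p.1).eventually (Iio_mem_nhds hlt)
      have e5 : ∀ᶠ t in 𝓝 p.1, t ≠ 0 := continuousAt_id.eventually_ne (norm_pos_iff.1 hp0)
      have e6 : ∀ᶠ t in 𝓝 p.1, ∀ i, DifferentiableAt ℂ (φ i) t := eventually_all.2 hφ2
      set J : ℂ → ℂ := fun t => (∏ i, jac H (t, φ i t)) / t ^ m with hJ
      have hJn : ∀ t, ‖J t‖ = Φ (t, fun i => φ i t) := fun t => by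
        simp only [hJ, hΦ, hD, norm_div, norm_prod, norm_pow]
      have hJp : ‖J p.1‖ = Φ p := by rw [hJn, hφp]
      have hJd : ∀ᶠ t in 𝓝 p.1, DifferentiableAt ℂ J t := by
        filter_upwards [e5, e6] with t ht5 ht6
        refine DifferentiableAt.div ?_ (by fun_prop) (pow_ne_zero _ ht5)
        refine DifferentiableAt.fun_finsetProd fun i _ => ?_
        have h7 : DifferentiableAt ℂ (jac H) (t, φ i t) :=
          ((contDiff_jac hH).differentiable (by simp)).differentiableAt
        exact DifferentiableAt.comp (g := jac H) (f := fun t => (t, φ i t)) t h7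
          (differentiableAt_id.prodMk (ht6 i))
      have hJmax : IsLocalMax (norm ∘ J) p.1 := by
        filter_upwards [e1, e2, e3, e4] with t h1 h2 h3 h4
        simp only [Function.comp]
        rw [hJp, hJn]
        exact (hall (t, fun i => φ i t) (fun i => ⟨h1 i, h2 i⟩) h3 h4.le).1
      have hJc := Complex.norm_eventually_eq_of_isLocalMax hJd hJmax
      have hev := ((hJc.and e1).and (e2.and (e3.and e4)))
      -- move outwards
      have hout : Tendsto (fun s : ℝ => (1 + s : ℂ) * p.1) (𝓝[>] 0) (𝓝 p.1) := by
        have : Continuous fun s : ℝ => (1 + s : ℂ) * p.1 := by fun_prop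
        have h := this.tendsto 0
        simp only [Complex.ofReal_zero, add_zero, one_mul] at h
        exact h.mono_left nhdsWithin_le_nhds
      obtain ⟨s, hs, hs0⟩ := ((hout.eventually hev).and self_mem_nhdsWithin).exists
      obtain ⟨⟨g1, g2⟩, g3, g4, g5⟩ := hs
      have hle := (hall (_, fun i => φ i ((1 + s : ℂ) * p.1)) (fun i => ⟨g2 i, g3 i⟩) g4 g5.le).2
        (by rw [← hJn, g1, hJp])
      simp only [norm_mul] at hle
      have hs0' : (0 : ℝ) < s := hs0
      have : ‖(1 + s : ℂ)‖ = 1 + s := by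
        rw [← Complex.ofReal_one, ← Complex.ofReal_add, Complex.norm_real, Real.norm_of_nonneg]
        linarith
      rw [this] at hle
      nlinarith
    have h2 : Φ p ≤ C / r ^ m := by
      simp only [hΦ, hpr]
      gcongr
      exact hC p (hQsub hpQ)
    have h3 := hΦ1.trans h2
    simp only [hΦ] at h3
    rw [div_le_iff₀ (by positivity)] at h3
    calc D (t₁, x₁) ≤ C / r ^ m * ‖t₁‖ ^ m := h3
      _ = _ := by rw [div_pow]; ring
  have hlim : Tendsto (fun m : ℕ => C * (‖t₁‖ / r) ^ m) atTop (𝓝 (C * 0)) :=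
    (tendsto_pow_atTop_nhds_zero_of_lt_one (by positivity) ((div_lt_one hr0).2 hr1)).const_mul C
  have := ge_of_tendsto' hlim key
  linarith

end LocalDegree

/-! ### A Rouché-type inequality and Sard's theorem -/

section LocalDegree

open Set Filter Metric

variable {V : Type*} [NormedAddCommGroup V] [NormedSpace ℂ V] [FiniteDimensional ℂ V]

/-- If all zeros in `W` at the parameter `0` are non-degenerate, the number of zeros cannot
increase for parameters near `0`. -/
theorem eventually_not_injective {H : ℂ × V → V} (hH : ContDiff ℂ ∞ H) {W : Set V}
    (hW : IsCompact W) (hreg : ∀ x ∈ W, H (0, x) = 0 → jac H (0, x) ≠ 0) :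
    {x ∈ W | H (0, x) = 0}.Finite ∧
    ∀ n : ℕ, {x ∈ W | H (0, x) = 0}.encard < n → ∀ᶠ t in 𝓝 (0 : ℂ), ∀ x : Fin n → V,
      (∀ i, x i ∈ W ∧ H (t, x i) = 0) → ¬ Function.Injective x := by
  have hcH := hH.continuous
  -- Each `y` has a neighbourhood with at most one zero for small `t`, and with none unless `y` is
  -- itself a zero at `t = 0`. A finite subcover then injects nearby zeros into those at `0`.
  have hloc : ∀ y ∈ W, ∃ U ∈ 𝓝 y, ∃ T ∈ 𝓝 (0 : ℂ), ∀ t ∈ T, ∀ x ∈ U, H (t, x) = 0 →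
      (H (0, y) = 0 ∧ ∀ x' ∈ U, H (t, x') = 0 → x = x') := by
    intro y hy
    by_cases h0 : H (0, y) = 0
    · obtain ⟨N, hN, hu⟩ := eventually_unique_of_jac_ne_zero hH h0 (hreg y hy h0)
      obtain ⟨T, hT, U, hU, hTU⟩ := mem_nhds_prod_iff.1 hN
      exact ⟨U, hU, T, hT, fun t ht x hx h => ⟨h0, fun x' hx' h' =>
        hu t x x' (hTU ⟨ht, hx⟩) (hTU ⟨ht, hx'⟩) h h'⟩⟩
    · have : ∀ᶠ z in 𝓝 ((0 : ℂ), y), H z ≠ 0 := hcH.continuousAt.eventually_ne h0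
      obtain ⟨T, hT, U, hU, hTU⟩ := mem_nhds_prod_iff.1 this
      exact ⟨U, hU, T, hT, fun t ht x hx h => absurd h (hTU ⟨ht, hx⟩)⟩
  choose! U hU T hT hUT using hloc
  obtain ⟨s, hsW, hs⟩ := hW.elim_nhds_subcover U hU
  refine ⟨s.finite_toSet.subset fun x hx => ?_, fun n hn => ?_⟩
  · obtain ⟨y, hys, hxy⟩ := mem_iUnion₂.1 (hs hx.1)
    obtain ⟨h1, h2⟩ := hUT y (hsW y hys) 0 (mem_of_mem_nhds (hT y (hsW y hys))) x hxy hx.2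
    rw [h2 y (mem_of_mem_nhds (hU y (hsW y hys))) h1]
    exact hys
  · filter_upwards [(Filter.biInter_finset_mem s).2 fun y hy => hT y (hsW y hy)] with t ht x hx hinj
    have : ∀ i, ∃ y ∈ s, x i ∈ U y := fun i => by simpa using hs (hx i).1
    choose y hys hxy using this
    have hty : ∀ i, t ∈ T (y i) := fun i => mem_iInter₂.1 ht _ (hys i)
    have hyinj : Function.Injective y := fun i j hij =>
      hinj ((hUT (y i) (hsW _ (hys i)) t (hty i) (x i) (hxy i) (hx i).2).2 (x j)
        (by rw [hij]; exact hxy j) (hx j).2)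
    have h1 : (range y).encard = n := by
      rw [← image_univ, hyinj.encard_image]; simp
    have h2 : range y ⊆ {x ∈ W | H (0, x) = 0} := by
      rintro _ ⟨i, rfl⟩
      exact ⟨hsW _ (hys i), (hUT (y i) (hsW _ (hys i)) t (hty i) (x i) (hxy i) (hx i).2).1⟩
    exact absurd (encard_le_encard h2) (by rw [h1]; exact not_le.2 hn)

/-- Hermite interpolation: a map vanishing at given points with identity derivatives. -/
theorem exists_interpolation {n : ℕ} {x : Fin n → V} (hx : Function.Injective x) :
    ∃ P : V → V, ContDiff ℂ ∞ P ∧ ∀ i, P (x i) = 0 ∧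
      HasFDerivAt P (ContinuousLinearMap.id ℂ V) (x i) := by
  have : ∀ i j, ∃ ℓ : V →L[ℂ] ℂ, i ≠ j → ℓ (x j - x i) = 1 := by
    intro i j
    by_cases h : i = j
    · exact ⟨0, fun h' => absurd h h'⟩
    · obtain ⟨ℓ, hℓ⟩ := SeparatingDual.exists_eq_one (R := ℂ) (sub_ne_zero.2 (hx.ne (Ne.symm h)))
      exact ⟨ℓ, fun _ => hℓ⟩
  choose ℓ hℓ using this
  set ψ : Fin n → V → ℂ := fun j y => ∏ i ∈ Finset.univ.erase j, ℓ i j (y - x i) with hψ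
  have hψc : ∀ j, ContDiff ℂ ∞ (ψ j) := fun j => contDiff_prod fun i _ =>
    (ℓ i j).contDiff.comp (contDiff_id.sub contDiff_const)
  have hψ1 : ∀ j, ψ j (x j) = 1 := fun j => Finset.prod_eq_one fun i hi =>
    hℓ i j (Finset.ne_of_mem_erase hi)
  have hψ0 : ∀ i j, i ≠ j → ψ j (x i) = 0 := fun i j hij =>
    Finset.prod_eq_zero (Finset.mem_erase.2 ⟨hij, Finset.mem_univ i⟩) (by simp)
  -- The square makes the terms `j ≠ i` vanish to second order at `x i`, so only the `i`-th term
  -- contributes to the derivative there.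
  refine ⟨fun y => ∑ j, (ψ j y) ^ 2 • (y - x j), ?_, fun i => ⟨?_, ?_⟩⟩
  · exact ContDiff.sum fun j _ => ((hψc j).pow 2).smul (contDiff_id.sub contDiff_const)
  · refine Finset.sum_eq_zero fun j _ => ?_
    by_cases h : i = j
    · simp [h]
    · simp [hψ0 i j h]
  · have hterm : ∀ j ∈ (Finset.univ : Finset (Fin n)),
        HasFDerivAt (fun y => (ψ j y) ^ 2 • (y - x j))
        (if j = i then ContinuousLinearMap.id ℂ V else 0) (x i) := by
      intro j _
      have hd : HasFDerivAt (ψ j) (fderiv ℂ (ψ j) (x i)) (x i) :=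
        ((hψc j).differentiable (by simp)).differentiableAt.hasFDerivAt
      have h2 := (hd.pow 2).smul ((hasFDerivAt_id (𝕜 := ℂ) (x i)).sub_const (x j))
      refine h2.congr_fderiv ?_
      by_cases h : j = i
      · subst h
        simp only [if_true, hψ1]
        ext v; simp
      · ext v; simp [h, hψ0 i j (Ne.symm h)]
    have := HasFDerivAt.fun_sum hterm
    simpa using this

/-- The determinant vanishes exactly when `ε` is an eigenvalue of `-A`, and there are finitely many
of those. -/
theorem eventually_det_add_smul_ne_zero (A : V →L[ℂ] V) :
    ∀ᶠ ε in 𝓝[≠] (0 : ℂ), (A + ε • ContinuousLinearMap.id ℂ V).det ≠ 0 := by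
  have hfin : {μ : ℂ | Module.End.HasEigenvalue (-(A : V →ₗ[ℂ] V)) μ}.Finite :=
    Module.End.finite_hasEigenvalue _
  have h1 : {μ : ℂ | Module.End.HasEigenvalue (-(A : V →ₗ[ℂ] V)) μ} \ {0} ⊆ {0}ᶜ := fun x hx => hx.2
  have h2 : ({μ : ℂ | Module.End.HasEigenvalue (-(A : V →ₗ[ℂ] V)) μ} \ {0})ᶜ ∈ 𝓝 (0 : ℂ) :=
    (hfin.subset sdiff_subset).isClosed.isOpen_compl.mem_nhds (by simp)
  filter_upwards [mem_nhdsWithin_of_mem_nhds h2, self_mem_nhdsWithin] with ε hε hε0 hdet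
  refine hε ⟨?_, hε0⟩
  have hdet' : LinearMap.det ((A : V →ₗ[ℂ] V) + ε • LinearMap.id) = 0 := hdet
  obtain ⟨v, hv0, hv⟩ := (LinearMap.hasEigenvalue_zero_tfae ((A : V →ₗ[ℂ] V) + ε • LinearMap.id)).out 3 5 |>.1 hdet'
  refine Module.End.hasEigenvalue_of_hasEigenvector (x := v) ⟨?_, hv0⟩
  rw [Module.End.mem_eigenspace_iff]
  simp only [LinearMap.add_apply, LinearMap.smul_apply, LinearMap.id_apply] at hv
  simp only [LinearMap.neg_apply]
  exact (eq_neg_of_add_eq_zero_right hv).symm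

/-- Comparison of the number of zeros of `a` and of `a + b`. -/
theorem encard_zeros_add_le {a b : V → V} (ha : ContDiff ℂ ∞ a) (hb : ContDiff ℂ ∞ b)
    {W : Set V} (hW : IsCompact W) (hab : ∀ x ∈ W, x ∉ interior W → 2 * ‖b x‖ < ‖a x‖)
    (hreg : ∀ x ∈ W, a x = 0 → (fderiv ℂ a x).det ≠ 0) :
    {x ∈ W | a x = 0}.Finite ∧ {x ∈ W | a x + b x = 0}.encard ≤ {x ∈ W | a x = 0}.encard := by
  have hHc : ∀ b : V → V, ContDiff ℂ ∞ b → ContDiff ℂ ∞ (fun z : ℂ × V => a z.2 + z.1 • b z.2) :=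
    fun b hb => (ha.comp contDiff_snd).add (contDiff_fst.smul (hb.comp contDiff_snd))
  have hreg' : ∀ b : V → V, ContDiff ℂ ∞ b → ∀ x ∈ W, a x + (0 : ℂ) • b x = 0 →
      jac (fun z : ℂ × V => a z.2 + z.1 • b z.2) (0, x) ≠ 0 := by
    intro b hb x hx h
    rw [jac_eq (hHc b hb)]
    simp only [zero_smul, add_zero] at h ⊢
    exact hreg x hx h
  have hfin : {x ∈ W | a x = 0}.Finite := by
    simpa using (eventually_not_injective (hHc b hb) hW (hreg' b hb)).1
  refine ⟨hfin, ?_⟩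
  by_contra hlt
  rw [not_le] at hlt
  obtain ⟨N, hN⟩ : ∃ N : ℕ, {x ∈ W | a x = 0}.encard = N := ⟨_, hfin.encard_eq_coe_toFinset_card⟩
  have hN1 : ((N + 1 : ℕ) : ℕ∞) ≤ {x ∈ W | a x + b x = 0}.encard := by
    rw [hN] at hlt
    exact_mod_cast Order.add_one_le_of_lt hlt
  obtain ⟨S, hS, hScard⟩ := exists_subset_encard_eq hN1
  have hSfin : S.Finite := finite_of_encard_eq_coe hScard
  have hSn : S.ncard = N + 1 := by
    have := hSfin.cast_ncard_eq
    rw [hScard] at this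
    exact_mod_cast this
  obtain ⟨x, hxinj, hxS⟩ : ∃ x : Fin (N + 1) → V, Function.Injective x ∧ ∀ i, x i ∈ S := by
    have : Nat.card S = N + 1 := hSn
    have : Finite S := hSfin.to_subtype
    have e := Finite.equivFinOfCardEq ‹Nat.card S = N + 1›
    exact ⟨fun i => (e.symm i : V), Subtype.val_injective.comp e.symm.injective,
      fun i => (e.symm i).2⟩
  have hxz : ∀ i, x i ∈ W ∧ a (x i) + b (x i) = 0 := fun i => hS (hxS i)
  obtain ⟨P, hPc, hP⟩ := exists_interpolation hxinj
  -- a small perturbation for which the zeros `x i` are non-degenerate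
  have e1 : ∀ᶠ ε in 𝓝 (0 : ℂ), ∀ y ∈ W \ interior W, 2 * ‖b y + ε • P y‖ < ‖a y‖ := by
    have hc : IsCompact (W \ interior W) := hW.diff isOpen_interior
    refine hc.eventually_forall_of_forall_eventually fun y hy => ?_
    have hcont : Continuous (fun z : ℂ × V => ‖a z.2‖ - 2 * ‖b z.2 + z.1 • P z.2‖) := by
      have := ha.continuous
      have := hb.continuous
      have := hPc.continuous
      fun_prop
    have : ∀ᶠ z in 𝓝 ((0 : ℂ), y), 0 < ‖a z.2‖ - 2 * ‖b z.2 + z.1 • P z.2‖ := by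
      refine hcont.continuousAt.eventually (lt_mem_nhds ?_)
      simpa using hab y hy.1 hy.2
    filter_upwards [this] with z hz
    linarith
  have e2 : ∀ᶠ ε in 𝓝[≠] (0 : ℂ), ∀ i,
      (fderiv ℂ (fun y => a y + b y) (x i) + ε • ContinuousLinearMap.id ℂ V).det ≠ 0 :=
    eventually_all.2 fun i => eventually_det_add_smul_ne_zero _
  obtain ⟨ε, hε1, hε2⟩ := ((e1.filter_mono nhdsWithin_le_nhds).and e2).exists
  -- Adding `ε • P` keeps every `x i` a zero of the sum and shifts the derivative there by `ε` times
  -- the identity, so the surplus zeros, possibly degenerate before, become non-degenerate.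
  set b' : V → V := fun y => b y + ε • P y with hb'
  have hb'c : ContDiff ℂ ∞ b' := hb.add (hPc.const_smul ε)
  obtain ⟨-, hnear⟩ := eventually_not_injective (hHc b' hb'c) hW (hreg' b' hb'c)
  have hN' : {x ∈ W | a x + (0 : ℂ) • b' x = 0}.encard < (N + 1 : ℕ) := by
    simp only [zero_smul, add_zero, hN]
    exact_mod_cast Nat.lt_succ_self N
  obtain ⟨δ, hδ, hδ'⟩ := Metric.eventually_nhds_iff_ball.1 (hnear (N + 1) hN')
  -- The factor `2` in the boundary estimate excludes boundary zeros of `a + t b'` on the disc `‖t‖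
  -- < 2`, which has the relevant parameter `t = 1` in its interior.
  refine not_injective_of_no_zeros_near (hHc b' hb'c) hW (R := 2) ?_ hδ
    (fun t ht y hy => hδ' t (by simpa using ht) y hy) (t₁ := 1) (by simp) (x₁ := x) ?_ ?_ hxinj
  · intro t ht y hy hy0
    by_contra hint
    have h1 := hε1 y ⟨hy, hint⟩
    simp only at hy0
    have h2 : ‖a y‖ = ‖t‖ * ‖b' y‖ := by
      rw [eq_neg_of_add_eq_zero_left hy0, norm_neg, norm_smul]
    have h3 : ‖t‖ * ‖b' y‖ ≤ 2 * ‖b' y‖ := by gcongr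
    linarith
  · intro i
    refine ⟨(hxz i).1, ?_⟩
    simp [hb', (hP i).1, (hxz i).2]
  · intro i
    rw [jac_eq (hHc b' hb'c)]
    have hd : HasFDerivAt (fun y => a y + b y) (fderiv ℂ (fun y => a y + b y) (x i)) (x i) :=
      ((ha.add hb).differentiable (by simp)).differentiableAt.hasFDerivAt
    have h2 : HasFDerivAt (fun y => a y + (1 : ℂ) • b' y)
        (fderiv ℂ (fun y => a y + b y) (x i) + ε • ContinuousLinearMap.id ℂ V) (x i) := by
      refine (hd.add ((hP i).2.const_smul ε)).congr_of_eventuallyEq (Eventually.of_forall fun y => ?_)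
      simp [hb', add_assoc]
    simp only
    rw [h2.fderiv]
    exact hε2 i

/-- Sard: non-degenerate values are dense. -/
theorem frequently_regular {f : V → V} (hf : ContDiff ℂ ∞ f) (p : V) :
    ∃ᶠ q in 𝓝 p, ∀ x, f x = q → (fderiv ℂ f x).det ≠ 0 := by
  let : MeasurableSpace V := borel V
  have : BorelSpace V := ⟨rfl⟩
  have : FiniteDimensional ℝ V := FiniteDimensional.complexToReal V
  let μ : MeasureTheory.Measure V := MeasureTheory.Measure.addHaar
  -- The real determinant of a complex linear map is the norm of its complex determinant, so complex
  -- critical points are real critical points and the equidimensional real Sard theorem applies.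
  have hz : μ (f '' {x | (fderiv ℂ f x).det = 0}) = 0 := by
    refine MeasureTheory.addHaar_image_eq_zero_of_det_fderivWithin_eq_zero μ
      (f' := fun x => (fderiv ℂ f x).restrictScalars ℝ) (fun x _ => ?_) fun x hx => ?_
    · exact ((hf.differentiable (by simp)).differentiableAt.hasFDerivAt.restrictScalars
        ℝ).hasFDerivWithinAt
    · have hx' : LinearMap.det (fderiv ℂ f x : V →ₗ[ℂ] V) = 0 := hx
      change LinearMap.det ((fderiv ℂ f x : V →ₗ[ℂ] V).restrictScalars ℝ) = 0
      rw [LinearMap.det_restrictScalars, hx']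
      simp
  intro hev
  have hsub : {q | ¬ ∀ x, f x = q → (fderiv ℂ f x).det ≠ 0} = f '' {x | (fderiv ℂ f x).det = 0} := by
    ext q; simp [and_comm]
  have hev' : f '' {x | (fderiv ℂ f x).det = 0} ∈ 𝓝 p := by
    have := hev
    rw [Filter.eventually_iff] at this
    simpa only [not_not, hsub] using! this
  obtain ⟨O, hO, hOo, hpO⟩ := _root_.mem_nhds_iff.1 hev'
  exact (hOo.measure_pos μ ⟨p, hpO⟩).ne' (MeasureTheory.measure_mono_null hO hz)

/-- The number of preimages of a regular value dominates the number of preimages of all nearby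
values under all nearby maps. -/
theorem exists_encard_fiber_le {f : V → V} (hf : ContDiff ℂ ∞ f) {W : Set V} (hW : IsCompact W)
    {p : V} (hp : ∀ x ∈ W, x ∉ interior W → f x ≠ p) :
    ∃ ε > 0, ∀ f' g : V → V, ContDiff ℂ ∞ f' → ContDiff ℂ ∞ g →
      (∀ x ∈ W, ‖f' x - f x‖ < ε) → (∀ x ∈ W, ‖g x - f x‖ < ε) → ∀ p' ∈ ball p ε, ∀ q ∈ ball p ε,
      (∀ x ∈ W, f' x = p' → (fderiv ℂ f' x).det ≠ 0) →
      (f' ⁻¹' {p'} ∩ W).Finite ∧ (g ⁻¹' {q} ∩ W).encard ≤ (f' ⁻¹' {p'} ∩ W).encard ∧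
      g ⁻¹' {q} ∩ W ⊆ interior W := by
  have hc : IsCompact (W \ interior W) := hW.diff isOpen_interior
  obtain ⟨c, hc0, hcle⟩ : ∃ c > 0, ∀ x ∈ W \ interior W, c ≤ ‖f x - p‖ := by
    have hcont : ContinuousOn (fun x => ‖f x - p‖) (W \ interior W) := by
      have := hf.continuous
      fun_prop
    rcases (W \ interior W).eq_empty_or_nonempty with he | hne
    · exact ⟨1, one_pos, by simp [he]⟩
    · obtain ⟨x, hx, hmin⟩ := hc.exists_isMinOn hne hcont
      exact ⟨‖f x - p‖, norm_pos_iff.2 (sub_ne_zero.2 (hp x hx.1 hx.2)), fun y hy => hmin hy⟩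
  -- On the boundary `‖f' - p'‖` exceeds `9c/10`, while the perturbation from `f' - p'` to `g - q`
  -- is below `4 * c / 20 = c/5`, less than half of that.
  refine ⟨c / 20, by positivity, fun f' g hf' hg hff' hfg p' hp' q hq hreg => ?_⟩
  rw [mem_ball, dist_eq_norm] at hp' hq
  have hbound : ∀ h : V → V, (∀ x ∈ W, ‖h x - f x‖ < c / 20) → ∀ s : V, ‖s - p‖ < c / 20 →
      ∀ x ∈ W \ interior W, c - c / 10 < ‖h x - s‖ := by
    intro h hh s hs x hx
    have h1 := hcle x hx
    have h2 := hh x hx.1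
    have h3 : ‖f x - p‖ ≤ ‖h x - s‖ + ‖h x - f x‖ + ‖s - p‖ := by
      calc ‖f x - p‖ = ‖(h x - s) - (h x - f x) + (s - p)‖ := by congr 1; abel
        _ ≤ _ := (norm_add_le _ _).trans (by gcongr; exact norm_sub_le _ _)
    linarith
  have key := encard_zeros_add_le (a := fun x => f' x - p') (b := fun x => (g x - q) - (f' x - p'))
    (hf'.sub contDiff_const) ((hg.sub contDiff_const).sub (hf'.sub contDiff_const)) hW
    (fun x hx hxi => by
      have h1 := hbound f' hff' p' hp' x ⟨hx, hxi⟩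
      have h2 : ‖(g x - q) - (f' x - p')‖ ≤ ‖g x - f x‖ + ‖f' x - f x‖ + ‖q - p‖ + ‖p' - p‖ := by
        calc ‖(g x - q) - (f' x - p')‖
            = ‖(g x - f x) - (f' x - f x) - (q - p) + (p' - p)‖ := by congr 1; abel
          _ ≤ _ := (norm_add_le _ _).trans (by
              gcongr; exact (norm_sub_le _ _).trans (by gcongr; exact norm_sub_le _ _))
      have h3 := hff' x hx
      have h4 := hfg x hx
      linarith)
    (fun x hx hx0 => by
      rw [fderiv_sub_const]
      exact hreg x hx (sub_eq_zero.1 hx0))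
  have s1 : {x ∈ W | f' x - p' = 0} = f' ⁻¹' {p'} ∩ W := by
    ext x; simp [sub_eq_zero, and_comm]
  have s2 : {x ∈ W | (f' x - p') + ((g x - q) - (f' x - p')) = 0} = g ⁻¹' {q} ∩ W := by
    ext x; simp [sub_eq_zero, and_comm]
  rw [s1, s2] at key
  refine ⟨key.1, key.2, fun x hx => ?_⟩
  by_contra hxi
  have := hbound g hfg q hq x ⟨hx.2, hxi⟩
  have hx1 : g x = q := hx.1
  rw [hx1, sub_self, norm_zero] at this
  linarith

end LocalDegree

/-! ### Local topological degree of maps between topological spaces -/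

section LocalMult

open Set Filter

variable {X Y Z : Type*} [TopologicalSpace X] [TopologicalSpace Y] [TopologicalSpace Z]

/-- The local topological degree of a map at a point. -/
def localMult (f : X → Y) (y : X) : ℕ∞ :=
  ⨅ W ∈ 𝓝 y, limsup (fun q => (f ⁻¹' {q} ∩ W).encard) (𝓝 (f y))

theorem localMult_le {f : X → Y} {y : X} {W : Set X} (hW : W ∈ 𝓝 y) {N : ℕ∞}
    (h : ∀ᶠ q in 𝓝 (f y), (f ⁻¹' {q} ∩ W).encard ≤ N) : localMult f y ≤ N :=
  (iInf₂_le W hW).trans (limsup_le_of_le (h := h))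

theorem le_localMult {f : X → Y} {y : X} {N : ℕ∞}
    (h : ∀ W ∈ 𝓝 y, ∃ᶠ q in 𝓝 (f y), N ≤ (f ⁻¹' {q} ∩ W).encard) : N ≤ localMult f y :=
  le_iInf₂ fun W hW => le_limsup_of_frequently_le (h W hW)

/-- The infimum over neighbourhoods is attained because in `ℕ∞` being less than `m + 1` with `m`
finite means being at most `m`. -/
theorem exists_encard_le_localMult (f : X → Y) (y : X) :
    ∃ W ∈ 𝓝 y, ∀ᶠ q in 𝓝 (f y), (f ⁻¹' {q} ∩ W).encard ≤ localMult f y := by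
  by_cases htop : localMult f y = ⊤
  · exact ⟨univ, univ_mem, by simp [htop]⟩
  · have hlt : localMult f y < localMult f y + 1 := ENat.lt_add_one_iff htop |>.2 le_rfl
    conv_lhs at hlt => rw [localMult]
    simp only [iInf_lt_iff] at hlt
    obtain ⟨W, hW, h⟩ := hlt
    refine ⟨W, hW, ?_⟩
    filter_upwards [eventually_lt_of_limsup_lt h] with q hq
    exact (ENat.lt_add_one_iff htop).1 hq

theorem one_le_localMult (f : X → Y) (y : X) : 1 ≤ localMult f y := by
  refine le_localMult fun W hW => ?_
  intro h
  refine h.self_of_nhds (one_le_encard_iff_nonempty.2 ⟨y, rfl, mem_of_mem_nhds hW⟩)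

/-- Near `x`, a fibre of `f ∘ g` is a union of fibres of `g` over the points of one fibre of `f`.
Both counts are bounded by the local degrees once the neighbourhoods are small enough. -/
theorem localMult_comp_le {f : Y → Z} {g : X → Y} {x : X} (hg : ContinuousAt g x) :
    localMult (f ∘ g) x ≤ localMult g x * localMult f (g x) := by
  obtain ⟨W₁, hW₁, h₁⟩ := exists_encard_le_localMult g x
  obtain ⟨W₂, hW₂, h₂⟩ := exists_encard_le_localMult f (g x)
  have hW : W₁ ∩ g ⁻¹' (W₂ ∩ {y | (g ⁻¹' {y} ∩ W₁).encard ≤ localMult g x}) ∈ 𝓝 x :=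
    inter_mem hW₁ (hg (inter_mem hW₂ h₁))
  refine localMult_le hW ?_
  filter_upwards [h₂] with q hq
  by_cases htop : localMult f (g x) = ⊤
  · rw [htop, ENat.mul_top (zero_lt_one.trans_le (one_le_localMult g x)).ne']
    exact le_top
  have hfin : (f ⁻¹' {q} ∩ W₂).Finite := by
    rw [← encard_lt_top_iff]
    exact hq.trans_lt (lt_top_iff_ne_top.2 htop)
  set T := {y ∈ hfin.toFinset | (g ⁻¹' {y} ∩ W₁).encard ≤ localMult g x} with hT
  have hsub : (f ∘ g) ⁻¹' {q} ∩ (W₁ ∩ g ⁻¹' (W₂ ∩ {y | (g ⁻¹' {y} ∩ W₁).encard ≤ localMult g x}))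
      ⊆ ⋃ y ∈ T, g ⁻¹' {y} ∩ W₁ := by
    rintro z ⟨hz1, hz2, hz3, hz4⟩
    simp only [mem_iUnion, hT, Finset.mem_filter, Finite.mem_toFinset]
    exact ⟨g z, ⟨⟨hz1, hz3⟩, hz4⟩, rfl, hz2⟩
  calc _ ≤ (⋃ y ∈ T, g ⁻¹' {y} ∩ W₁).encard := encard_le_encard hsub
    _ ≤ ∑ y ∈ T, (g ⁻¹' {y} ∩ W₁).encard := T.set_encard_biUnion_le _
    _ ≤ ∑ y ∈ T, localMult g x := Finset.sum_le_sum fun y hy => (Finset.mem_filter.1 hy).2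
    _ = T.card * localMult g x := by simp
    _ ≤ hfin.toFinset.card * localMult g x := by
        gcongr
        exact Finset.filter_subset _ _
    _ ≤ localMult f (g x) * localMult g x := by
        gcongr
        rwa [hfin.encard_eq_coe_toFinset_card] at hq
    _ = _ := mul_comm _ _

end LocalMult

/-! ### Upper semicontinuity of the local degree -/

section LocalDegree

open Set Filter Metric

variable {V : Type*} [NormedAddCommGroup V] [NormedSpace ℂ V] [FiniteDimensional ℂ V]

/-- If `y` is the only preimage of `f y` in the compact set `W`, its multiplicity is at least the
number of preimages in `W` of regular values close to `f y`. -/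
theorem encard_regular_fiber_le_localMult {f : V → V} (hf : ContDiff ℂ ∞ f) {W : Set V}
    (hW : IsCompact W) {y : V} (hy : ∀ x ∈ W, f x = f y → x = y) {N : ℕ∞}
    (hN : ∃ ε > 0, ∀ q ∈ ball (f y) ε, (∀ x, f x = q → (fderiv ℂ f x).det ≠ 0) →
      N ≤ (f ⁻¹' {q} ∩ W).encard) : N ≤ localMult f y := by
  refine le_localMult fun W' hW' => ?_
  obtain ⟨ε, hε, hN⟩ := hN
  have hc : IsCompact (W \ interior W') := hW.diff isOpen_interior
  have hnot : f y ∉ f '' (W \ interior W') := by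
    rintro ⟨x, ⟨hxW, hx⟩, hxy⟩
    rw [hy x hxW hxy] at hx
    exact hx (mem_interior_iff_mem_nhds.2 hW')
  have hev : (f '' (W \ interior W'))ᶜ ∈ 𝓝 (f y) :=
    (hc.image hf.continuous).isClosed.isOpen_compl.mem_nhds hnot
  -- Values close to `f y` are not taken on the compact set `W \ interior W'`, so all their
  -- preimages in `W` already lie in `W'`.
  refine ((frequently_regular hf (f y)).and_eventually
    (inter_mem hev (ball_mem_nhds _ hε))).mono fun q hq => ?_
  refine (hN q hq.2.2 hq.1).trans (encard_le_encard fun x hx => ⟨hx.1, ?_⟩)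
  by_contra hxW'
  exact hq.2.1 ⟨x, ⟨hx.2, fun h => hxW' (interior_subset h)⟩, hx.1⟩

/-- Upper semi-continuity of the number of preimages counted with multiplicity. -/
theorem exists_tsum_localMult_le {f : V → V} (hf : ContDiff ℂ ∞ f) {W : Set V}
    (hW : IsCompact W) {y : V} (hyW : y ∈ interior W) (hy : ∀ x ∈ W, f x = f y → x = y) :
    localMult f y < ⊤ ∧ ∃ ε > 0, ∀ g : V → V, ContDiff ℂ ∞ g → (∀ x ∈ W, ‖g x - f x‖ < ε) →
      ∀ q ∈ ball (f y) ε, ∃ S : Finset V, (∀ x, x ∈ S ↔ g x = q ∧ x ∈ W) ∧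
        ∑ x ∈ S, localMult g x ≤ localMult f y := by
  obtain ⟨ε, hε, hkey⟩ := exists_encard_fiber_le hf hW (p := f y)
    (fun x hxW hxi hxy => hxi (hy x hxW hxy ▸ hyW))
  obtain ⟨p', hp'reg, hp'⟩ := ((frequently_regular hf (f y)).and_eventually
    (ball_mem_nhds _ hε)).exists
  have hself : ∀ x ∈ W, ‖f x - f x‖ < ε := fun x _ => by simpa using hε
  set N := (f ⁻¹' {p'} ∩ W).encard with hN
  have hNtop : N < ⊤ := encard_lt_top_iff.2
    (hkey f f hf hf hself hself p' hp' p' hp' fun x _ => hp'reg x).1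
  have hle : ∀ g : V → V, ContDiff ℂ ∞ g → (∀ x ∈ W, ‖g x - f x‖ < ε) →
      ∀ q ∈ ball (f y) ε, (g ⁻¹' {q} ∩ W).encard ≤ N ∧ g ⁻¹' {q} ∩ W ⊆ interior W :=
    fun g hg hfg q hq => (hkey f g hf hg hself hfg p' hp' q hq fun x _ => hp'reg x).2
  have hNm : N ≤ localMult f y := by
    refine encard_regular_fiber_le_localMult hf hW hy ⟨ε, hε, fun q hq hqr => ?_⟩
    exact (hkey f f hf hf hself hself q hq p' hp' fun x _ => hqr x).2.1
  refine ⟨(localMult_le (W := W) (mem_interior_iff_mem_nhds.1 hyW) ?_).trans_lt hNtop,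
    ε, hε, fun g hg hfg q hq => ?_⟩
  · filter_upwards [ball_mem_nhds (f y) hε] with q hq
    exact (hle f hf hself q hq).1
  obtain ⟨hqN, hqint⟩ := hle g hg hfg q hq
  have hfin : (g ⁻¹' {q} ∩ W).Finite := encard_lt_top_iff.1 (hqN.trans_lt hNtop)
  refine ⟨hfin.toFinset, fun x => by simp, ?_⟩
  -- disjoint neighbourhoods of the preimages
  obtain ⟨U, hU, hUd⟩ := hfin.t2_separation
  have hr : ∀ x ∈ g ⁻¹' {q} ∩ W, ∃ r > 0, closedBall x r ⊆ U x ∩ interior W := fun x hx =>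
    nhds_basis_closedBall.mem_iff.1
      (((hU x).2.inter isOpen_interior).mem_nhds ⟨(hU x).1, hqint hx⟩)
  choose! r hr0 hrsub using hr
  have hpc : ProperSpace V := FiniteDimensional.proper ℂ V
  have hx : ∀ x ∈ g ⁻¹' {q} ∩ W, ∃ ε' > 0, ∀ q' ∈ ball q ε',
      (∀ x, g x = q' → (fderiv ℂ g x).det ≠ 0) →
      localMult g x ≤ (g ⁻¹' {q'} ∩ closedBall x (r x)).encard := by
    intro x hx
    have hgx : g x = q := hx.1
    have honly : ∀ z ∈ closedBall x (r x), g z = q → z = x := by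
      intro z hz hzq
      by_contra hne
      have hzW : z ∈ g ⁻¹' {q} ∩ W := ⟨hzq, interior_subset (hrsub x hx hz).2⟩
      exact disjoint_left.1 (hUd hzW hx hne) (hU z).1 (hrsub x hx hz).1
    have hxint : x ∈ interior (closedBall x (r x)) :=
      mem_interior_iff_mem_nhds.2 (closedBall_mem_nhds _ (hr0 x hx))
    obtain ⟨ε', hε', hk⟩ := exists_encard_fiber_le hg (isCompact_closedBall x (r x)) (p := q)
      (fun z hz hzi hzq => hzi (honly z hz hzq ▸ hxint))
    refine ⟨ε', hε', fun q' hq' hreg => localMult_le (W := closedBall x (r x))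
      (closedBall_mem_nhds _ (hr0 x hx)) ?_⟩
    rw [hgx]
    filter_upwards [ball_mem_nhds q hε'] with q'' hq''
    exact (hk g g hg hg (by simpa using fun _ _ => hε') (by simpa using fun _ _ => hε') q' hq'
      q'' hq'' fun x _ => hreg x).2.1
  choose! e he0 he using hx
  have hev : ∀ᶠ q' in 𝓝 q, (∀ x ∈ hfin.toFinset, q' ∈ ball q (e x)) ∧ q' ∈ ball (f y) ε := by
    refine ((Finset.eventually_all _).2 fun x hx => ?_).and (isOpen_ball.mem_nhds hq)
    exact ball_mem_nhds q (he0 x (hfin.mem_toFinset.1 hx))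
  -- One regular value `q'` of `g` serves for all preimages `x` of `q` at once. Its preimages in the
  -- ball around `x` bound the local degree at `x`, and since the balls are disjoint the total is at
  -- most the number of preimages of `q'` in `W`, hence at most `N`.
  obtain ⟨q', hreg, hq'1, hq'2⟩ := ((frequently_regular hg q).and_eventually hev).exists
  calc ∑ x ∈ hfin.toFinset, localMult g x
      ≤ ∑ x ∈ hfin.toFinset, (g ⁻¹' {q'} ∩ closedBall x (r x)).encard :=
        Finset.sum_le_sum fun x hx => he x (hfin.mem_toFinset.1 hx) q' (hq'1 x hx) hreg
    _ = (⋃ x ∈ hfin.toFinset, g ⁻¹' {q'} ∩ closedBall x (r x)).encard := by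
        have := (hfin.toFinset.finite_toSet).encard_biUnion
          (s := fun x => g ⁻¹' {q'} ∩ closedBall x (r x)) (fun a ha b hb hab => by
          refine Disjoint.mono ?_ ?_ (hUd (by simpa using ha) (by simpa using hb) hab)
          · exact fun z hz => (hrsub a (by simpa using ha) hz.2).1
          · exact fun z hz => (hrsub b (by simpa using hb) hz.2).1)
        rw [finsum_mem_coe_finset] at this
        simpa using this.symm
    _ ≤ (g ⁻¹' {q'} ∩ W).encard := by
        refine encard_le_encard (iUnion₂_subset fun x hx => ?_)
        exact inter_subset_inter_right _ fun z hz =>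
          interior_subset (hrsub x (hfin.mem_toFinset.1 hx) hz).2
    _ ≤ N := (hle g hg hfg q' hq'2).1
    _ ≤ _ := hNm

end LocalDegree

/-! ### Topology of projective space and homogeneous lifts -/

section ProjectiveTopology

open Set Filter

variable {k : ℕ}

/-- The projection `E k → P k`, with a junk value at the origin. -/
def proj (v : E k) : P k :=
  open Classical in
  if h : v ≠ 0 then Projectivization.mk ℂ v h
  else Projectivization.mk ℂ (fun _ => 1) (fun h => one_ne_zero (congrFun h 0))

theorem proj_of_ne_zero {v : E k} (h : v ≠ 0) : proj v = Projectivization.mk ℂ v h := dif_pos h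

theorem exists_proj_eq (p : P k) : ∃ v : E k, v ≠ 0 ∧ proj v = p :=
  ⟨p.rep, p.rep_nonzero, by rw [proj_of_ne_zero p.rep_nonzero, Projectivization.mk_rep]⟩

theorem proj_eq_proj_iff {v w : E k} (hv : v ≠ 0) (hw : w ≠ 0) :
    proj v = proj w ↔ ∃ c : ℂ, c • w = v := by
  rw [proj_of_ne_zero hv, proj_of_ne_zero hw, Projectivization.mk_eq_mk_iff']

theorem proj_smul {c : ℂ} (hc : c ≠ 0) (v : E k) : proj (c • v) = proj v := by
  by_cases hv : v = 0
  · simp [hv]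
  · exact (proj_eq_proj_iff (smul_ne_zero hc hv) hv).2 ⟨c, rfl⟩

theorem isOpen_iff_proj {O : Set (P k)} :
    IsOpen O ↔ IsOpen {v : E k | v ≠ 0 ∧ proj v ∈ O} := by
  rw [isOpen_coinduced]
  have hop : IsOpen {v : E k | v ≠ 0} := isOpen_ne
  rw [hop.isOpenEmbedding_subtypeVal.isOpen_iff_image_isOpen]
  congr! 1
  ext v
  simp only [mem_image, mem_preimage, Subtype.exists, mem_ofPred_eq]
  constructor
  · rintro ⟨a, ha, h, rfl⟩
    exact ⟨ha, by rw [proj_of_ne_zero ha]; exact h⟩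
  · rintro ⟨hv, h⟩
    exact ⟨v, hv, by rw [proj_of_ne_zero hv] at h; exact h, rfl⟩

theorem continuousAt_proj {v : E k} (hv : v ≠ 0) : ContinuousAt (proj : E k → P k) v := by
  intro O hO
  obtain ⟨O', hO', hop, hv'⟩ := mem_nhds_iff.1 hO
  refine mem_map.2 (mem_of_superset ((isOpen_iff_proj.1 hop).mem_nhds ⟨hv, hv'⟩) ?_)
  exact fun w hw => hO' hw.2

/-- The projection is open and continuous away from the origin. -/
theorem map_proj_nhds {v : E k} (hv : v ≠ 0) : map proj (𝓝 v) = 𝓝 (proj v : P k) := by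
  refine le_antisymm (continuousAt_proj hv) fun O hO => ?_
  have hO' : proj ⁻¹' O ∈ 𝓝 v := hO
  obtain ⟨U, hU, hUo, hvU⟩ := mem_nhds_iff.1 (inter_mem hO' (isOpen_ne.mem_nhds hv))
  refine mem_nhds_iff.2 ⟨proj '' U, ?_, ?_, ⟨v, hvU, rfl⟩⟩
  · rintro _ ⟨w, hw, rfl⟩
    exact (hU hw).1
  · rw [isOpen_iff_proj]
    have : {w : E k | w ≠ 0 ∧ proj w ∈ proj '' U} = ⋃ c : {c : ℂ // c ≠ 0}, (fun w => c.1 • w) ⁻¹' U := by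
      ext w
      simp only [mem_ofPred_eq, mem_iUnion, mem_preimage, mem_image]
      constructor
      · rintro ⟨hw, u, hu, huw⟩
        obtain ⟨c, hc⟩ := (proj_eq_proj_iff (hU hu).2 hw).1 huw
        refine ⟨⟨c, ?_⟩, by simpa [hc] using hu⟩
        rintro rfl
        exact (hU hu).2 (by simpa using hc.symm)
      · rintro ⟨⟨c, hc⟩, hcw⟩
        have hw : w ≠ 0 := by
          rintro rfl
          exact (hU hcw).2 (by simp)
        exact ⟨hw, _, hcw, proj_smul hc w⟩
    rw [this]
    exact isOpen_iUnion fun c => hUo.preimage (by fun_prop)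

/-- Two vectors span different lines exactly when some minor `v i * w j - v j * w i` is nonzero,
which is an open condition on the pair. -/
instance instT2SpaceP (k : ℕ) : T2Space (P k) := by
  refine t2Space_iff_disjoint_nhds.2 fun p q hpq => ?_
  obtain ⟨v, hv, rfl⟩ := exists_proj_eq p
  obtain ⟨w, hw, rfl⟩ := exists_proj_eq q
  have hij : ∃ i j, v i * w j - v j * w i ≠ 0 := by
    by_contra h
    push Not at h
    obtain ⟨j, hj⟩ : ∃ j, w j ≠ 0 := by
      by_contra h'
      push Not at h'
      exact hw (funext h')
    refine hpq ((proj_eq_proj_iff hv hw).2 ⟨v j / w j, funext fun i => ?_⟩)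
    have := h i j
    simp only [Pi.smul_apply, smul_eq_mul]
    field_simp
    linear_combination -this
  obtain ⟨i, j, hij⟩ := hij
  rw [← map_proj_nhds hv, ← map_proj_nhds hw]
  have hcont : Continuous fun z : E k × E k => z.1 i * z.2 j - z.1 j * z.2 i := by fun_prop
  have hev : ∀ᶠ z in 𝓝 v ×ˢ 𝓝 w, z.1 i * z.2 j - z.1 j * z.2 i ≠ 0 := by
    rw [← nhds_prod_eq]
    exact hcont.continuousAt.eventually_ne hij
  have hev2 : ∀ᶠ z in 𝓝 v ×ˢ 𝓝 w, z.1 ≠ 0 ∧ z.2 ≠ 0 :=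
    (continuousAt_id.eventually_ne hv : ∀ᶠ z in 𝓝 v, z ≠ 0).prod_mk
      (continuousAt_id.eventually_ne hw)
  obtain ⟨A, hA, B, hB, hAB⟩ := mem_prod_iff.1 (hev.and hev2)
  refine Filter.disjoint_iff.2 ⟨_, image_mem_map hA, _, image_mem_map hB, ?_⟩
  rw [disjoint_left]
  rintro _ ⟨a, ha, rfl⟩ ⟨b, hb, hba⟩
  obtain ⟨h1, h2, h3⟩ := hAB (mk_mem_prod ha hb)
  obtain ⟨c, hc⟩ := (proj_eq_proj_iff h3 h2).1 hba
  refine h1 ?_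
  rw [← hc]
  simp only [Pi.smul_apply, smul_eq_mul]
  ring

instance instCompactSpaceP (k : ℕ) : CompactSpace (P k) := by
  refine ⟨?_⟩
  have h : (univ : Set (P k)) = proj '' Metric.sphere (0 : E k) 1 := by
    refine (eq_univ_of_forall fun p => ?_).symm
    obtain ⟨v, hv, rfl⟩ := exists_proj_eq p
    have hn : (‖v‖ : ℂ)⁻¹ ≠ 0 := inv_ne_zero (by exact_mod_cast (norm_ne_zero_iff.2 hv))
    refine ⟨(‖v‖ : ℂ)⁻¹ • v, ?_, proj_smul hn v⟩
    rw [mem_sphere_zero_iff_norm, norm_smul, norm_inv, Complex.norm_real, norm_norm,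
      inv_mul_cancel₀ (norm_ne_zero_iff.2 hv)]
  rw [h]
  refine (isCompact_sphere _ _).image_of_continuousOn fun v hv => ?_
  refine (continuousAt_proj ?_).continuousWithinAt
  exact norm_ne_zero_iff.1 (by rw [mem_sphere_zero_iff_norm.1 hv]; exact one_ne_zero)

/-- `G` is a smooth homogeneous map of degree `D` of `ℂ^(k+1)` which covers the map `g`. -/
structure IsLift (D : ℕ) (G : E k → E k) (g : P k → P k) : Prop where
  contDiff : ContDiff ℂ ∞ G
  homog : ∀ (c : ℂ) (x : E k), G (c • x) = c ^ D • G x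
  ne_zero : ∀ x, x ≠ 0 → G x ≠ 0
  map_proj : ∀ x, x ≠ 0 → g (proj x) = proj (G x)

theorem IsLift.comp {D D' : ℕ} {G G' : E k → E k} {g g' : P k → P k} (h : IsLift D G g)
    (h' : IsLift D' G' g') : IsLift (D' * D) (G ∘ G') (g ∘ g') where
  contDiff := h.contDiff.comp h'.contDiff
  homog c x := by simp [h'.homog, h.homog, pow_mul]
  ne_zero x hx := h.ne_zero _ (h'.ne_zero x hx)
  map_proj x hx := by simp [h'.map_proj x hx, h.map_proj _ (h'.ne_zero x hx)]

theorem IsLift.iterate {D : ℕ} {G : E k → E k} {g : P k → P k} (h : IsLift D G g) (n : ℕ) :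
    IsLift (D ^ n) G^[n] g^[n] := by
  induction n with
  | zero => exact ⟨contDiff_id, by simp, by simp, by simp⟩
  | succ n ih =>
    rw [Function.iterate_succ, Function.iterate_succ, pow_succ']
    exact ih.comp h

theorem IsLift.continuous {D : ℕ} {G : E k → E k} {g : P k → P k} (h : IsLift D G g) :
    Continuous g := by
  refine continuous_iff_continuousAt.2 fun p => ?_
  obtain ⟨v, hv, rfl⟩ := exists_proj_eq p
  rw [ContinuousAt, ← map_proj_nhds hv, tendsto_map'_iff, h.map_proj v hv]
  have : Tendsto (fun x => proj (G x)) (𝓝 v) (𝓝 (proj (G v))) :=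
    (continuousAt_proj (h.ne_zero v hv)).comp h.contDiff.continuous.continuousAt
  refine this.congr' ?_
  filter_upwards [isOpen_ne.mem_nhds hv] with x hx using (h.map_proj x hx).symm

/-- The polynomial map of `ℂ^(k+1)` given by a tuple of polynomials. -/
def Lift.evalMap {d : ℕ} (F : Lift k d) (x : E k) : E k := fun i => MvPolynomial.eval x (F.1 i)

theorem Lift.isLift {d : ℕ} (F : Lift k d) : IsLift d F.evalMap F.map where
  contDiff := by
    refine contDiff_pi.2 fun i => ?_
    simp only [Lift.evalMap, MvPolynomial.eval_eq]
    refine ContDiff.sum fun m _ => contDiff_const.mul (contDiff_prod fun j _ => ?_)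
    exact (contDiff_apply ℂ ℂ j).pow _
  homog c x := funext fun i => eval_smul_of_isHomogeneous (F.2.1 i) c x
  ne_zero x hx h := hx (F.2.2 x fun i => congrFun h i)
  map_proj x hx := by
    have h : F.evalMap x ≠ 0 := fun h => hx (F.2.2 x fun i => congrFun h i)
    rw [proj_of_ne_zero hx, proj_of_ne_zero h]
    rfl

/-- Evaluation is continuous in the coefficients and the point. -/
theorem continuous_evalMap {d : ℕ} : Continuous fun z : Lift k d × E k => z.1.evalMap z.2 := by
  have hcoef : ∀ (i : Fin (k + 1)) (m : Fin (k + 1) →₀ ℕ),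
      Continuous fun F : Lift k d => MvPolynomial.coeff m (F.1 i) := fun i m => by
    have h : Continuous fun F : Lift k d => fun (i : Fin (k + 1)) (m : Fin (k + 1) →₀ ℕ) =>
        MvPolynomial.coeff m (F.1 i) := continuous_induced_dom
    exact continuous_pi_iff.1 (continuous_pi_iff.1 h i) m
  refine continuous_pi fun i => ?_
  -- The support of the polynomial varies with the tuple; summing over all exponents of degree `d`
  -- gives a finite index set independent of it.
  have : (fun z : Lift k d × E k => z.1.evalMap z.2 i) = fun z =>
      ∑ m ∈ Finset.univ.finsuppAntidiag d, MvPolynomial.coeff m (z.1.1 i) * ∏ j, z.2 j ^ m j := by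
    funext z
    rw [Lift.evalMap, MvPolynomial.eval_eq']
    refine Finset.sum_subset (fun m hm => ?_) (fun m _ hm => ?_)
    · rw [Finset.mem_finsuppAntidiag]
      refine ⟨?_, by simp⟩
      have := z.1.2.1 i (MvPolynomial.mem_support_iff.1 hm)
      rw [← this, Finsupp.weight_apply]
      simp [Finsupp.sum_fintype]
    · rw [MvPolynomial.notMem_support_iff.1 hm, zero_mul]
  rw [this]
  refine continuous_finsetSum _ fun m _ => Continuous.mul
    (f := fun z : Lift k d × E k => MvPolynomial.coeff m (z.1.1 i))
    (g := fun z : Lift k d × E k => ∏ j, z.2 j ^ m j) ((hcoef i m).comp continuous_fst) ?_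
  have h2 : Continuous fun x : E k => ∏ j, x j ^ m j := by fun_prop
  exact h2.comp continuous_snd

theorem continuous_evalMap_iterate {d : ℕ} (n : ℕ) :
    Continuous fun z : Lift k d × E k => z.1.evalMap^[n] z.2 := by
  induction n with
  | zero => exact continuous_snd
  | succ n ih =>
    have h : (fun z : Lift k d × E k => z.1.evalMap^[n + 1] z.2) =
        (fun z : Lift k d × E k => z.1.evalMap z.2) ∘ fun z => (z.1, z.1.evalMap^[n] z.2) := by
      funext z
      rw [Function.iterate_succ_apply', Function.comp_apply]
    rw [h]
    exact Continuous.comp continuous_evalMap (Continuous.prodMk continuous_fst ih)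

end ProjectiveTopology

/-! ### Multiplicities on projective space computed on lifts -/

section Transfer

open Set Filter Metric

variable {k D : ℕ}

theorem mult_eq_localMult (f : P k → P k) (y : P k) : mult f y = localMult f y := rfl

/-- Near `v`, points on the same complex line with the same image under a lift coincide. -/
theorem IsLift.exists_injOn_proj {G : E k → E k} {g : P k → P k} (h : IsLift D G g) (hD : D ≠ 0)
    {v : E k} (hv : v ≠ 0) :
    ∃ N ∈ 𝓝 v, (∀ x ∈ N, x ≠ 0) ∧ ∀ x ∈ N, ∀ y ∈ N, G x = G y → proj x = proj y → x = y := by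
  obtain ⟨i, hi⟩ : ∃ i, v i ≠ 0 := by
    by_contra h'
    push Not at h'
    exact hv (funext h')
  have hfin : {c : ℂ | c ^ D = 1}.Finite := by
    refine (Polynomial.nthRootsFinset D (1 : ℂ)).finite_toSet.subset fun c hc => ?_
    exact Finset.mem_coe.2 ((Polynomial.mem_nthRootsFinset (Nat.pos_of_ne_zero hD) 1).2 hc)
  have hM : ({c : ℂ | c ^ D = 1} \ {1})ᶜ ∈ 𝓝 (1 : ℂ) :=
    (hfin.subset sdiff_subset).isClosed.isOpen_compl.mem_nhds (by simp)
  have hcont : ContinuousAt (fun z : E k × E k => z.1 i / z.2 i) (v, v) :=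
    ContinuousAt.div (by fun_prop) (by fun_prop) hi
  have hev : ∀ᶠ z in 𝓝 v ×ˢ 𝓝 v, z.1 i / z.2 i ∈ ({c : ℂ | c ^ D = 1} \ {1})ᶜ := by
    rw [← nhds_prod_eq]
    exact hcont (by simpa [div_self hi] using hM)
  obtain ⟨A, hA, hAA⟩ := eventually_prod_self_iff'.1 hev
  refine ⟨A ∩ {x | x i ≠ 0}, inter_mem hA
    ((continuous_apply i).continuousAt.eventually_ne hi), fun x hx h0 => hx.2 (by simp [h0]),
    fun x hx y hy hxy hp => ?_⟩
  have hx0 : x ≠ 0 := fun h0 => hx.2 (by simp [h0])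
  have hy0 : y ≠ 0 := fun h0 => hy.2 (by simp [h0])
  obtain ⟨c, rfl⟩ := (proj_eq_proj_iff hx0 hy0).1 hp
  have hc : c ^ D = 1 := by
    rw [h.homog] at hxy
    have : (c ^ D - 1) • G y = 0 := by rw [sub_smul, one_smul, hxy, sub_self]
    exact sub_eq_zero.1 ((smul_eq_zero.1 this).resolve_right (h.ne_zero y hy0))
  have h1 := hAA _ hx.1 _ hy.1
  have hyi : y i ≠ 0 := hy.2
  have h2 : (c • y) i / y i = c := by simp [hyi]
  simp only [h2] at h1
  have : c = 1 := by
    by_contra hne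
    exact h1 ⟨hc, hne⟩
  rw [this, one_smul]

/-- The branch `exp (-log c / D)` of `c ^ (-1/D)` is continuous at `1`, so the correcting factor `μ`
stays near `1`. This allows a preimage of a line to be rescaled to a preimage of a prescribed vector
without leaving a given neighbourhood. -/
theorem exists_root_near_one (hD : D ≠ 0) {M : Set ℂ} (hM : M ∈ 𝓝 (1 : ℂ)) :
    ∃ L ∈ 𝓝 (1 : ℂ), ∀ c ∈ L, c ≠ 0 ∧ ∃ μ ∈ M, μ ≠ 0 ∧ μ ^ D * c = 1 := by
  have hcont : ContinuousAt (fun c : ℂ => Complex.exp (-Complex.log c / D)) 1 := by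
    have : ContinuousAt Complex.log 1 := continuousAt_clog (by simp)
    fun_prop
  have h1 : (fun c : ℂ => Complex.exp (-Complex.log c / D)) ⁻¹' M ∈ 𝓝 (1 : ℂ) :=
    hcont (by simpa using hM)
  refine ⟨_, inter_mem h1 (isOpen_ne.mem_nhds one_ne_zero), fun c hc => ⟨hc.2, _, hc.1,
    Complex.exp_ne_zero _, ?_⟩⟩
  have hc0 : c ≠ 0 := hc.2
  rw [← Complex.exp_nat_mul, mul_div_cancel₀ _ (by exact_mod_cast hD), Complex.exp_neg,
    Complex.exp_log hc0, inv_mul_cancel₀ hc0]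

/-- Preimages in projective space lift to preimages of a given representative. -/
theorem exists_lift_preimage (hD : D ≠ 0) {v w : E k} (hw : w ≠ 0) {W : Set (E k)}
    (hW : W ∈ 𝓝 v) :
    ∃ B ∈ 𝓝 w, ∃ W₀ ∈ 𝓝 v, ∀ (G : E k → E k) (g : P k → P k), IsLift D G g →
      ∀ x ∈ W₀, x ≠ 0 → G x ∈ B → ∀ z ∈ B, z ≠ 0 → g (proj x) = proj z →
        ∃ x' ∈ W, G x' = z ∧ proj x' = proj x := by
  obtain ⟨i, hi⟩ : ∃ i, w i ≠ 0 := by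
    by_contra h'
    push Not at h'
    exact hw (funext h')
  have h1 : ∀ᶠ z in 𝓝 (1 : ℂ) ×ˢ 𝓝 v, z.1 • z.2 ∈ W := by
    rw [← nhds_prod_eq]
    have : ContinuousAt (fun z : ℂ × E k => z.1 • z.2) (1, v) := by fun_prop
    exact this (by simpa using hW)
  obtain ⟨M, hM, W₀, hW₀, hMW⟩ := mem_prod_iff.1 h1
  obtain ⟨L, hL, hLM⟩ := exists_root_near_one hD hM
  have hcont : ContinuousAt (fun z : E k × E k => z.1 i / z.2 i) (w, w) :=
    ContinuousAt.div (by fun_prop) (by fun_prop) hi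
  have hev : ∀ᶠ z in 𝓝 w ×ˢ 𝓝 w, z.1 i / z.2 i ∈ L := by
    rw [← nhds_prod_eq]
    exact hcont (by simpa [div_self hi] using hL)
  obtain ⟨B, hB, hBB⟩ := eventually_prod_self_iff'.1 hev
  refine ⟨B ∩ {x | x i ≠ 0}, inter_mem hB
    ((continuous_apply i).continuousAt.eventually_ne hi), W₀, hW₀,
    fun G g h x hx hx0 hGx z hz hz0 hg => ?_⟩
  rw [h.map_proj x hx0] at hg
  obtain ⟨c, hc⟩ := (proj_eq_proj_iff (h.ne_zero x hx0) hz0).1 hg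
  have hcL : c ∈ L := by
    have h2 := hBB _ hGx.1 _ hz.1
    rw [← hc] at h2
    have hzi : z i ≠ 0 := hz.2
    simpa [hzi] using h2
  obtain ⟨hc0, μ, hμM, hμ0, hμ⟩ := hLM c hcL
  refine ⟨μ • x, hMW (mk_mem_prod hμM hx), ?_, proj_smul hμ0 x⟩
  rw [h.homog, ← hc, smul_smul, hμ, one_smul]

/-- The multiplicity can be computed on a lift. -/
theorem IsLift.localMult_eq {G : E k → E k} {g : P k → P k} (h : IsLift D G g) (hD : D ≠ 0)
    -- The two inequalities rest on opposite facts: each nearby projective preimage has a rescaling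
    -- over the chosen representative `z`, and nearby preimages of one `z` on the same line
    -- coincide.
    {v : E k} (hv : v ≠ 0) : localMult g (proj v) = localMult G v := by
  have hGv := h.ne_zero v hv
  apply le_antisymm
  · obtain ⟨W, hW, hWle⟩ := exists_encard_le_localMult G v
    obtain ⟨B, hB, W₀, hW₀, hlift⟩ := exists_lift_preimage hD hGv hW
    have hW₁ : W₀ ∩ {x | x ≠ 0} ∩ G ⁻¹' B ∈ 𝓝 v :=
      inter_mem (inter_mem hW₀ (isOpen_ne.mem_nhds hv))
        (h.contDiff.continuous.continuousAt hB)
    refine localMult_le (W := proj '' (W₀ ∩ {x | x ≠ 0} ∩ G ⁻¹' B)) ?_ ?_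
    · rw [← map_proj_nhds hv]
      exact image_mem_map hW₁
    · rw [h.map_proj v hv, ← map_proj_nhds hGv, eventually_map]
      filter_upwards [hWle, hB, isOpen_ne.mem_nhds hGv] with z hz1 hz2 hz3
      refine le_trans ?_ hz1
      refine le_trans (encard_le_encard (t := proj '' (G ⁻¹' {z} ∩ W)) ?_) (encard_image_le _ _)
      rintro _ ⟨hq, x, ⟨⟨hx1, hx2⟩, hx3⟩, rfl⟩
      obtain ⟨x', hx'W, hx'G, hx'⟩ := hlift G g h x hx1 hx2 hx3 z hz2 hz3 hq
      exact ⟨x', ⟨hx'G, hx'W⟩, hx'⟩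
  · obtain ⟨W, hW, hWle⟩ := exists_encard_le_localMult g (proj v)
    obtain ⟨N, hN, hN0, hNinj⟩ := h.exists_injOn_proj hD hv
    have hW' : N ∩ proj ⁻¹' W ∈ 𝓝 v := inter_mem hN (continuousAt_proj hv hW)
    refine localMult_le hW' ?_
    rw [h.map_proj v hv, ← map_proj_nhds hGv, eventually_map] at hWle
    filter_upwards [hWle] with z hz
    refine le_trans ?_ hz
    have hinj : InjOn proj (G ⁻¹' {z} ∩ (N ∩ proj ⁻¹' W)) := fun x hx y hy hxy =>
      hNinj x hx.2.1 y hy.2.1 (hx.1.trans hy.1.symm) hxy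
    rw [← hinj.encard_image]
    refine encard_le_encard ?_
    rintro _ ⟨x, ⟨hx1, hx2, hx3⟩, rfl⟩
    have hx1' : G x = z := hx1
    exact ⟨by rw [mem_preimage, h.map_proj x (hN0 x hx2), hx1']; rfl, hx3⟩

/-- Fibres of a lift over non-zero vectors are finite. -/
theorem IsLift.finite_fiber_lift {G : E k → E k} {g : P k → P k} (h : IsLift D G g) (hD : D ≠ 0)
    (w : E k) : (G ⁻¹' {w}).Finite := by
  obtain ⟨c, hc0, hc⟩ : ∃ c > 0, ∀ x : E k, c * ‖x‖ ^ D ≤ ‖G x‖ := by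
    have hcpt := isCompact_sphere (0 : E k) 1
    have hne : (sphere (0 : E k) 1).Nonempty := NormedSpace.sphere_nonempty.2 zero_le_one
    obtain ⟨u, hu, hmin⟩ := hcpt.exists_isMinOn hne
      (f := fun x => ‖G x‖) h.contDiff.continuous.norm.continuousOn
    have hu0 : u ≠ 0 := norm_ne_zero_iff.1 (by rw [mem_sphere_zero_iff_norm.1 hu]; exact one_ne_zero)
    refine ⟨‖G u‖, norm_pos_iff.2 (h.ne_zero u hu0), fun x => ?_⟩
    by_cases hx : x = 0
    · simp [hx, hD]
    · have hn : ‖x‖ ≠ 0 := norm_ne_zero_iff.2 hx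
      have h1 : x = (‖x‖ : ℂ) • ((‖x‖ : ℂ)⁻¹ • x) := by
        rw [smul_smul, mul_inv_cancel₀ (by exact_mod_cast hn), one_smul]
      have h2 : (‖x‖ : ℂ)⁻¹ • x ∈ sphere (0 : E k) 1 := by
        rw [mem_sphere_zero_iff_norm, norm_smul, norm_inv, Complex.norm_real, norm_norm,
          inv_mul_cancel₀ hn]
      have h3 : ‖G x‖ = ‖x‖ ^ D * ‖G ((‖x‖ : ℂ)⁻¹ • x)‖ := by
        conv_lhs => rw [h1, h.homog]
        rw [norm_smul, norm_pow, Complex.norm_real, norm_norm]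
      rw [h3, mul_comm]
      gcongr
      exact hmin h2
  obtain ⟨r, hr0, hr⟩ : ∃ r > 0, ‖w‖ < c * r ^ D := by
    have ht : Tendsto (fun r : ℝ => c * r ^ D) atTop atTop :=
      (tendsto_pow_atTop hD).const_mul_atTop hc0
    obtain ⟨r, hr⟩ := ((ht.eventually_gt_atTop ‖w‖).and (eventually_gt_atTop 0)).exists
    exact ⟨r, hr.2, hr.1⟩
  have hsub : ∀ x, G x = w → ‖x‖ < r := fun x hx => by
    by_contra hlt
    have h1 : c * r ^ D ≤ c * ‖x‖ ^ D := by gcongr; exact not_lt.1 hlt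
    have h2 := hc x
    rw [hx] at h2
    linarith
  -- Homogeneity bounds the fibre, so it lies inside the ball of radius `r`. A regular value near
  -- `w` has finitely many preimages there, and their number dominates the fibre over `w`.
  obtain ⟨ε, hε, hkey⟩ := exists_encard_fiber_le h.contDiff (isCompact_closedBall (0 : E k) r)
    (p := w) (fun x _ hxi hxw => hxi (by
      rw [interior_closedBall _ hr0.ne', mem_ball_zero_iff]; exact hsub x hxw))
  obtain ⟨p', hreg, hp'⟩ := ((frequently_regular h.contDiff w).and_eventually
    (ball_mem_nhds _ hε)).exists
  have h1 := hkey G G h.contDiff h.contDiff (by simpa using fun _ _ => hε)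
    (by simpa using fun _ _ => hε) p' hp' w (mem_ball_self hε) (fun x _ => hreg x)
  have h2 : (G ⁻¹' {w} ∩ closedBall 0 r).Finite :=
    encard_lt_top_iff.1 (h1.2.1.trans_lt (encard_lt_top_iff.2 h1.1))
  exact h2.subset fun x hx => ⟨hx, mem_closedBall_zero_iff.2 (hsub x hx).le⟩

theorem exists_pow_mul_eq_one (hD : D ≠ 0) {c : ℂ} (hc : c ≠ 0) : ∃ μ : ℂ, μ ≠ 0 ∧ μ ^ D * c = 1 := by
  obtain ⟨μ, hμ⟩ := IsAlgClosed.exists_pow_nat_eq c⁻¹ (Nat.pos_of_ne_zero hD)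
  refine ⟨μ, ?_, by rw [hμ, inv_mul_cancel₀ hc]⟩
  rintro rfl
  rw [zero_pow hD] at hμ
  exact inv_ne_zero hc hμ.symm

/-- Any representative of `y` is mapped to a multiple of `w`, and a `D`-th root of the inverse
multiple corrects it. -/
theorem IsLift.exists_preimage {G : E k → E k} {g : P k → P k} (h : IsLift D G g) (hD : D ≠ 0)
    {w : E k} (hw : w ≠ 0) {y : P k} (hy : g y = proj w) : ∃ v, v ≠ 0 ∧ proj v = y ∧ G v = w := by
  obtain ⟨x, hx, rfl⟩ := exists_proj_eq y
  rw [h.map_proj x hx] at hy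
  obtain ⟨c, hc⟩ := (proj_eq_proj_iff (h.ne_zero x hx) hw).1 hy
  have hc0 : c ≠ 0 := by
    rintro rfl
    exact h.ne_zero x hx (by rw [← hc, zero_smul])
  obtain ⟨μ, hμ0, hμ⟩ := exists_pow_mul_eq_one hD hc0
  exact ⟨μ • x, smul_ne_zero hμ0 hx, proj_smul hμ0 x, by rw [h.homog, ← hc, smul_smul, hμ, one_smul]⟩

theorem IsLift.finite_fiber {G : E k → E k} {g : P k → P k} (h : IsLift D G g) (hD : D ≠ 0)
    (p : P k) : (g ⁻¹' {p}).Finite := by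
  obtain ⟨w, hw, rfl⟩ := exists_proj_eq p
  refine ((h.finite_fiber_lift hD w).image proj).subset fun y hy => ?_
  obtain ⟨v, -, hv, hvw⟩ := h.exists_preimage hD hw hy
  exact ⟨v, hvw, hv⟩

/-- Upper semi-continuity, in the map and in the point, of the number of preimages in a compact
set counted with multiplicity. -/
theorem IsLift.eventually_numPreimages_le {ι : Type*} {l : Filter ι} {F : E k → E k}
    {f : P k → P k} (hF : IsLift D F f) (hD : D ≠ 0) {G : ι → E k → E k} {g : ι → P k → P k}
    (hG : ∀ i, IsLift D (G i) (g i))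
    (hlim : ∀ C : Set (E k), IsCompact C → ∀ ε > 0, ∀ᶠ i in l, ∀ x ∈ C, ‖G i x - F x‖ < ε)
    {K : Set (P k)} (hK : IsCompact K) (p : P k) :
    numPreimages f K p < ⊤ ∧
      ∀ᶠ z in l ×ˢ 𝓝 p, numPreimages (g z.1) K z.2 ≤ numPreimages f K p := by
  obtain ⟨w, hw, rfl⟩ := exists_proj_eq p
  have hFc := hF.contDiff.continuous
  have hfin : (f ⁻¹' {proj w} ∩ K).Finite := (hF.finite_fiber hD _).subset inter_subset_left
  have := hfin.fintype
  have hlift : ∀ y : ↥(f ⁻¹' {proj w} ∩ K), ∃ v, v ≠ 0 ∧ proj v = y.1 ∧ F v = w := fun y =>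
    hF.exists_preimage hD hw y.2.1
  choose v hv0 hvy hvw using hlift
  -- isolating compact neighbourhoods
  have hiso : ∀ y, ∃ r > 0, ∀ x ∈ closedBall (v y) r, x ≠ 0 ∧ (F x = F (v y) → x = v y) := by
    intro y
    have h1 : (F ⁻¹' {w} \ {v y})ᶜ ∩ {x | x ≠ 0} ∈ 𝓝 (v y) :=
      inter_mem (((hF.finite_fiber_lift hD w).subset sdiff_subset).isClosed.isOpen_compl.mem_nhds
        (by simp)) (isOpen_ne.mem_nhds (hv0 y))
    obtain ⟨r, hr0, hr⟩ := nhds_basis_closedBall.mem_iff.1 h1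
    refine ⟨r, hr0, fun x hx => ⟨(hr hx).2, fun hxF => ?_⟩⟩
    by_contra hne
    exact (hr hx).1 ⟨hxF.trans (hvw y), hne⟩
  choose r hr0 hr using hiso
  have hvint : ∀ y, v y ∈ interior (closedBall (v y) (r y)) := fun y =>
    mem_interior_iff_mem_nhds.2 (closedBall_mem_nhds _ (hr0 y))
  have husc := fun y => exists_tsum_localMult_le hF.contDiff (isCompact_closedBall (v y) (r y))
    (hvint y) (fun x hx => (hr y x hx).2)
  have hsum : numPreimages f K (proj w) = ∑ y, (localMult F (v y) : ENNReal) := by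
    rw [numPreimages, tsum_fintype]
    refine Finset.sum_congr rfl fun y _ => ?_
    rw [mult_eq_localMult, ← hvy y, hF.localMult_eq hD (hv0 y)]
  refine ⟨?_, ?_⟩
  · rw [hsum]
    exact ENNReal.sum_lt_top.2 fun y _ => ENat.toENNReal_lt_top.2 (husc y).1
  choose ε hε0 hε using fun y => (husc y).2
  choose B hB W₀ hW₀ hBW using fun y => exists_lift_preimage hD hw
    (closedBall_mem_nhds (v y) (hr0 y))
  -- smaller neighbourhoods on which the maps take values in `B`
  have hsmall : ∀ y, ∃ ρ > 0, ∃ β > 0, closedBall (v y) ρ ⊆ W₀ y ∩ closedBall (v y) (r y) ∧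
      ∀ x ∈ closedBall (v y) ρ, ∀ z, ‖z - F x‖ < β → z ∈ B y := by
    intro y
    obtain ⟨β, hβ0, hβ⟩ := Metric.mem_nhds_iff.1 (hB y)
    have h1 : W₀ y ∩ closedBall (v y) (r y) ∩ F ⁻¹' ball w (β / 2) ∈ 𝓝 (v y) :=
      inter_mem (inter_mem (hW₀ y) (closedBall_mem_nhds _ (hr0 y)))
        (hFc.continuousAt (by rw [hvw]; exact ball_mem_nhds _ (half_pos hβ0)))
    obtain ⟨ρ, hρ0, hρ⟩ := nhds_basis_closedBall.mem_iff.1 h1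
    refine ⟨ρ, hρ0, β / 2, half_pos hβ0, fun x hx => (hρ hx).1, fun x hx z hz => hβ ?_⟩
    have h2 : dist (F x) w < β / 2 := (hρ hx).2
    rw [mem_ball]
    calc dist z w ≤ dist z (F x) + dist (F x) w := dist_triangle _ _ _
      _ < β / 2 + β / 2 := by rw [dist_eq_norm z]; gcongr
      _ = β := add_halves β
  choose ρ hρ0 β hβ0 hρ hρβ using hsmall
  set O : Set (P k) := ⋃ y, proj '' ball (v y) (ρ y) with hO
  have hOo : IsOpen O := isOpen_iUnion fun y => by
    rw [isOpen_iff_mem_nhds]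
    rintro _ ⟨x, hx, rfl⟩
    have hx0 : x ≠ 0 := (hr y x (hρ y (ball_subset_closedBall hx)).2).1
    rw [← map_proj_nhds hx0]
    exact image_mem_map (isOpen_ball.mem_nhds hx)
  -- no preimages in `K \ O`
  have hout : ∀ᶠ z in l ×ˢ 𝓝 (proj w), ∀ y ∈ K \ O, g z.1 y ≠ z.2 := by
    have hloc : ∀ y ∈ K \ O, ∃ U ∈ 𝓝 y, ∀ᶠ z in l ×ˢ 𝓝 (proj w), ∀ y' ∈ U, g z.1 y' ≠ z.2 := by
      intro y hy
      have hne : f y ≠ proj w := fun h => by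
        refine hy.2 (mem_iUnion.2 ⟨⟨y, h, hy.1⟩, v ⟨y, h, hy.1⟩, mem_ball_self (hρ0 _), hvy _⟩)
      obtain ⟨A, A', hA, hA', hyA, hwA', hAA'⟩ := t2_separation hne
      obtain ⟨x, hx, rfl⟩ := exists_proj_eq y
      rw [hF.map_proj x hx] at hyA
      obtain ⟨a, ha0, ha⟩ := Metric.mem_nhds_iff.1
        ((continuousAt_proj (hF.ne_zero x hx)) (hA.mem_nhds hyA))
      have h1 : F ⁻¹' ball (F x) (a / 2) ∩ {x | x ≠ 0} ∈ 𝓝 x :=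
        inter_mem (hFc.continuousAt (ball_mem_nhds _ (half_pos ha0))) (isOpen_ne.mem_nhds hx)
      obtain ⟨s, hs0, hs⟩ := nhds_basis_closedBall.mem_iff.1 h1
      refine ⟨proj '' closedBall x s, ?_, ?_⟩
      · rw [← map_proj_nhds hx]
        exact image_mem_map (closedBall_mem_nhds _ hs0)
      · filter_upwards [(hlim _ (isCompact_closedBall x s) _ (half_pos ha0)).prod_mk
          (hA'.mem_nhds hwA')] with z hz
        rintro _ ⟨x', hx', rfl⟩ heq
        have h2 : g z.1 (proj x') ∈ A := by
          rw [(hG z.1).map_proj x' (hs hx').2]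
          refine ha ?_
          have h3 : dist (F x') (F x) < a / 2 := (hs hx').1
          have h4 := hz.1 x' hx'
          rw [mem_ball]
          calc dist (G z.1 x') (F x) ≤ dist (G z.1 x') (F x') + dist (F x') (F x) :=
                dist_triangle _ _ _
            _ < a / 2 + a / 2 := by rw [dist_eq_norm (G z.1 x')]; gcongr
            _ = a := add_halves a
        exact disjoint_left.1 hAA' h2 (heq ▸ hz.2)
    choose! U hU hUev using hloc
    obtain ⟨t, htK, ht⟩ := (hK.diff hOo).elim_nhds_subcover U hU
    filter_upwards [(Finset.eventually_all t).2 fun y hy => hUev y (htK y hy)] with z hz y hy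
    obtain ⟨y', hy't, hy'⟩ := mem_iUnion₂.1 (ht hy)
    exact hz y' hy't y hy'
  have hclose : ∀ᶠ i in l, ∀ y, (∀ x ∈ closedBall (v y) (r y), ‖G i x - F x‖ < ε y) ∧
      ∀ x ∈ closedBall (v y) (ρ y), ‖G i x - F x‖ < β y :=
    eventually_all.2 fun y => (hlim _ (isCompact_closedBall _ _) _ (hε0 y)).and
      (hlim _ (isCompact_closedBall _ _) _ (hβ0 y))
  have hwev : ∀ᶠ q in 𝓝 (proj w : P k), ∃ z : E k, z ≠ 0 ∧ proj z = q ∧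
      ∀ y, z ∈ B y ∧ z ∈ ball (F (v y)) (ε y) := by
    have h1 : ∀ᶠ z in 𝓝 w, z ≠ 0 ∧ ∀ y, z ∈ B y ∧ z ∈ ball (F (v y)) (ε y) := by
      refine Filter.Eventually.and (continuousAt_id.eventually_ne hw) (eventually_all.2 fun y => ?_)
      refine Filter.Eventually.and (hB y) ?_
      rw [hvw]
      exact ball_mem_nhds _ (hε0 y)
    rw [← map_proj_nhds hw, eventually_map]
    filter_upwards [h1] with z hz using ⟨z, hz.1, rfl, hz.2⟩
  filter_upwards [hout, hclose.prod_mk hwev] with z hz1 hz2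
  obtain ⟨hcl, u, hu0, huq, hu⟩ := hz2
  choose S hS hSle using fun y => hε y (G z.1) (hG z.1).contDiff (hcl y).1 u (hu y).2
  rw [hsum]
  -- Every preimage of `z.2` in `K` is on the line of some vector that `G` maps to the single
  -- representative `u`, in one of the balls around the `v y`. The count for `g` thus injects into
  -- the disjoint union of the local counts for `G`.
  have hpre : ∀ x : ↥(g z.1 ⁻¹' {z.2} ∩ K), ∃ a : Σ y, ↥(S y), proj a.2.1 = x.1 := by
    rintro ⟨x, hx, hxK⟩
    have hxO : x ∈ O := by
      by_contra h
      exact hz1 x ⟨hxK, h⟩ hx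
    obtain ⟨y, x', hx', rfl⟩ := mem_iUnion.1 hxO
    have hx'c := ball_subset_closedBall hx'
    have hx'0 : x' ≠ 0 := (hr y x' (hρ y hx'c).2).1
    have hgx : g z.1 (proj x') = proj u := by rw [huq]; exact hx
    obtain ⟨a, haW, haG, ha⟩ := hBW y (G z.1) (g z.1) (hG z.1) x' (hρ y hx'c).1 hx'0
      (hρβ y x' hx'c _ ((hcl y).2 x' hx'c)) u (hu y).1 hu0 hgx
    exact ⟨⟨y, a, (hS y a).2 ⟨haG, haW⟩⟩, ha⟩
  choose Φ hΦ using hpre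
  have hΦinj : Function.Injective Φ := fun a b hab => Subtype.ext (by rw [← hΦ a, ← hΦ b, hab])
  calc numPreimages (g z.1) K z.2
      = ∑' x, ((fun a : Σ y, ↥(S y) => (localMult (G z.1) a.2.1 : ENNReal)) (Φ x)) := by
        rw [numPreimages]
        refine tsum_congr fun x => ?_
        have h0 : (Φ x).2.1 ≠ 0 := (hr _ _ ((hS _ _).1 (Φ x).2.2).2).1
        simp only [mult_eq_localMult]
        rw [← (hG z.1).localMult_eq hD h0, hΦ]
    _ ≤ ∑' a : Σ y, ↥(S y), (localMult (G z.1) a.2.1 : ENNReal) :=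
        ENNReal.tsum_comp_le_tsum_of_injective hΦinj _
    _ = ∑ y, ∑ x ∈ S y, (localMult (G z.1) x : ENNReal) := by
        rw [ENNReal.tsum_sigma', tsum_fintype]
        refine Finset.sum_congr rfl fun y _ => ?_
        rw [tsum_fintype]
        exact Finset.sum_coe_sort (S y) fun x => (localMult (G z.1) x : ENNReal)
    _ ≤ ∑ y, (localMult F (v y) : ENNReal) := by
        refine Finset.sum_le_sum fun y _ => ?_
        have h1 := ENat.toENNReal_le.2 (hSle y)
        refine le_trans (le_of_eq ?_) h1
        exact (map_sum ENat.toENNRealRingHom _ _).symm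

end Transfer

/-! ### Stability of trapping regions and of the growth of preimages -/

section SmallDegree

open Set Filter

variable {k d : ℕ}

theorem continuous_lift_map : Continuous fun z : Lift k d × P k => z.1.map z.2 := by
  refine continuous_iff_continuousAt.2 fun ⟨F, p⟩ => ?_
  obtain ⟨v, hv, rfl⟩ := exists_proj_eq p
  have h1 : ContinuousAt (fun z : Lift k d × E k => proj (z.1.evalMap z.2)) (F, v) :=
    ContinuousAt.comp (g := proj) (continuousAt_proj (F.isLift.ne_zero v hv))
      continuous_evalMap.continuousAt
  have h2 : 𝓝 (F, proj v) = map (fun z : Lift k d × E k => (z.1, proj z.2)) (𝓝 (F, v)) := by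
    rw [nhds_prod_eq, ← map_proj_nhds hv, nhds_prod_eq]
    have := Filter.prod_map_map_eq (f₁ := 𝓝 F) (f₂ := 𝓝 v) (m₁ := (id : Lift k d → Lift k d))
      (m₂ := (proj : E k → P k))
    rw [map_id] at this
    exact this
  rw [ContinuousAt, h2, tendsto_map'_iff, F.isLift.map_proj v hv]
  refine Tendsto.congr' ?_ h1
  have h3 : ∀ᶠ z : Lift k d × E k in 𝓝 (F, v), z.2 ≠ 0 :=
    continuousAt_snd.eventually_ne hv
  filter_upwards [h3] with z hz using (z.1.isLift.map_proj z.2 hz).symm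

theorem eventually_iterate_close (F : Lift k d) (n : ℕ) {C : Set (E k)} (hC : IsCompact C) {ε : ℝ}
    (hε : 0 < ε) : ∀ᶠ F' in 𝓝 F, ∀ x ∈ C, ‖F'.evalMap^[n] x - F.evalMap^[n] x‖ < ε := by
  refine hC.eventually_forall_of_forall_eventually fun x _ => ?_
  have h1 := continuous_evalMap_iterate (k := k) (d := d) n
  have h2 : Continuous fun z : Lift k d × E k => ‖z.1.evalMap^[n] z.2 - F.evalMap^[n] z.2‖ := by
    have h3 : Continuous fun z : Lift k d × E k => F.evalMap^[n] z.2 :=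
      h1.comp (continuous_const.prodMk continuous_snd)
    exact (h1.sub h3).norm
  exact h2.continuousAt.eventually (gt_mem_nhds (by simpa using hε))

theorem numPreimages_mono (f : P k → P k) {U W : Set (P k)} (h : U ⊆ W) (p : P k) :
    numPreimages f U p ≤ numPreimages f W p :=
  ENNReal.tsum_mono_subtype (fun y => (mult f y : ENNReal)) (inter_subset_inter_right _ h)

/-- Preimages under a composition are counted fibrewise. -/
theorem numPreimages_comp_le {f g : P k → P k} (hg : Continuous g) {U : Set (P k)}
    (hgU : MapsTo g U U) (q : P k) {B : ENNReal} (hB : ∀ y ∈ U, numPreimages g U y ≤ B) :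
    numPreimages (f ∘ g) U q ≤ numPreimages f U q * B := by
  let Φ : ↥((f ∘ g) ⁻¹' {q} ∩ U) → Σ y : ↥(f ⁻¹' {q} ∩ U), ↥(g ⁻¹' {y.1} ∩ U) := fun x =>
    ⟨⟨g x.1, x.2.1, hgU x.2.2⟩, ⟨x.1, rfl, x.2.2⟩⟩
  have hΦ : Function.Injective Φ := fun a b hab => by
    have : ∀ x, (Φ x).2.1 = x.1 := fun _ => rfl
    exact Subtype.ext (by rw [← this a, ← this b, hab])
  calc numPreimages (f ∘ g) U q
      ≤ ∑' x, (fun a : Σ y : ↥(f ⁻¹' {q} ∩ U), ↥(g ⁻¹' {y.1} ∩ U) =>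
          (mult f a.1.1 : ENNReal) * (mult g a.2.1 : ENNReal)) (Φ x) := by
        refine ENNReal.tsum_le_tsum fun x => ?_
        simp only [Φ, mult_eq_localMult]
        rw [← ENat.toENNReal_mul, ENat.toENNReal_le, mul_comm]
        exact localMult_comp_le hg.continuousAt
    _ ≤ ∑' a : Σ y : ↥(f ⁻¹' {q} ∩ U), ↥(g ⁻¹' {y.1} ∩ U),
          (mult f a.1.1 : ENNReal) * (mult g a.2.1 : ENNReal) :=
        ENNReal.tsum_comp_le_tsum_of_injective hΦ _
    _ = ∑' y : ↥(f ⁻¹' {q} ∩ U), (mult f y.1 : ENNReal) * numPreimages g U y.1 := by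
        rw [ENNReal.tsum_sigma']
        refine tsum_congr fun y => ?_
        exact ENNReal.tsum_mul_left (a := (mult f y.1 : ENNReal))
          (f := fun b : ↥(g ⁻¹' {y.1} ∩ U) => (mult g b.1 : ENNReal))
    _ ≤ ∑' y : ↥(f ⁻¹' {q} ∩ U), (mult f y.1 : ENNReal) * B :=
        ENNReal.tsum_le_tsum fun y => by gcongr; exact hB _ y.2.2
    _ = numPreimages f U q * B := by rw [ENNReal.tsum_mul_right]; rfl

theorem numPreimages_iterate_eq_zero {f : P k → P k} {U : Set (P k)} (hfU : MapsTo f U U)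
    {p : P k} (hp : p ∉ f '' U) {n : ℕ} (hn : n ≠ 0) : numPreimages f^[n] U p = 0 := by
  have : IsEmpty ↥(f^[n] ⁻¹' {p} ∩ U) := by
    refine ⟨fun ⟨x, hx, hxU⟩ => hp ?_⟩
    obtain ⟨m, rfl⟩ := Nat.exists_eq_succ_of_ne_zero hn
    rw [mem_preimage, Function.iterate_succ_apply'] at hx
    exact ⟨f^[m] x, hfU.iterate m hxU, hx⟩
  rw [numPreimages, tsum_empty]

theorem eventually_numPreimages_iterate_le (F : Lift k d) (hd : d ≠ 0) {K : Set (P k)}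
    (hK : IsCompact K) (n : ℕ) (p : P k) : numPreimages F.map^[n] K p < ⊤ ∧
      ∀ᶠ z : Lift k d × P k in 𝓝 F ×ˢ 𝓝 p,
        numPreimages z.1.map^[n] K z.2 ≤ numPreimages F.map^[n] K p := by
  have hlim : ∀ C : Set (E k), IsCompact C → ∀ ε > 0, ∀ᶠ F' in 𝓝 F, ∀ x ∈ C,
      ‖(fun F' : Lift k d => F'.evalMap^[n]) F' x - F.evalMap^[n] x‖ < ε :=
    fun C hC ε hε => eventually_iterate_close F n hC hε
  have hlift : ∀ F' : Lift k d, IsLift (d ^ n) ((fun F' : Lift k d => F'.evalMap^[n]) F')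
      ((fun F' : Lift k d => F'.map^[n]) F') := by
    intro F'
    beta_reduce
    have h := F'.isLift
    exact h.iterate n
  have hdn : d ^ n ≠ 0 := pow_ne_zero n hd
  exact (F.isLift.iterate n).eventually_numPreimages_le hdn hlift hlim hK p

/-- Uniform bound of the number of preimages in a compact set, over finitely many pieces. -/
theorem exists_finset_eventually_numPreimages_le (F : Lift k d) (hd : d ≠ 0) {K : Set (P k)}
    (hK : IsCompact K) (n : P k → ℕ) :
    ∃ t : Finset (P k), ↑t ⊆ K ∧ ∀ᶠ F' in 𝓝 F, ∀ q ∈ K, ∃ p ∈ t,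
      numPreimages F'.map^[n p] K q ≤ numPreimages F.map^[n p] K p := by
  have hloc : ∀ p ∈ K, ∃ V ∈ 𝓝 p, ∀ᶠ F' in 𝓝 F, ∀ q ∈ V,
      numPreimages F'.map^[n p] K q ≤ numPreimages F.map^[n p] K p := by
    intro p _
    have h1 := (eventually_numPreimages_iterate_le F hd hK (n p) p).2
    obtain ⟨A, hA, V, hV, hAV⟩ := mem_prod_iff.1 h1
    refine ⟨V, hV, ?_⟩
    filter_upwards [hA] with F' hF' q hq
    have h2 : (F', q) ∈ A ×ˢ V := ⟨hF', hq⟩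
    have h3 := hAV h2
    rw [mem_ofPred_eq] at h3
    exact h3
  choose! V hV hVev using hloc
  obtain ⟨t, htK, ht⟩ := hK.elim_nhds_subcover V hV
  refine ⟨t, htK, ?_⟩
  filter_upwards [(Finset.eventually_all t).2 fun p hp => hVev p (htK p hp)] with F' hF' q hq
  obtain ⟨p, hpt, hqp⟩ := mem_iUnion₂.1 (ht hq)
  exact ⟨p, hpt, hF' p hpt q hqp⟩

theorem exists_eventually_numPreimages_le (F : Lift k d) (hd : d ≠ 0) {K : Set (P k)}
    (hK : IsCompact K) (m : ℕ) :
    ∃ C : ENNReal, C ≠ ⊤ ∧ ∀ᶠ F' in 𝓝 F, ∀ q ∈ K, numPreimages F'.map^[m] K q ≤ C := by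
  obtain ⟨t, -, ht⟩ := exists_finset_eventually_numPreimages_le F hd hK (fun _ => m)
  refine ⟨∑ p ∈ t, numPreimages F.map^[m] K p, ?_, ?_⟩
  · refine (ENNReal.sum_lt_top.2 fun p _ => ?_).ne
    exact (eventually_numPreimages_iterate_le F hd hK m p).1
  · filter_upwards [ht] with F' hF' q hq
    obtain ⟨p, hp, hle⟩ := hF' q hq
    exact hle.trans (Finset.single_le_sum (f := fun p => numPreimages F.map^[m] K p)
      (fun _ _ => zero_le) hp)

/-- The limsup hypothesis covers only `p ∈ f '' U`. Any other point has no preimage in `U` at all,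
so `n = 1` and `c = 0` serve, and the conclusion holds at every point, as needed for a compactness
argument over `K`. -/
theorem exists_numPreimages_le_pow {f : P k → P k} {U : Set (P k)} (hfU : MapsTo f U U)
    {L : ENNReal} (hL : 0 < L)
    (hsmall : ∀ p ∈ f '' U, limsup (fun n : ℕ => numPreimages f^[n] U p ^ (1 / (n : ℝ))) atTop < L)
    (p : P k) : ∃ n : ℕ, n ≠ 0 ∧ ∃ c < L, numPreimages f^[n] U p ≤ c ^ n := by
  by_cases hp : p ∈ f '' U
  · obtain ⟨c, hc1, hc2⟩ := exists_between (hsmall p hp)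
    obtain ⟨n, hn, hn0⟩ := ((eventually_lt_of_limsup_lt hc1).and (eventually_ne_atTop 0)).exists
    refine ⟨n, hn0, c, hc2, ?_⟩
    have hn0' : (n : ℝ) ≠ 0 := by exact_mod_cast hn0
    calc numPreimages f^[n] U p = (numPreimages f^[n] U p ^ (1 / (n : ℝ))) ^ n := by
          rw [← ENNReal.rpow_natCast, ← ENNReal.rpow_mul, one_div, inv_mul_cancel₀ hn0',
            ENNReal.rpow_one]
      _ ≤ c ^ n := by gcongr
  · exact ⟨1, one_ne_zero, 0, hL, by rw [numPreimages_iterate_eq_zero hfU hp one_ne_zero]; simp⟩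

/-- For `Λ < Λ' < L` the constant is absorbed, since `C * (Λ / Λ') ^ n` tends to zero. -/
theorem limsup_rpow_lt {N : ℕ → ENNReal} {C Λ L : ENNReal} (hC : C ≠ ⊤) (hΛL : Λ < L)
    (hN : ∀ n, N n ≤ C * Λ ^ n) : limsup (fun n : ℕ => N n ^ (1 / (n : ℝ))) atTop < L := by
  obtain ⟨Λ', h1, h2⟩ := exists_between hΛL
  have h0 : Λ' ≠ 0 := (bot_le.trans_lt h1).ne'
  have htop : Λ' ≠ ⊤ := (h2.trans_le le_top).ne
  refine lt_of_le_of_lt (limsup_le_of_le (h := ?_)) h2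
  have hlt : Λ / Λ' < 1 := (ENNReal.div_lt_iff (Or.inl h0) (Or.inl htop)).2 (by rwa [one_mul])
  have ht : Tendsto (fun n : ℕ => C * (Λ / Λ') ^ n) atTop (𝓝 (C * 0)) :=
    ENNReal.Tendsto.const_mul (ENNReal.tendsto_pow_atTop_nhds_zero_of_lt_one hlt) (Or.inr hC)
  rw [mul_zero] at ht
  filter_upwards [ht.eventually (gt_mem_nhds zero_lt_one), eventually_ne_atTop 0] with n hn hn0
  have hn0' : (n : ℝ) ≠ 0 := by exact_mod_cast hn0
  have hle : N n ≤ Λ' ^ n := by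
    calc N n ≤ C * Λ ^ n := hN n
      _ = C * (Λ / Λ') ^ n * Λ' ^ n := by
          rw [mul_assoc, ← mul_pow, ENNReal.div_mul_cancel h0 htop]
      _ ≤ 1 * Λ' ^ n := by gcongr
      _ = Λ' ^ n := one_mul _
  calc N n ^ (1 / (n : ℝ)) ≤ (Λ' ^ n) ^ (1 / (n : ℝ)) := by gcongr
    _ = Λ' := by
      rw [← ENNReal.rpow_natCast, ← ENNReal.rpow_mul, one_div, mul_inv_cancel₀ hn0',
        ENNReal.rpow_one]

/-- The condition of small topological degree is stable, after shrinking the trapping region. -/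
theorem exists_stable_trappingRegion (F : Lift k d) (hd : d ≠ 0) {U : Set (P k)}
    (hU : IsTrappingRegion F.map U) {L : ENNReal} (hL : 0 < L)
    (hsmall : ∀ p ∈ F.map '' U,
      limsup (fun n : ℕ => numPreimages F.map^[n] U p ^ (1 / (n : ℝ))) atTop < L) :
    ∃ U' : Set (P k), U' ⊆ U ∧ F.map '' U ⊆ U' ∧ ∀ᶠ F' in 𝓝 F, IsTrappingRegion F'.map U' ∧
      ∀ p ∈ F'.map '' U',
        limsup (fun n : ℕ => numPreimages F'.map^[n] U' p ^ (1 / (n : ℝ))) atTop < L := by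
  obtain ⟨hUo, hUc, hUsub⟩ := hU
  have hfU : MapsTo F.map U U := fun x hx => hUsub (subset_closure (mem_image_of_mem _ hx))
  -- The new region is the interior of `K`. Semicontinuity needs a compact set, and `K ⊆ U` lets the
  -- counts of `F` in `K` be bounded by those in `U`.
  obtain ⟨K, hK, hK1, hK2⟩ := exists_compact_between hUc hUo hUsub
  refine ⟨interior K, interior_subset.trans hK2, subset_closure.trans hK1, ?_⟩
  choose n hn0 c hcL hnc using exists_numPreimages_le_pow hfU hL hsmall
  obtain ⟨t, htK, ht⟩ := exists_finset_eventually_numPreimages_le F hd hK n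
  obtain ⟨Λ, hΛ1, hΛ2⟩ : ∃ Λ, (t.sup c) < Λ ∧ Λ < L :=
    exists_between ((Finset.sup_lt_iff hL).2 fun p _ => hcL p)
  have hΛ0 : Λ ≠ 0 := (bot_le.trans_lt hΛ1).ne'
  have hΛtop : Λ ≠ ⊤ := (hΛ2.trans_le le_top).ne
  choose C hC hCev using fun m => exists_eventually_numPreimages_le F hd hK m
  set M := t.sup n with hM
  -- `C'` takes care of the finitely many times `m < M` that are too short for the recursive step,
  -- which removes `n p ≤ M` iterates.
  set C' : ENNReal := ∑ m ∈ Finset.range M, C m * (Λ ^ m)⁻¹ with hC'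
  have hC'top : C' ≠ ⊤ := ENNReal.sum_ne_top.2 fun m _ =>
    ENNReal.mul_ne_top (hC m) (ENNReal.inv_ne_top.2 (pow_ne_zero _ hΛ0))
  have htrap : ∀ᶠ F' in 𝓝 F, ∀ y ∈ K, F'.map y ∈ interior K := by
    refine hK.eventually_forall_of_forall_eventually fun y hy => ?_
    refine continuous_lift_map.continuousAt.eventually (isOpen_interior.mem_nhds ?_)
    exact hK1 (subset_closure (mem_image_of_mem _ (hK2 hy)))
  filter_upwards [ht, htrap, (Finset.eventually_all (Finset.range M)).2 fun m _ => hCev m] with F'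
    h1 h2 h3
  have hcont : Continuous F'.map := F'.isLift.continuous
  have hmaps : MapsTo F'.map (interior K) (interior K) := fun x hx => h2 x (interior_subset hx)
  have hclK : closure (F'.map '' interior K) ⊆ F'.map '' K :=
    closure_minimal (image_mono interior_subset) (hK.image hcont).isClosed
  refine ⟨⟨isOpen_interior, isClosed_closure.isCompact, hclK.trans ?_⟩, fun p hp => ?_⟩
  · rintro _ ⟨y, hy, rfl⟩
    exact h2 y hy
  · -- the number of preimages grows at most like `Λ ^ n`
    have hbound : ∀ m, ∀ q ∈ interior K, numPreimages F'.map^[m] (interior K) q ≤ C' * Λ ^ m := by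
      intro m
      induction m using Nat.strong_induction_on with
      | _ m ih =>
        intro q hq
        by_cases hmM : m < M
        · have hm := Finset.mem_range.2 hmM
          calc numPreimages F'.map^[m] (interior K) q ≤ numPreimages F'.map^[m] K q :=
                numPreimages_mono _ interior_subset q
            _ ≤ C m := h3 m hm q (interior_subset hq)
            _ = C m * (Λ ^ m)⁻¹ * Λ ^ m := by
                rw [mul_assoc, ENNReal.inv_mul_cancel (pow_ne_zero _ hΛ0)
                  (ENNReal.pow_ne_top hΛtop), mul_one]
            _ ≤ C' * Λ ^ m := by
                gcongr
                exact Finset.single_le_sum (f := fun m => C m * (Λ ^ m)⁻¹)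
                  (fun _ _ => zero_le) hm
        -- The point `q` has at most `Λ ^ n p` preimages under the last `n p` iterates, and the
        -- induction hypothesis bounds the preimages of each of them under the remaining `m - n p`.
        · obtain ⟨p, hpt, hp⟩ := h1 q (interior_subset hq)
          have hnM : n p ≤ m := (Finset.le_sup hpt).trans (not_lt.1 hmM)
          have hsplit : F'.map^[m] = F'.map^[n p] ∘ F'.map^[m - n p] := by
            rw [← Function.iterate_add, Nat.add_sub_cancel' hnM]
          have hstep : numPreimages F'.map^[n p] (interior K) q ≤ Λ ^ n p := by
            calc numPreimages F'.map^[n p] (interior K) q ≤ numPreimages F'.map^[n p] K q :=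
                  numPreimages_mono _ interior_subset q
              _ ≤ numPreimages F.map^[n p] K p := hp
              _ ≤ numPreimages F.map^[n p] U p := numPreimages_mono _ hK2 p
              _ ≤ c p ^ n p := hnc p
              _ ≤ Λ ^ n p := by
                  gcongr
                  exact (Finset.le_sup hpt).trans hΛ1.le
          rw [hsplit]
          calc _ ≤ numPreimages F'.map^[n p] (interior K) q * (C' * Λ ^ (m - n p)) :=
                numPreimages_comp_le (hcont.iterate _) (hmaps.iterate _) q
                  (ih _ (Nat.sub_lt (by have := hn0 p; omega) (Nat.pos_of_ne_zero (hn0 p))))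
            _ ≤ Λ ^ n p * (C' * Λ ^ (m - n p)) := by gcongr
            _ = C' * (Λ ^ n p * Λ ^ (m - n p)) := by ring
            _ = C' * Λ ^ m := by rw [← pow_add, Nat.add_sub_cancel' hnM]
    exact limsup_rpow_lt hC'top hΛ2 fun m => hbound m p (hmaps.image_subset hp)

end SmallDegree

/-! ### Alternating forms in real coordinates -/

section MultilinearAlgebra

open Finset

variable {k n : ℕ}

/-- The real coordinates on `ℂ^(k+1)`. -/
def rcoord (p : Fin (k + 1) × Fin 2) : E k →L[ℝ] ℝ :=
  if p.2 = 0 then Complex.reCLM.comp (ContinuousLinearMap.proj p.1)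
  else Complex.imCLM.comp (ContinuousLinearMap.proj p.1)

/-- The real basis of `ℂ^(k+1)` dual to the real coordinates. -/
def rbasis (p : Fin (k + 1) × Fin 2) : E k := Pi.single p.1 (if p.2 = 0 then 1 else Complex.I)

theorem sum_rcoord_smul_rbasis (v : E k) : ∑ p, rcoord p v • rbasis p = v := by
  rw [Fintype.sum_prod_type]
  funext i
  rw [Finset.sum_apply, Finset.sum_eq_single i]
  · simp only [Fin.sum_univ_two, rcoord, rbasis, Pi.add_apply, Pi.smul_apply, Pi.single_eq_same,
      if_true, Fin.one_eq_zero_iff, ContinuousLinearMap.comp_apply, ContinuousLinearMap.proj_apply]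
    apply Complex.ext <;> simp
  · intro j _ hj
    simp [rbasis, Pi.single_eq_of_ne (Ne.symm hj)]
  · simp

theorem norm_rbasis_le (p : Fin (k + 1) × Fin 2) : ‖rbasis (k := k) p‖ ≤ 1 := by
  rw [rbasis, pi_norm_le_iff_of_nonneg zero_le_one]
  intro i
  by_cases h : i = p.1
  · subst h
    rw [Pi.single_eq_same]
    split_ifs <;> simp
  · simp [Pi.single_eq_of_ne h]

/-- The alternating form `ρ₁ ∧ ... ∧ ρₙ`. -/
def prodAlt (ρ : Fin n → E k →L[ℝ] ℝ) : E k [⋀^Fin n]→L[ℝ] ℝ :=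
  { (Matrix.detRowAlternating (n := Fin n) (R := ℝ)).compLinearMap
      (LinearMap.pi fun a => (ρ a : E k →ₗ[ℝ] ℝ)) with
    cont := by
      change Continuous fun v : Fin n → E k => Matrix.det (Matrix.of fun b a => ρ a (v b))
      refine Continuous.matrix_det ?_
      refine continuous_matrix fun b a => ?_
      exact (ρ a).continuous.comp (continuous_apply b) }

theorem prodAlt_eq_det (ρ : Fin n → E k →L[ℝ] ℝ) (v : Fin n → E k) :
    prodAlt ρ v = Matrix.det (Matrix.of fun b a => ρ a (v b)) := rfl

theorem prodAlt_apply (ρ : Fin n → E k →L[ℝ] ℝ) (v : Fin n → E k) :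
    prodAlt ρ v = ∑ σ : Equiv.Perm (Fin n), ((σ.sign : ℤ) : ℝ) * ∏ a, ρ a (v (σ a)) := by
  rw [prodAlt_eq_det, Matrix.det_apply']
  rfl

/-- This is the Laplace expansion of the determinant along its first column. -/
theorem alternatizeUncurryFin_smulRight_prodAlt (lam : E k →L[ℝ] ℝ) (ρ : Fin n → E k →L[ℝ] ℝ) :
    ContinuousAlternatingMap.alternatizeUncurryFin (lam.smulRight (prodAlt ρ)) =
      prodAlt (Fin.cons lam ρ : Fin (n + 1) → E k →L[ℝ] ℝ) := by
  ext v
  rw [ContinuousAlternatingMap.alternatizeUncurryFin_apply, prodAlt_eq_det,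
    Matrix.det_succ_column_zero]
  refine Finset.sum_congr rfl fun i _ => ?_
  rw [ContinuousLinearMap.smulRight_apply, ContinuousAlternatingMap.smul_apply, prodAlt_eq_det]
  simp only [zsmul_eq_mul, smul_eq_mul, Int.cast_pow, Int.cast_neg, Int.cast_one, Matrix.of_apply,
    Fin.cons_zero, mul_assoc]
  rfl

theorem multilinear_expand (μ : MultilinearMap ℝ (fun _ : Fin n => E k) ℝ) (u : Fin n → E k) :
    μ u = ∑ m : Fin n → Fin (k + 1) × Fin 2, μ (fun a => rbasis (m a)) * ∏ a, rcoord (m a) (u a) := by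
  conv_lhs => rw [← funext fun a => sum_rcoord_smul_rbasis (u a)]
  rw [μ.map_sum]
  refine Finset.sum_congr rfl fun m _ => ?_
  rw [μ.map_smul_univ, smul_eq_mul, mul_comm]

/-- The alternating form obtained by alternatization of a multilinear map, in coordinates. -/
def altForm (μ : (Fin n → E k) → ℝ) : E k [⋀^Fin n]→L[ℝ] ℝ :=
  ∑ m : Fin n → Fin (k + 1) × Fin 2, μ (fun a => rbasis (m a)) • prodAlt fun a => rcoord (m a)

theorem altForm_apply (μ : MultilinearMap ℝ (fun _ : Fin n => E k) ℝ) (v : Fin n → E k) :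
    altForm μ v = ∑ σ : Equiv.Perm (Fin n), ((σ.sign : ℤ) : ℝ) * μ (fun a => v (σ a)) := by
  rw [altForm, ContinuousAlternatingMap.sum_apply]
  simp only [ContinuousAlternatingMap.smul_apply, prodAlt_apply, smul_eq_mul, Finset.mul_sum]
  rw [Finset.sum_comm]
  refine Finset.sum_congr rfl fun σ _ => ?_
  rw [multilinear_expand μ, Finset.mul_sum]
  refine Finset.sum_congr rfl fun m _ => by ring

theorem altForm_alternating (η : E k [⋀^Fin n]→L[ℝ] ℝ) :
    altForm η = (n.factorial : ℝ) • η := by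
  ext v
  have h := altForm_apply η.toMultilinearMap v
  rw [show altForm η = altForm η.toMultilinearMap from rfl, h, ContinuousAlternatingMap.smul_apply]
  have h2 : ∀ σ : Equiv.Perm (Fin n), ((σ.sign : ℤ) : ℝ) * η.toMultilinearMap (fun a => v (σ a)) = η v := by
    intro σ
    have h3 : η (fun a => v (σ a)) = (σ.sign : ℤ) • η v := η.toAlternatingMap.map_perm v σ
    change ((σ.sign : ℤ) : ℝ) * η (fun a => v (σ a)) = _
    rw [h3, zsmul_eq_mul, ← mul_assoc, ← Int.cast_mul, Int.units_coe_mul_self, Int.cast_one, one_mul]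
  rw [Finset.sum_congr rfl fun σ _ => h2 σ, Finset.sum_const, Finset.card_univ, Fintype.card_perm,
    Fintype.card_fin, nsmul_eq_mul, smul_eq_mul]

theorem eq_sum_prodAlt (η : E k [⋀^Fin n]→L[ℝ] ℝ) :
    η = ∑ m : Fin n → Fin (k + 1) × Fin 2,
      (η fun a => rbasis (m a)) • (((n.factorial : ℝ)⁻¹) • prodAlt fun a => rcoord (m a)) := by
  have h := altForm_alternating η
  have hn : (n.factorial : ℝ) ≠ 0 := by exact_mod_cast n.factorial_ne_zero
  calc η = (n.factorial : ℝ)⁻¹ • altForm η := by rw [h, inv_smul_smul₀ hn]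
    _ = _ := by
      rw [altForm, Finset.smul_sum]
      exact Finset.sum_congr rfl fun m _ => smul_comm _ _ _

/-- Smoothness of forms can be tested on coefficients. -/
theorem contDiffOn_form {s : Set (E k)} {N : WithTop ℕ∞} {φ : E k → E k [⋀^Fin n]→L[ℝ] ℝ}
    (h : ∀ v : Fin n → E k, ContDiffOn ℝ N (fun x => φ x v) s) : ContDiffOn ℝ N φ s := by
  rw [show φ = fun x => _ from funext fun x => eq_sum_prodAlt (φ x)]
  exact ContDiffOn.sum fun m _ => (h _).smul contDiffOn_const

theorem contDiffOn_altForm {s : Set (E k)} {N : WithTop ℕ∞} {μ : E k → (Fin n → E k) → ℝ}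
    (h : ∀ v : Fin n → E k, ContDiffOn ℝ N (fun x => μ x v) s) :
    ContDiffOn ℝ N (fun x => altForm (μ x)) s :=
  ContDiffOn.sum fun _ _ => (h _).smul contDiffOn_const

/-- The exterior derivative becomes a signed sum over all permutations, the direction of
differentiation being argument `0`. Closedness arguments then reduce to cancellation under
transpositions. -/
theorem extDeriv_altForm {μ : E k → MultilinearMap ℝ (fun _ : Fin n => E k) ℝ} {x : E k}
    (h : ∀ v : Fin n → E k, DifferentiableAt ℝ (fun y => μ y v) x) (v : Fin (n + 1) → E k) :
    extDeriv (fun y => altForm (μ y)) x v = ∑ σ : Equiv.Perm (Fin (n + 1)), ((σ.sign : ℤ) : ℝ) *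
      fderiv ℝ (fun y => μ y fun a => v (σ a.succ)) x (v (σ 0)) := by
  have hd : HasFDerivAt (fun y => altForm (μ y)) (∑ m : Fin n → Fin (k + 1) × Fin 2,
      (fderiv ℝ (fun y => μ y fun a => rbasis (m a)) x).smulRight (prodAlt fun a => rcoord (m a))) x :=
    HasFDerivAt.fun_sum fun m _ => HasFDerivAt.smul_const
      (h fun a => rbasis (m a)).hasFDerivAt (prodAlt fun a => rcoord (m a))
  have hlin : ∀ u : Fin n → E k, fderiv ℝ (fun y => μ y u) x =
      ∑ m : Fin n → Fin (k + 1) × Fin 2, (∏ a, rcoord (m a) (u a)) •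
        fderiv ℝ (fun y => μ y fun a => rbasis (m a)) x := by
    intro u
    have h1 : HasFDerivAt (fun y => ∑ m : Fin n → Fin (k + 1) × Fin 2,
        μ y (fun a => rbasis (m a)) * ∏ a, rcoord (m a) (u a)) _ x :=
      HasFDerivAt.fun_sum fun m _ => (h fun a => rbasis (m a)).hasFDerivAt.mul_const _
    rw [show (fun y => μ y u) = _ from funext fun y => multilinear_expand (μ y) u]
    exact h1.fderiv
  rw [extDeriv, hd.fderiv, ← ContinuousAlternatingMap.alternatizeUncurryFinCLM_apply, map_sum]
  simp only [ContinuousAlternatingMap.alternatizeUncurryFinCLM_apply,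
    alternatizeUncurryFin_smulRight_prodAlt, ContinuousAlternatingMap.sum_apply, prodAlt_apply]
  rw [Finset.sum_comm]
  refine Finset.sum_congr rfl fun σ _ => ?_
  rw [hlin, _root_.sum_apply, Finset.mul_sum]
  refine Finset.sum_congr rfl fun m _ => ?_
  rw [Fin.prod_univ_succ]
  simp only [Fin.cons_zero, Fin.cons_succ, _root_.smul_apply, smul_eq_mul]
  ring

/-- A product of factors, each argument being a linear argument of exactly one factor. -/
def prodMultilinear {J : Type*} [Fintype J] [DecidableEq J] (own : Fin n → J)
    (B : J → (Fin n → E k) → ℝ)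
    (hadd : ∀ a (u : Fin n → E k) x y, B (own a) (Function.update u a (x + y)) =
      B (own a) (Function.update u a x) + B (own a) (Function.update u a y))
    (hsmul : ∀ a (u : Fin n → E k) (c : ℝ) x, B (own a) (Function.update u a (c • x)) =
      c * B (own a) (Function.update u a x))
    (hconst : ∀ a j, own a ≠ j → ∀ (u : Fin n → E k) x, B j (Function.update u a x) = B j u) :
    MultilinearMap ℝ (fun _ : Fin n => E k) ℝ where
  toFun u := ∏ j, B j u
  map_update_add' := by
    intro inst u a x y
    obtain rfl : inst = instDecidableEqFin n := Subsingleton.elim _ _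
    have h : ∀ z, ∏ j, B j (Function.update u a z) =
        B (own a) (Function.update u a z) * ∏ j ∈ univ.erase (own a), B j u := by
      intro z
      rw [← Finset.mul_prod_erase _ _ (mem_univ (own a))]
      congr 1
      exact Finset.prod_congr rfl fun j hj => hconst a j (Finset.ne_of_mem_erase hj).symm u z
    rw [h, h, h, hadd, add_mul]
  map_update_smul' := by
    intro inst u a c x
    obtain rfl : inst = instDecidableEqFin n := Subsingleton.elim _ _
    have h : ∀ z, ∏ j, B j (Function.update u a z) =
        B (own a) (Function.update u a z) * ∏ j ∈ univ.erase (own a), B j u := by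
      intro z
      rw [← Finset.mul_prod_erase _ _ (mem_univ (own a))]
      congr 1
      exact Finset.prod_congr rfl fun j hj => hconst a j (Finset.ne_of_mem_erase hj).symm u z
    rw [h, h, hsmul, mul_assoc, smul_eq_mul]

end MultilinearAlgebra

/-! ### Exterior products of bilinear functions and the strongly positive cone -/

section Wedge

open Finset

variable {k l : ℕ} {X R : Type*} [CommRing R]

/-- The (unnormalized) exterior product of bilinear functions. -/
def wedge (b : Fin l → X → X → R) (u : Fin l × Fin 2 → X) : R :=
  ∑ σ : Equiv.Perm (Fin l × Fin 2), ((σ.sign : ℤ) : R) * ∏ j, b j (u (σ (j, 0))) (u (σ (j, 1)))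

theorem wedge_sum {S : Type*} [Fintype S] [DecidableEq S] (b : Fin l → S → X → X → R)
    (u : Fin l × Fin 2 → X) :
    wedge (fun j v w => ∑ s, b j s v w) u = ∑ s : Fin l → S, wedge (fun j => b j (s j)) u := by
  simp only [wedge, Finset.prod_univ_sum, Finset.mul_sum, Fintype.piFinset_univ]
  exact Finset.sum_comm

theorem wedge_mul (c : Fin l → R) (b : Fin l → X → X → R) (u : Fin l × Fin 2 → X) :
    wedge (fun j v w => c j * b j v w) u = (∏ j, c j) * wedge b u := by
  simp only [wedge, Finset.prod_mul_distrib, Finset.mul_sum]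
  exact Finset.sum_congr rfl fun σ _ => by ring

theorem wedge_comp {Y : Type*} (b : Fin l → Y → Y → R) (f : X → Y) (u : Fin l × Fin 2 → X) :
    wedge b (fun p => f (u p)) = wedge (fun j v w => b j (f v) (f w)) u := rfl

theorem wedge_ofReal (b : Fin l → X → X → ℝ) (u : Fin l × Fin 2 → X) :
    wedge (fun j v w => (b j v w : ℂ)) u = ((wedge b u : ℝ) : ℂ) := by
  simp [wedge]

theorem wedge_perm (b : Fin l → X → X → R) (u : Fin l × Fin 2 → X)
    (π : Equiv.Perm (Fin l × Fin 2)) :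
    ∑ σ : Equiv.Perm (Fin l × Fin 2), ((σ.sign : ℤ) : R) *
      ∏ j, b j (u (σ (π (j, 0)))) (u (σ (π (j, 1)))) = ((π.sign : ℤ) : R) * wedge b u := by
  rw [wedge, Finset.mul_sum]
  refine Fintype.sum_equiv (Equiv.mulRight π) _ _ fun σ => ?_
  have hs : ((π.sign : ℤ) : R) * ((π.sign : ℤ) : R) = 1 := by
    rw [← Int.cast_mul, Int.units_coe_mul_self, Int.cast_one]
  simp only [Equiv.coe_mulRight, Equiv.Perm.mul_apply, Equiv.Perm.sign_mul, Units.val_mul,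
    Int.cast_mul]
  linear_combination (-((σ.sign : ℤ) : R) *
    ∏ j, b j (u (σ (π (j, 0)))) (u (σ (π (j, 1))))) * hs

/-- Expanding each antisymmetrized factor over the permutations of its two arguments gives `2 ^ l`
terms, and each equals the original product since its sign cancels that of the swaps. -/
theorem wedge_antisymm (b : Fin l → X → X → R) (u : Fin l × Fin 2 → X) :
    wedge (fun j v w => b j v w - b j w v) u = 2 ^ l * wedge b u := by
  have h1 : ∀ (j : Fin l) (v : Fin 2 → X), b j (v 0) (v 1) - b j (v 1) (v 0) =
      ∑ τ : Equiv.Perm (Fin 2), ((τ.sign : ℤ) : R) * b j (v (τ 0)) (v (τ 1)) := by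
    intro j v
    have : (univ : Finset (Equiv.Perm (Fin 2))) = {1, Equiv.swap 0 1} := by decide
    rw [this, Finset.sum_insert (by decide), Finset.sum_singleton]
    simp [sub_eq_add_neg]
  have h2 : wedge (fun j v w => b j v w - b j w v) u =
      ∑ τ : Fin l → Equiv.Perm (Fin 2), ∑ σ : Equiv.Perm (Fin l × Fin 2), ((σ.sign : ℤ) : R) *
        ∏ j, ((((τ j).sign : ℤ) : R) * b j (u (σ (j, τ j 0))) (u (σ (j, τ j 1)))) := by
    rw [Finset.sum_comm, wedge]
    refine Finset.sum_congr rfl fun σ _ => ?_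
    rw [← Finset.mul_sum]
    congr 1
    rw [Finset.prod_congr rfl fun j _ => h1 j fun s => u (σ (j, s)), Finset.prod_univ_sum,
      Fintype.piFinset_univ]
  rw [h2]
  have h3 : ∀ τ : Fin l → Equiv.Perm (Fin 2),
      ∑ σ : Equiv.Perm (Fin l × Fin 2), ((σ.sign : ℤ) : R) *
        ∏ j, ((((τ j).sign : ℤ) : R) * b j (u (σ (j, τ j 0))) (u (σ (j, τ j 1)))) = wedge b u := by
    intro τ
    have h4 := wedge_perm b u (Equiv.prodCongrRight τ)
    simp only [Equiv.prodCongrRight_apply, Equiv.Perm.sign_prodCongrRight] at h4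
    simp only [Finset.prod_mul_distrib]
    have h5 : ∀ σ : Equiv.Perm (Fin l × Fin 2), ((σ.sign : ℤ) : R) *
        ((∏ j, (((τ j).sign : ℤ) : R)) * ∏ j, b j (u (σ (j, τ j 0))) (u (σ (j, τ j 1)))) =
        (∏ j, (((τ j).sign : ℤ) : R)) *
          (((σ.sign : ℤ) : R) * ∏ j, b j (u (σ (j, τ j 0))) (u (σ (j, τ j 1)))) := fun σ => by ring
    rw [Finset.sum_congr rfl fun σ _ => h5 σ, ← Finset.mul_sum, h4]
    rw [Units.coe_prod, Int.cast_prod, ← mul_assoc, ← Finset.prod_mul_distrib]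
    rw [Finset.prod_eq_one fun j _ => ?_, one_mul]
    rw [← Int.cast_mul, Int.units_coe_mul_self, Int.cast_one]
  rw [Finset.sum_congr rfl fun τ _ => h3 τ, Finset.sum_const, Finset.card_univ, Fintype.card_fun,
    Fintype.card_perm, Fintype.card_fin, Fintype.card_fin, nsmul_eq_mul]
  simp

/-- Forms of even degree commute: permuting the pairs acts identically on first and second members,
so its sign is a square. -/
theorem wedge_permute (b : Fin l → X → X → R) (π : Equiv.Perm (Fin l)) (u : Fin l × Fin 2 → X) :
    wedge (fun j => b (π j)) u = wedge b u := by
  have h1 := wedge_perm b u (Equiv.prodCongrLeft fun _ => π⁻¹)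
  rw [Equiv.Perm.sign_prodCongrLeft, Finset.prod_const, Finset.card_univ, Fintype.card_fin,
    Units.val_pow_eq_pow_val, sq, Int.units_coe_mul_self, Int.cast_one, one_mul] at h1
  rw [← h1, wedge]
  refine Finset.sum_congr rfl fun σ _ => ?_
  congr 1
  simp only [Equiv.prodCongrLeft_apply]
  refine Fintype.prod_equiv π _ _ fun j => by simp

theorem stdVol_eq_wedge (v : Fin (l * 2) → Fin l → ℂ) :
    stdVol l v = wedge (fun j x y => (x j).re * (y j).im) (fun p => v (finProdFinEquiv p)) := by
  rw [stdVol, ← Matrix.det_submatrix_equiv_self finProdFinEquiv, Matrix.det_apply', wedge]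
  refine Finset.sum_congr rfl fun σ _ => ?_
  congr 1
  rw [Fintype.prod_prod_type]
  refine Finset.prod_congr rfl fun j _ => ?_
  rw [Fin.prod_univ_two]
  simp only [Matrix.submatrix_apply, Matrix.of_apply, Equiv.symm_apply_apply, if_true,
    one_ne_zero, if_false]

/-- The positive `(1,1)`-form `(i/2) α ∧ \bar α`, up to a factor. -/
def herm (α : X → ℂ) (v w : X) : ℝ := (α v).re * (α w).im - (α w).re * (α v).im

theorem wedge_herm (A : E k →ₗ[ℂ] (Fin l → ℂ)) (v : Fin (l * 2) → E k) :
    wedge (fun j => herm fun x => A x j) (fun p => v (finProdFinEquiv p)) =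
      2 ^ l * stdVol l fun i => A (v i) := by
  rw [stdVol_eq_wedge, wedge_comp (fun j (x y : Fin l → ℂ) => (x j).re * (y j).im) A
    (fun p => v (finProdFinEquiv p))]
  exact wedge_antisymm (fun j (x y : E k) => (A x j).re * (A y j).im) _

/-- The cone of strongly positive `(l,l)`-covectors, as functions. -/
def coneF (k l : ℕ) : AddSubmonoid ((Fin (l * 2) → E k) → ℝ) :=
  AddSubmonoid.closure {η | ∃ (r : ℝ) (A : E k →ₗ[ℂ] (Fin l → ℂ)), 0 ≤ r ∧
    ∀ v, η v = r * stdVol l (fun i => A (v i))}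

/-- The volume form pulled back by a linear map, as a bundled form. -/
theorem exists_form_stdVol (A : E k →ₗ[ℂ] (Fin l → ℂ)) :
    ∃ η : E k [⋀^Fin (l * 2)]→L[ℝ] ℝ, ∀ v, η v = stdVol l fun i => A (v i) := by
  let A' : E k →L[ℝ] (Fin l → ℂ) := LinearMap.toContinuousLinearMap (A.restrictScalars ℝ)
  refine ⟨prodAlt fun b => if (finProdFinEquiv.symm b).2 = 0
    then Complex.reCLM.comp ((ContinuousLinearMap.proj (finProdFinEquiv.symm b).1).comp A')
    else Complex.imCLM.comp ((ContinuousLinearMap.proj (finProdFinEquiv.symm b).1).comp A'),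
    fun v => ?_⟩
  rw [prodAlt_eq_det, stdVol]
  congr 1
  ext a b
  simp only [Matrix.of_apply]
  split_ifs <;> rfl

/-- Each generator of the cone of functions comes from a bundled form, so the cone of functions is
the image of the cone of forms under an injective map. Working with plain functions avoids carrying
multilinearity and continuity through the computations. -/
theorem mem_strongPosCone_of_mem_coneF {η : E k [⋀^Fin (l * 2)]→L[ℝ] ℝ} (h : ⇑η ∈ coneF k l) :
    η ∈ strongPosCone k l := by
  let φ : (E k [⋀^Fin (l * 2)]→L[ℝ] ℝ) →+ ((Fin (l * 2) → E k) → ℝ) :=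
    { toFun := fun η => ⇑η, map_zero' := rfl, map_add' := fun _ _ => rfl }
  have hmap : (strongPosCone k l).map φ = coneF k l := by
    rw [strongPosCone, coneF, AddMonoidHom.map_mclosure]
    congr 1
    ext f
    constructor
    · rintro ⟨η, ⟨r, A, hr, hη⟩, rfl⟩
      exact ⟨r, A, hr, hη⟩
    · rintro ⟨r, A, hr, hf⟩
      obtain ⟨η, hη⟩ := exists_form_stdVol A
      refine ⟨r • η, ⟨r, A, hr, fun v => by simp [hη]⟩, funext fun v => ?_⟩
      rw [hf, ← hη]
      rfl
  rw [← hmap] at h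
  obtain ⟨η', hη', heq⟩ := h
  rwa [← DFunLike.coe_injective (F := E k [⋀^Fin (l * 2)]→L[ℝ] ℝ) heq]

theorem stdVol_mem_coneF (A : E k →ₗ[ℂ] (Fin l → ℂ)) :
    (fun v : Fin (l * 2) → E k => stdVol l fun i => A (v i)) ∈ coneF k l :=
  AddSubmonoid.subset_closure ⟨1, A, zero_le_one, fun v => by rw [one_mul]⟩

theorem smul_mem_coneF {c : ℝ} (hc : 0 ≤ c) {f : (Fin (l * 2) → E k) → ℝ} (hf : f ∈ coneF k l) :
    c • f ∈ coneF k l := by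
  induction hf using AddSubmonoid.closure_induction with
  | mem f hf =>
    obtain ⟨r, A, hr, h⟩ := hf
    exact AddSubmonoid.subset_closure ⟨c * r, A, mul_nonneg hc hr, fun v => by
      rw [Pi.smul_apply, h, smul_eq_mul, mul_assoc]⟩
  | zero => rw [smul_zero]; exact zero_mem _
  | add f g _ _ hf hg => rw [smul_add]; exact add_mem hf hg

theorem comp_mem_coneF (L : E k →ₗ[ℂ] E k) {f : (Fin (l * 2) → E k) → ℝ} (hf : f ∈ coneF k l) :
    (fun v => f fun i => L (v i)) ∈ coneF k l := by
  induction hf using AddSubmonoid.closure_induction with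
  | mem f hf =>
    obtain ⟨r, A, hr, h⟩ := hf
    exact AddSubmonoid.subset_closure ⟨r, A.comp L, hr, fun v => h fun i => L (v i)⟩
  | zero => exact zero_mem _
  | add f g _ _ hf hg => exact add_mem hf hg

/-- The standard Kähler form of `ℂ^(k+1)`. -/
def kahler (v w : E k) : ℝ := ∑ i, herm (fun x : E k => x i) v w

/-- Its `l`-th power. -/
def kahlerPow (l : ℕ) (v : Fin (l * 2) → E k) : ℝ :=
  wedge (fun (_ : Fin l) => kahler (k := k)) fun p => v (finProdFinEquiv p)

theorem kahlerPow_mem_coneF : kahlerPow l ∈ coneF k l := by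
  have h : kahlerPow (k := k) l = ∑ s : Fin l → Fin (k + 1), (2 ^ l : ℝ) •
      fun v : Fin (l * 2) → E k => stdVol l fun i =>
        (LinearMap.pi fun j => LinearMap.proj (s j) : E k →ₗ[ℂ] (Fin l → ℂ)) (v i) := by
    funext v
    rw [Finset.sum_apply, kahlerPow]
    have := wedge_sum (fun (_ : Fin l) (i : Fin (k + 1)) => herm (fun x : E k => x i))
      (fun p => v (finProdFinEquiv p))
    refine this.trans (Finset.sum_congr rfl fun s _ => ?_)
    rw [Pi.smul_apply, smul_eq_mul, ← wedge_herm]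
    rfl
  rw [h]
  exact sum_mem fun s _ => smul_mem_coneF (by positivity) (stdVol_mem_coneF _)

/-- Cauchy–Schwarz for positive `(1,1)`-forms. -/
theorem kahler_sub_herm (a : Fin (k + 1) → ℂ) (v w : E k) :
    (∑ i, ‖a i‖ ^ 2) * kahler v w = herm (fun x : E k => ∑ i, a i * x i) v w +
      ∑ p : Fin (k + 1) × Fin (k + 1), herm (fun x : E k => ((√2)⁻¹ : ℝ) *
        ((starRingEnd ℂ) (a p.1) * x p.2 - (starRingEnd ℂ) (a p.2) * x p.1)) v w := by
  have hh : ∀ (α : E k → ℂ), (herm α v w : ℝ) = ((starRingEnd ℂ) (α v) * α w).im := by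
    intro α; simp [herm, Complex.mul_im]; ring
  simp only [kahler, hh]
  -- The factor `1/√2` compensates for each minor occurring twice, for `(i, j)` and `(j, i)`.
  have h2 : ((√2)⁻¹ : ℝ) * ((√2)⁻¹ : ℝ) = 1 / 2 := by
    rw [← mul_inv, Real.mul_self_sqrt (by norm_num)]; norm_num
  have h2' : (((√2)⁻¹ : ℝ) : ℂ) * (((√2)⁻¹ : ℝ) : ℂ) = 1 / 2 := by
    rw [← Complex.ofReal_mul, h2]; norm_num
  have hn : (((∑ i, ‖a i‖ ^ 2 : ℝ)) : ℂ) = ∑ i, (starRingEnd ℂ) (a i) * a i := by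
    push_cast
    exact Finset.sum_congr rfl fun i _ => (Complex.conj_mul' (a i)).symm
  -- Lagrange's identity in polarized form; the claim is its imaginary part.
  have key : ((∑ i, ‖a i‖ ^ 2 : ℝ) : ℂ) * ∑ i, (starRingEnd ℂ) (v i) * w i =
      (starRingEnd ℂ) (∑ i, a i * v i) * (∑ i, a i * w i) +
      ∑ p : Fin (k + 1) × Fin (k + 1), (starRingEnd ℂ) ((((√2)⁻¹ : ℝ) : ℂ) *
        ((starRingEnd ℂ) (a p.1) * v p.2 - (starRingEnd ℂ) (a p.2) * v p.1)) *
        ((((√2)⁻¹ : ℝ) : ℂ) * ((starRingEnd ℂ) (a p.1) * w p.2 - (starRingEnd ℂ) (a p.2) * w p.1)) := by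
    rw [hn]
    have e1 : ∀ p : Fin (k + 1) × Fin (k + 1), (starRingEnd ℂ) ((((√2)⁻¹ : ℝ) : ℂ) *
        ((starRingEnd ℂ) (a p.1) * v p.2 - (starRingEnd ℂ) (a p.2) * v p.1)) *
        ((((√2)⁻¹ : ℝ) : ℂ) * ((starRingEnd ℂ) (a p.1) * w p.2 - (starRingEnd ℂ) (a p.2) * w p.1)) =
        (1 / 2) * (((starRingEnd ℂ) (a p.1) * a p.1) * ((starRingEnd ℂ) (v p.2) * w p.2)
        + ((starRingEnd ℂ) (a p.2) * a p.2) * ((starRingEnd ℂ) (v p.1) * w p.1)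
        - ((starRingEnd ℂ) (a p.2) * (starRingEnd ℂ) (v p.2)) * (a p.1 * w p.1)
        - ((starRingEnd ℂ) (a p.1) * (starRingEnd ℂ) (v p.1)) * (a p.2 * w p.2)) := by
      intro p
      rw [← h2']
      simp only [map_mul, map_sub, Complex.conj_ofReal, Complex.conj_conj]
      ring
    rw [Finset.sum_congr rfl fun p _ => e1 p, ← Finset.mul_sum]
    simp only [Finset.sum_add_distrib, Finset.sum_sub_distrib, Fintype.sum_prod_type, map_sum, map_mul]
    simp only [← Finset.sum_mul, ← Finset.mul_sum]
    ring
  have := congrArg Complex.im key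
  rw [Complex.im_ofReal_mul, Complex.add_im, Complex.im_sum, Complex.im_sum] at this
  exact this

end Wedge

/-! ### Domination of forms by the power of the Kähler form -/

section Domination

open Finset

variable {k l : ℕ}

theorem wedge_comp_perm {X R : Type*} [CommRing R] (b : Fin l → X → X → R) (u : Fin l × Fin 2 → X)
    (π : Equiv.Perm (Fin l × Fin 2)) :
    wedge b (fun p => u (π p)) = ((π.sign : ℤ) : R) * wedge b u := by
  rw [wedge, wedge, Finset.mul_sum]
  refine Fintype.sum_equiv (Equiv.mulLeft π) _ _ fun σ => ?_
  have hs : ((π.sign : ℤ) : R) * ((π.sign : ℤ) : R) = 1 := by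
    rw [← Int.cast_mul, Int.units_coe_mul_self, Int.cast_one]
  simp only [Equiv.coe_mulLeft, Equiv.Perm.mul_apply, Equiv.Perm.sign_mul, Units.val_mul,
    Int.cast_mul]
  linear_combination (-((σ.sign : ℤ) : R) *
    ∏ j, b j (u (π (σ (j, 0)))) (u (π (σ (j, 1))))) * hs

theorem apply_eq_sum_mul (α : E k →ₗ[ℂ] ℂ) (x : E k) : α x = ∑ i, α (Pi.single i 1) * x i := by
  conv_lhs => rw [← Finset.univ_sum_single x]
  rw [map_sum]
  refine Finset.sum_congr rfl fun i _ => ?_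
  rw [mul_comm, ← smul_eq_mul, ← map_smul, ← Pi.single_smul, smul_eq_mul, mul_one]

/-- The linear forms in the Cauchy–Schwarz identity. -/
def minorForm (a : Fin (k + 1) → ℂ) (p : Fin (k + 1) × Fin (k + 1)) : E k →ₗ[ℂ] ℂ :=
  (((√2)⁻¹ : ℝ) : ℂ) • ((starRingEnd ℂ) (a p.1) • LinearMap.proj p.2 -
    (starRingEnd ℂ) (a p.2) • LinearMap.proj p.1)

/-- Each factor `herm (A · j)` is one summand in a decomposition of a multiple of the Kähler form
into positive forms. Multiplying the decompositions out, one term is the given volume form and the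
others lie in the cone. -/
theorem exists_kahlerPow_sub_stdVol_mem (A : E k →ₗ[ℂ] (Fin l → ℂ)) :
    ∃ C : ℝ, 0 ≤ C ∧ C • kahlerPow l - (fun v => stdVol l fun i => A (v i)) ∈ coneF k l := by
  classical
  let a : Fin l → Fin (k + 1) → ℂ := fun j i => A (Pi.single i 1) j
  let c : Fin l → ℝ := fun j => ∑ i, ‖a j i‖ ^ 2
  let α : Fin l → Option (Fin (k + 1) × Fin (k + 1)) → E k →ₗ[ℂ] ℂ := fun j s =>
    s.elim ((LinearMap.proj j).comp A) (minorForm (a j))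
  have hc : ∀ j v w, c j * kahler v w = ∑ s, herm (fun x => α j s x) v w := by
    intro j v w
    rw [Fintype.sum_option, kahler_sub_herm]
    congr 2
    funext x
    exact (apply_eq_sum_mul ((LinearMap.proj j).comp A) x).symm
  have hsum : ∀ v : Fin (l * 2) → E k, (∏ j, c j) * kahlerPow l v =
      ∑ s : Fin l → Option (Fin (k + 1) × Fin (k + 1)), 2 ^ l *
        stdVol l (fun i => LinearMap.pi (fun j => α j (s j)) (v i)) := by
    intro v
    rw [kahlerPow, ← wedge_mul, funext fun j => funext fun v => funext fun w => hc j v w, wedge_sum]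
    refine Finset.sum_congr rfl fun s _ => ?_
    rw [← wedge_herm]
    rfl
  refine ⟨(2 ^ l)⁻¹ * ∏ j, c j, mul_nonneg (by positivity) (Finset.prod_nonneg fun j _ =>
    Finset.sum_nonneg fun i _ => by positivity), ?_⟩
  have : ((2 ^ l)⁻¹ * ∏ j, c j) • kahlerPow l - (fun v => stdVol l fun i => A (v i)) =
      ∑ s ∈ univ.erase (fun _ : Fin l => (none : Option (Fin (k + 1) × Fin (k + 1)))),
        fun v : Fin (l * 2) → E k =>
          stdVol l (fun i => LinearMap.pi (fun j => α j (s j)) (v i)) := by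
    rw [sub_eq_iff_eq_add]
    funext v
    rw [Pi.smul_apply, smul_eq_mul, mul_assoc, hsum, ← Finset.mul_sum, inv_mul_cancel_left₀
      (by positivity), Pi.add_apply, Finset.sum_apply,
      ← Finset.sum_erase_add _ _ (mem_univ (fun _ : Fin l => none))]
    rfl
  rw [this]
  exact sum_mem fun s _ => stdVol_mem_coneF _

variable (k l) in
/-- The space of real `(l,l)`-covectors. -/
def realSpan : Submodule ℝ ((Fin (l * 2) → E k) → ℝ) :=
  Submodule.span ℝ (Set.range fun (A : E k →ₗ[ℂ] (Fin l → ℂ)) v => stdVol l fun i => A (v i))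

variable (k l) in
/-- The space of complex `(l,l)`-covectors. -/
def complexSpan : Submodule ℂ ((Fin (l * 2) → E k) → ℂ) :=
  Submodule.span ℂ (Set.range fun (A : E k →ₗ[ℂ] (Fin l → ℂ)) v =>
    ((stdVol l fun i => A (v i) : ℝ) : ℂ))

/-- The power of the Kähler form is an order unit: it dominates the generators, and signs are
harmless because both `f` and `-f` are bounded. -/
theorem exists_bound_of_mem_realSpan {f : (Fin (l * 2) → E k) → ℝ} (hf : f ∈ realSpan k l) :
    ∃ C : ℝ, 0 ≤ C ∧ C • kahlerPow l + f ∈ coneF k l ∧ C • kahlerPow l - f ∈ coneF k l := by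
  induction hf using Submodule.span_induction with
  | mem f hf =>
    obtain ⟨A, rfl⟩ := hf
    obtain ⟨C, hC, h⟩ := exists_kahlerPow_sub_stdVol_mem A
    exact ⟨C, hC, add_mem (smul_mem_coneF hC kahlerPow_mem_coneF) (stdVol_mem_coneF A), h⟩
  | zero => exact ⟨0, le_rfl, by simp, by simp⟩
  | add f g _ _ hf hg =>
    obtain ⟨C, hC, h1, h2⟩ := hf
    obtain ⟨D, hD, h3, h4⟩ := hg
    refine ⟨C + D, add_nonneg hC hD, ?_, ?_⟩
    · convert add_mem h1 h3 using 1; module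
    · convert add_mem h2 h4 using 1; module
  | smul r f _ hf =>
    obtain ⟨C, hC, h1, h2⟩ := hf
    rcases le_total 0 r with hr | hr
    · refine ⟨r * C, mul_nonneg hr hC, ?_, ?_⟩
      · convert smul_mem_coneF hr h1 using 1; module
      · convert smul_mem_coneF hr h2 using 1; module
    · have hr' : 0 ≤ -r := neg_nonneg.2 hr
      refine ⟨-r * C, mul_nonneg hr' hC, ?_, ?_⟩
      · convert smul_mem_coneF hr' h2 using 1; module
      · convert smul_mem_coneF hr' h1 using 1; module

theorem re_im_mem_realSpan {f : (Fin (l * 2) → E k) → ℂ} (hf : f ∈ complexSpan k l) :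
    (fun v => (f v).re) ∈ realSpan k l ∧ (fun v => (f v).im) ∈ realSpan k l := by
  induction hf using Submodule.span_induction with
  | mem f hf =>
    obtain ⟨A, rfl⟩ := hf
    exact ⟨Submodule.subset_span ⟨A, rfl⟩, zero_mem (realSpan k l)⟩
  | zero => exact ⟨zero_mem (realSpan k l), zero_mem (realSpan k l)⟩
  | add f g _ _ hf hg => exact ⟨add_mem hf.1 hg.1, add_mem hf.2 hg.2⟩
  | smul r f _ hf =>
    refine ⟨?_, ?_⟩
    · exact sub_mem (Submodule.smul_mem _ r.re hf.1) (Submodule.smul_mem _ r.im hf.2)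
    · exact add_mem (Submodule.smul_mem _ r.re hf.2) (Submodule.smul_mem _ r.im hf.1)

/-- Antisymmetrizing `conj γ ⊗ γ` gives `2i` times the real form `herm γ`, so the product is a
constant multiple of a pulled-back volume form. -/
theorem wedge_conj_self_mem (γ : Fin l → E k →ₗ[ℂ] ℂ) :
    (fun v : Fin (l * 2) → E k => wedge (fun j x y => (starRingEnd ℂ) (γ j x) * γ j y)
      fun p => v (finProdFinEquiv p)) ∈ complexSpan k l := by
  have h : ∀ v : Fin (l * 2) → E k, wedge (fun j x y => (starRingEnd ℂ) (γ j x) * γ j y)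
      (fun p => v (finProdFinEquiv p)) = (2 * Complex.I) ^ l *
        ((stdVol l fun i => LinearMap.pi γ (v i) : ℝ) : ℂ) := by
    intro v
    have h1 := wedge_antisymm (fun j x y => (starRingEnd ℂ) (γ j x) * γ j y)
      (fun p => v (finProdFinEquiv p))
    have h2 : (fun (j : Fin l) (x y : E k) => (starRingEnd ℂ) (γ j x) * γ j y -
        (starRingEnd ℂ) (γ j y) * γ j x) = fun j x y => (2 * Complex.I) *
          ((herm (fun z => LinearMap.pi γ z j) x y : ℝ) : ℂ) := by
      funext j x y
      apply Complex.ext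
      · simp [herm]; ring
      · simp [herm]; ring
    rw [h2, wedge_mul, wedge_ofReal, wedge_herm, Finset.prod_const, Finset.card_univ,
      Fintype.card_fin] at h1
    push_cast at h1
    have h3 : (2 : ℂ) ^ l ≠ 0 := pow_ne_zero _ two_ne_zero
    apply mul_left_cancel₀ h3
    rw [← h1]
    ring
  rw [funext h]
  exact Submodule.smul_mem _ ((2 * Complex.I) ^ l) (Submodule.subset_span ⟨LinearMap.pi γ, rfl⟩)

/-- Polarization: `conj α ⊗ β` is a combination of the four diagonal terms of `α + i ^ s β`. -/
theorem wedge_conj_mem (α β : Fin l → E k →ₗ[ℂ] ℂ) :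
    (fun v : Fin (l * 2) → E k => wedge (fun j x y => (starRingEnd ℂ) (α j x) * β j y)
      fun p => v (finProdFinEquiv p)) ∈ complexSpan k l := by
  let γ : Fin l → Fin 4 → E k →ₗ[ℂ] ℂ := fun j s => α j + Complex.I ^ (s : ℕ) • β j
  have h : ∀ j x y, (starRingEnd ℂ) (α j x) * β j y = ∑ s : Fin 4,
      (4⁻¹ * (-Complex.I) ^ (s : ℕ)) * ((starRingEnd ℂ) (γ j s x) * γ j s y) := by
    intro j x y
    have e2 : Complex.I ^ 2 = -1 := Complex.I_sq
    have e3 : Complex.I ^ 3 = -Complex.I := Complex.I_pow_three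
    rw [Fin.sum_univ_four]
    simp only [γ, LinearMap.add_apply, LinearMap.smul_apply, smul_eq_mul, map_add, map_mul, Fin.val_zero, Fin.val_one, Fin.val_two, pow_zero, pow_one,
      show ((3 : Fin 4) : ℕ) = 3 from rfl, neg_pow Complex.I, e2, e3,
      map_neg, map_one, Complex.conj_I]
    ring_nf
    simp only [e2]
    ring
  have h1 : (fun v : Fin (l * 2) → E k => wedge (fun j x y => (starRingEnd ℂ) (α j x) * β j y)
      fun p => v (finProdFinEquiv p)) = ∑ s : Fin l → Fin 4,
        (∏ j, (4⁻¹ * (-Complex.I) ^ (s j : ℕ))) • fun v : Fin (l * 2) → E k =>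
          wedge (fun j x y => (starRingEnd ℂ) (γ j (s j) x) * γ j (s j) y)
            fun p => v (finProdFinEquiv p) := by
    funext v
    rw [funext fun j => funext fun x => funext fun y => h j x y, wedge_sum, Finset.sum_apply]
    refine Finset.sum_congr rfl fun s _ => ?_
    rw [wedge_mul, Pi.smul_apply, smul_eq_mul]
  rw [h1]
  exact sum_mem fun s _ => Submodule.smul_mem _ _ (wedge_conj_self_mem _)

/-- A term of bidegree `(l,l)` has as many conjugated as unconjugated factors. Pairing them off
turns it, up to sign, into a product of `conj α ⊗ β`. -/
theorem sum_prod_mem_of_balanced (g : Fin (l * 2) → Bool → E k →ₗ[ℂ] ℂ) (ε : Fin (l * 2) → Bool)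
    (hε : #{a | ε a = true} = #{a | ε a = false}) :
    (fun v : Fin (l * 2) → E k => ∑ σ : Equiv.Perm (Fin (l * 2)), ((σ.sign : ℤ) : ℂ) *
      ∏ a, if ε a then g a (ε a) (v (σ a)) else (starRingEnd ℂ) (g a (ε a) (v (σ a)))) ∈
      complexSpan k l := by
  have hcard : #{a | ε a = true} + #{a | ε a = false} = l * 2 := by
    have := Finset.card_filter_add_card_filter_not (s := (univ : Finset (Fin (l * 2))))
      (fun a => ε a = true)
    simpa using this
  have h1 : #{a | ε a = true} = l := by omega
  have h0 : #{a | ε a = false} = l := by omega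
  let e1 := Finset.orderEmbOfFin _ h1
  let e0 := Finset.orderEmbOfFin _ h0
  have he1 : ∀ j, ε (e1 j) = true := fun j =>
    (Finset.mem_filter.1 (Finset.orderEmbOfFin_mem _ h1 j)).2
  have he0 : ∀ j, ε (e0 j) = false := fun j =>
    (Finset.mem_filter.1 (Finset.orderEmbOfFin_mem _ h0 j)).2
  let f : Fin l × Fin 2 → Fin (l * 2) := fun p => if p.2 = 0 then e0 p.1 else e1 p.1
  have hf : Function.Injective f := by
    rintro ⟨i, s⟩ ⟨j, t⟩ h
    have hs : s = t := by
      have h2 := congrArg ε h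
      fin_cases s <;> fin_cases t
      · rfl
      · exact absurd (((he0 i).symm.trans h2).trans (he1 j)) (by decide)
      · exact absurd (((he1 i).symm.trans h2).trans (he0 j)) (by decide)
      · rfl
    subst hs
    fin_cases s <;> simpa [f] using h
  let κ : Fin l × Fin 2 ≃ Fin (l * 2) := Equiv.ofBijective f
    ((Fintype.bijective_iff_injective_and_card f).2 ⟨hf, by simp⟩)
  have hκ0 : ∀ j, κ (j, 0) = e0 j := fun j => rfl
  have hκ1 : ∀ j, κ (j, 1) = e1 j := fun j => rfl
  have key : ∀ v : Fin (l * 2) → E k, (∑ σ : Equiv.Perm (Fin (l * 2)), ((σ.sign : ℤ) : ℂ) *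
      ∏ a, if ε a then g a (ε a) (v (σ a)) else (starRingEnd ℂ) (g a (ε a) (v (σ a)))) =
      ((Equiv.Perm.sign (κ.trans finProdFinEquiv.symm) : ℤ) : ℂ) *
        wedge (fun j x y => (starRingEnd ℂ) (g (e0 j) false x) * g (e1 j) true y)
          fun p => v (finProdFinEquiv p) := by
    intro v
    rw [← wedge_comp_perm _ _ (κ.trans finProdFinEquiv.symm), wedge]
    refine Fintype.sum_equiv (Equiv.permCongr κ.symm) _ _ fun σ => ?_
    rw [Equiv.Perm.sign_permCongr]
    congr 1
    rw [← Equiv.prod_comp κ, Fintype.prod_prod_type]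
    refine Finset.prod_congr rfl fun j _ => ?_
    rw [Fin.prod_univ_two]
    simp only [hκ0, hκ1, he0, he1, Equiv.permCongr_apply, Equiv.symm_symm, Equiv.trans_apply,
      Equiv.apply_symm_apply, if_true, Bool.false_eq_true, if_false]
  rw [funext key]
  exact Submodule.smul_mem _ _ (wedge_conj_mem _ _)

/-- The complex linear form with real part `rcoord`. -/
def ccoord (p : Fin (k + 1) × Fin 2) : E k →ₗ[ℂ] ℂ :=
  (if p.2 = 0 then 1 else -Complex.I : ℂ) • LinearMap.proj p.1

theorem rcoord_eq (p : Fin (k + 1) × Fin 2) (x : E k) :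
    ((rcoord p x : ℝ) : ℂ) = 2⁻¹ * (ccoord p x + (starRingEnd ℂ) (ccoord p x)) := by
  rw [Complex.add_conj]
  have : rcoord p x = (ccoord p x).re := by
    rw [rcoord, ccoord]
    split_ifs <;> simp
  rw [this]
  push_cast
  ring

/-- The product is the `t`-th power of `ζ ^ (p - q)`, where `p + q = 2l` and `p ≠ q`. Since `p, q ≤
2l`, the order `2l + 1` of `ζ` makes this root of unity different from `1`, and the geometric sum
vanishes. -/
theorem sum_rotation_coeff {ζ : ℂ} (hζ : IsPrimitiveRoot ζ (l * 2 + 1)) (ε : Fin (l * 2) → Bool)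
    (hε : #{a | ε a = true} ≠ #{a | ε a = false}) :
    ∑ t ∈ range (l * 2 + 1), ∏ a, (if ε a then ζ ^ t else (starRingEnd ℂ) (ζ ^ t)) = 0 := by
  have hn : ‖ζ‖ = 1 := hζ.norm'_eq_one (by omega)
  have hz0 : ζ ≠ 0 := hζ.ne_zero (by omega)
  have hconj : (starRingEnd ℂ) ζ = ζ⁻¹ := (Complex.inv_eq_conj hn).symm
  set z : ℂ := ∏ a, (if ε a then ζ else (starRingEnd ℂ) ζ) with hz
  have h1 : ∀ t, ∏ a, (if ε a then ζ ^ t else (starRingEnd ℂ) (ζ ^ t)) = z ^ t := by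
    intro t
    rw [hz, ← Finset.prod_pow]
    refine Finset.prod_congr rfl fun a _ => ?_
    split_ifs
    · rfl
    · rw [map_pow]
  have hcard : #{a | ε a = true} + #{a | ε a = false} = l * 2 := by
    have := Finset.card_filter_add_card_filter_not (s := (univ : Finset (Fin (l * 2))))
      (fun a => ε a = true)
    simpa using this
  have hz2 : z * ζ ^ #{a | ε a = false} = ζ ^ #{a | ε a = true} := by
    rw [hz, Finset.prod_ite, Finset.prod_const, Finset.prod_const, hconj]
    simp only [Bool.not_eq_true]
    rw [mul_assoc, ← mul_pow, inv_mul_cancel₀ hz0, one_pow, mul_one]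
  have hz1 : z ≠ 1 := by
    intro h
    rw [h, one_mul] at hz2
    exact hε (hζ.pow_inj (by omega) (by omega) hz2).symm
  have hzN : z ^ (l * 2 + 1) = 1 := by
    rw [← h1, hζ.pow_eq_one]
    simp
  rw [Finset.sum_congr rfl fun t _ => h1 t]
  have := mul_neg_geom_sum z (l * 2 + 1)
  rw [hzN, sub_self] at this
  exact (mul_eq_zero.1 this).resolve_left (sub_ne_zero.2 hz1.symm)

/-- Writing each real coordinate as half the sum of a complex linear form and its conjugate splits
the form into bidegrees. The average over rotations kills the unbalanced ones. -/
theorem sum_rotation_prodAlt_mem {ζ : ℂ} (hζ : IsPrimitiveRoot ζ (l * 2 + 1))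
    (m : Fin (l * 2) → Fin (k + 1) × Fin 2) :
    (fun v => ∑ t ∈ range (l * 2 + 1), prodAlt (fun a => rcoord (m a)) fun i => ζ ^ t • v i) ∈
      realSpan k l := by
  let W : (Fin (l * 2) → Bool) → (Fin (l * 2) → E k) → ℂ := fun ε v =>
    ∑ σ : Equiv.Perm (Fin (l * 2)), ((σ.sign : ℤ) : ℂ) *
      ∏ a, if ε a then ccoord (m a) (v (σ a)) else (starRingEnd ℂ) (ccoord (m a) (v (σ a)))
  let q : ℂ → (Fin (l * 2) → Bool) → ℂ := fun c ε =>
    ∏ a, (if ε a then c else (starRingEnd ℂ) c)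
  have h1 : ∀ (c : ℂ) (v : Fin (l * 2) → E k),
      ((prodAlt (fun a => rcoord (m a)) fun i => c • v i : ℝ) : ℂ) =
        ∑ ε : Fin (l * 2) → Bool, (2⁻¹ ^ (l * 2) * q c ε) * W ε v := by
    intro c v
    rw [prodAlt_apply]
    push_cast
    simp only [W, Finset.mul_sum]
    rw [Finset.sum_comm]
    refine Finset.sum_congr rfl fun σ _ => ?_
    have h2 : ∀ a, ((rcoord (m a) (c • v (σ a)) : ℝ) : ℂ) = ∑ s : Bool,
        2⁻¹ * ((if s then c else (starRingEnd ℂ) c) *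
          if s then ccoord (m a) (v (σ a)) else (starRingEnd ℂ) (ccoord (m a) (v (σ a)))) := by
      intro a
      rw [rcoord_eq, Fintype.sum_bool, map_smul, smul_eq_mul, map_mul]
      simp only [if_true, Bool.false_eq_true, if_false]
      ring
    rw [Finset.prod_congr rfl fun a _ => h2 a, Finset.prod_univ_sum, Fintype.piFinset_univ,
      Finset.mul_sum]
    refine Finset.sum_congr rfl fun ε _ => ?_
    simp only [Finset.prod_mul_distrib, Finset.prod_const, Finset.card_univ, Fintype.card_fin, q]
    ring
  have h2 : ∀ v : Fin (l * 2) → E k, ((∑ t ∈ range (l * 2 + 1),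
      prodAlt (fun a => rcoord (m a)) fun i => ζ ^ t • v i : ℝ) : ℂ) =
      ∑ ε : Fin (l * 2) → Bool,
        (2⁻¹ ^ (l * 2) * ∑ t ∈ range (l * 2 + 1), q (ζ ^ t) ε) * W ε v := by
    intro v
    rw [Complex.ofReal_sum, Finset.sum_congr rfl fun t _ => h1 (ζ ^ t) v, Finset.sum_comm]
    refine Finset.sum_congr rfl fun ε _ => ?_
    rw [← Finset.sum_mul, ← Finset.mul_sum]
  have h3 : (fun v : Fin (l * 2) → E k => ((∑ t ∈ range (l * 2 + 1),
      prodAlt (fun a => rcoord (m a)) fun i => ζ ^ t • v i : ℝ) : ℂ)) ∈ complexSpan k l := by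
    have : (fun v : Fin (l * 2) → E k => ((∑ t ∈ range (l * 2 + 1),
      prodAlt (fun a => rcoord (m a)) fun i => ζ ^ t • v i : ℝ) : ℂ)) =
      ∑ ε : Fin (l * 2) → Bool,
        (2⁻¹ ^ (l * 2) * ∑ t ∈ range (l * 2 + 1), q (ζ ^ t) ε) • W ε := by
      funext v
      rw [h2, Finset.sum_apply]
      rfl
    rw [this]
    refine sum_mem fun ε _ => ?_
    by_cases hε : #{a | ε a = true} = #{a | ε a = false}
    · exact Submodule.smul_mem _ _ (sum_prod_mem_of_balanced (fun a _ => ccoord (m a)) ε hε)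
    · rw [show ∑ t ∈ range (l * 2 + 1), q (ζ ^ t) ε = 0 from sum_rotation_coeff hζ ε hε, mul_zero,
        zero_smul]
      exact zero_mem _
  exact (re_im_mem_realSpan h3).1

variable (k l) in
/-- The rotation averages of a form are controlled by the power of the Kähler form. -/
theorem exists_bound_rotation {ζ : ℂ} (hζ : IsPrimitiveRoot ζ (l * 2 + 1)) :
    ∃ C : ℝ, 0 ≤ C ∧ ∀ (η : E k [⋀^Fin (l * 2)]→L[ℝ] ℝ) (B : ℝ), ‖η‖ ≤ B →
      (C * B) • kahlerPow l + (fun v => ∑ t ∈ range (l * 2 + 1), η fun i => ζ ^ t • v i) ∈ coneF k l ∧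
      (C * B) • kahlerPow l - (fun v => ∑ t ∈ range (l * 2 + 1), η fun i => ζ ^ t • v i) ∈ coneF k l := by
  choose C hC h1 h2 using fun m : Fin (l * 2) → Fin (k + 1) × Fin 2 =>
    exists_bound_of_mem_realSpan (sum_rotation_prodAlt_mem hζ m)
  refine ⟨∑ m, C m, Finset.sum_nonneg fun m _ => hC m, fun η B hB => ?_⟩
  let f : (Fin (l * 2) → Fin (k + 1) × Fin 2) → (Fin (l * 2) → E k) → ℝ := fun m v =>
    ∑ t ∈ range (l * 2 + 1), prodAlt (fun a => rcoord (m a)) fun i => ζ ^ t • v i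
  let r : (Fin (l * 2) → Fin (k + 1) × Fin 2) → ℝ := fun m =>
    (η fun a => rbasis (m a)) * ((l * 2).factorial : ℝ)⁻¹
  have hr : ∀ m, |r m| ≤ B := by
    intro m
    have e1 : |η fun a => rbasis (m a)| ≤ B := by
      refine (η.le_opNorm _).trans ((mul_le_of_le_one_right (norm_nonneg _) ?_).trans hB)
      exact Finset.prod_le_one (fun _ _ => norm_nonneg _) fun a _ => norm_rbasis_le _
    have e2 : ((l * 2).factorial : ℝ)⁻¹ ≤ 1 :=
      inv_le_one_of_one_le₀ (by exact_mod_cast Nat.one_le_iff_ne_zero.2 (l * 2).factorial_ne_zero)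
    rw [abs_mul, abs_of_nonneg (a := ((l * 2).factorial : ℝ)⁻¹) (by positivity)]
    exact (mul_le_of_le_one_right (abs_nonneg _) e2).trans e1
  have hf : (fun v => ∑ t ∈ range (l * 2 + 1), η fun i => ζ ^ t • v i) = ∑ m, r m • f m := by
    funext v
    have e : ∀ t, (η fun i => ζ ^ t • v i) =
        ∑ m, r m * prodAlt (fun a => rcoord (m a)) fun i => ζ ^ t • v i := by
      intro t
      conv_lhs => rw [eq_sum_prodAlt η]
      rw [ContinuousAlternatingMap.sum_apply]
      refine Finset.sum_congr rfl fun m _ => ?_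
      simp only [ContinuousAlternatingMap.smul_apply, smul_eq_mul, r, mul_assoc]
    rw [Finset.sum_congr rfl fun t _ => e t, Finset.sum_comm, Finset.sum_apply]
    refine Finset.sum_congr rfl fun m _ => ?_
    rw [Pi.smul_apply, smul_eq_mul, Finset.mul_sum]
  have hm : ∀ m, (C m * B) • kahlerPow l + r m • f m ∈ coneF k l ∧
      (C m * B) • kahlerPow l - r m • f m ∈ coneF k l := by
    intro m
    have e1 : (C m * (B - |r m|)) • kahlerPow l ∈ coneF k l :=
      smul_mem_coneF (mul_nonneg (hC m) (sub_nonneg.2 (hr m))) kahlerPow_mem_coneF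
    have e2 := smul_mem_coneF (abs_nonneg (r m)) (h1 m)
    have e3 := smul_mem_coneF (abs_nonneg (r m)) (h2 m)
    rcases abs_choice (r m) with hs | hs
    · refine ⟨?_, ?_⟩
      · convert add_mem e1 e2 using 1
        rw [hs]; module
      · convert add_mem e1 e3 using 1
        rw [hs]; module
    · refine ⟨?_, ?_⟩
      · convert add_mem e1 e3 using 1
        rw [hs]; module
      · convert add_mem e1 e2 using 1
        rw [hs]; module
  rw [hf, Finset.sum_mul, Finset.sum_smul, ← Finset.sum_add_distrib, ← Finset.sum_sub_distrib]
  exact ⟨sum_mem fun m _ => (hm m).1, sum_mem fun m _ => (hm m).2⟩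

end Domination

/-! ### Forms on projective space built from functions of pairs of vectors -/

section PairForms

open Finset

variable {k n l : ℕ}

/-- Families of functions of pairs of vectors, whose product is multilinear in the arguments
attached to the slots, and defines a form on projective space by alternatization. -/
structure IsPairFamily (slot : Fin n → Fin l × Fin 2) (c : Fin l → E k → E k → E k → ℝ) : Prop where
  inj : Function.Injective slot
  add_left : ∀ a j, slot a = (j, 0) → ∀ x v v' w, c j x (v + v') w = c j x v w + c j x v' w
  smul_left : ∀ a j, slot a = (j, 0) → ∀ x (r : ℝ) v w, c j x (r • v) w = r * c j x v w
  horiz_left : ∀ a j, slot a = (j, 0) → ∀ x, x ≠ 0 → ∀ (t : ℂ) w, c j x (t • x) w = 0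
  add_right : ∀ a j, slot a = (j, 1) → ∀ x v w w', c j x v (w + w') = c j x v w + c j x v w'
  smul_right : ∀ a j, slot a = (j, 1) → ∀ x (r : ℝ) v w, c j x v (r • w) = r * c j x v w
  horiz_right : ∀ a j, slot a = (j, 1) → ∀ x, x ≠ 0 → ∀ (t : ℂ) v, c j x v (t • x) = 0
  smooth : ∀ j v w, ContDiffOn ℝ ∞ (fun x => c j x v w) {0}ᶜ
  invariant : ∀ j (t : ℂ), t ≠ 0 → ∀ x, x ≠ 0 → ∀ v w, c j (t • x) (t • v) (t • w) = c j x v w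

/-- The arguments of the factors. -/
def slotExtend (slot : Fin n → Fin l × Fin 2) (u : Fin n → E k) : Fin l × Fin 2 → E k :=
  Function.extend slot u 0

theorem slotExtend_apply {slot : Fin n → Fin l × Fin 2} (h : Function.Injective slot)
    (u : Fin n → E k) (a : Fin n) : slotExtend slot u (slot a) = u a := h.extend_apply u 0 a

theorem slotExtend_update {slot : Fin n → Fin l × Fin 2} (h : Function.Injective slot)
    (u : Fin n → E k) (a : Fin n) (x : E k) : slotExtend slot (Function.update u a x) =
      Function.update (slotExtend slot u) (slot a) x := by
  funext p
  by_cases hp : ∃ b, slot b = p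
  · obtain ⟨b, rfl⟩ := hp
    rw [slotExtend_apply h]
    by_cases hb : b = a
    · subst hb; simp
    · rw [Function.update_of_ne hb, Function.update_of_ne (h.ne hb), slotExtend_apply h]
  · have hpa : p ≠ slot a := fun e => hp ⟨a, e.symm⟩
    rw [Function.update_of_ne hpa, slotExtend, slotExtend, Function.extend_apply' _ _ _ hp,
      Function.extend_apply' _ _ _ hp]

theorem slotExtend_smul {slot : Fin n → Fin l × Fin 2} (h : Function.Injective slot) (t : ℂ)
    (u : Fin n → E k) (p : Fin l × Fin 2) :
    slotExtend slot (fun a => t • u a) p = t • slotExtend slot u p := by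
  by_cases hp : ∃ b, slot b = p
  · obtain ⟨b, rfl⟩ := hp
    rw [slotExtend_apply h, slotExtend_apply h]
  · rw [slotExtend, slotExtend, Function.extend_apply' _ _ _ hp, Function.extend_apply' _ _ _ hp]
    simp

namespace IsPairFamily

variable {slot : Fin n → Fin l × Fin 2} {c : Fin l → E k → E k → E k → ℝ}

/-- The product of the factors. -/
def multilinear (h : IsPairFamily slot c) (x : E k) :
    MultilinearMap ℝ (fun _ : Fin n => E k) ℝ :=
  prodMultilinear (fun a => (slot a).1)
    (fun j u => c j x (slotExtend slot u (j, 0)) (slotExtend slot u (j, 1)))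
    (by
      intro a u y z
      simp only [slotExtend_update h.inj]
      generalize slotExtend slot u = V
      obtain ⟨⟨j, s⟩, hs⟩ : ∃ p, slot a = p := ⟨_, rfl⟩
      rw [hs]
      fin_cases s
      · simp [h.add_left a j hs]
      · simp [h.add_right a j hs])
    (by
      intro a u r y
      simp only [slotExtend_update h.inj]
      generalize slotExtend slot u = V
      obtain ⟨⟨j, s⟩, hs⟩ : ∃ p, slot a = p := ⟨_, rfl⟩
      rw [hs]
      fin_cases s
      · simp [h.smul_left a j hs]
      · simp [h.smul_right a j hs])
    (by
      intro a j hj u y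
      simp only [slotExtend_update h.inj]
      rw [Function.update_of_ne fun e => hj (congrArg Prod.fst e).symm,
        Function.update_of_ne fun e => hj (congrArg Prod.fst e).symm])

theorem multilinear_apply (h : IsPairFamily slot c) (x : E k) (u : Fin n → E k) :
    h.multilinear x u = ∏ j, c j x (slotExtend slot u (j, 0)) (slotExtend slot u (j, 1)) := rfl

theorem contDiffOn_multilinear (h : IsPairFamily slot c) (u : Fin n → E k) :
    ContDiffOn ℝ ∞ (fun x => h.multilinear x u) {0}ᶜ := by
  simp only [multilinear_apply]
  exact contDiffOn_prod fun j _ => h.smooth j _ _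

theorem altForm_multilinear (h : IsPairFamily slot c) (x : E k) (v : Fin n → E k) :
    altForm (h.multilinear x) v = ∑ σ : Equiv.Perm (Fin n), ((σ.sign : ℤ) : ℝ) *
      ∏ j, c j x (slotExtend slot (fun a => v (σ a)) (j, 0))
        (slotExtend slot (fun a => v (σ a)) (j, 1)) := altForm_apply _ _

/-- The form defined by a family. -/
def form (h : IsPairFamily slot c) : Form k n :=
  ⟨fun x => if x = 0 then 0 else altForm (h.multilinear x), by
    refine ⟨?_, if_pos rfl, ?_, ?_⟩
    · refine (contDiffOn_altForm h.contDiffOn_multilinear).congr fun x hx => ?_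
      exact if_neg hx
    · rintro x hx v ⟨i, t, hi⟩
      simp only [if_neg hx]
      rw [altForm_multilinear]
      refine Finset.sum_eq_zero fun σ _ => mul_eq_zero_of_right _ ?_
      obtain ⟨⟨j, s⟩, hs⟩ : ∃ p, slot (σ.symm i) = p := ⟨_, rfl⟩
      refine Finset.prod_eq_zero (mem_univ j) ?_
      have h1 : slotExtend slot (fun a => v (σ a)) (j, s) = t • x := by
        rw [← hs, slotExtend_apply h.inj, Equiv.apply_symm_apply, hi]
      fin_cases s
      · simp only [Fin.zero_eta] at h1 hs
        rw [h1, h.horiz_left _ j hs x hx]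
      · simp only [Fin.mk_one] at h1 hs
        rw [h1, h.horiz_right _ j hs x hx]
    · intro t ht x hx v
      simp only [if_neg hx, if_neg (smul_ne_zero ht hx)]
      rw [altForm_multilinear, altForm_multilinear]
      simp only [slotExtend_smul h.inj, h.invariant _ t ht x hx]⟩

theorem form_apply (h : IsPairFamily slot c) {x : E k} (hx : x ≠ 0) :
    h.form.1 x = altForm (h.multilinear x) := if_neg hx

end IsPairFamily

/-- Forms of degree two on projective space. -/
structure IsBasic (b : E k → E k → E k → ℝ) : Prop where
  add_left : ∀ x v v' w, b x (v + v') w = b x v w + b x v' w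
  smul_left : ∀ x (r : ℝ) v w, b x (r • v) w = r * b x v w
  horiz_left : ∀ x, x ≠ 0 → ∀ (t : ℂ) w, b x (t • x) w = 0
  add_right : ∀ x v w w', b x v (w + w') = b x v w + b x v w'
  smul_right : ∀ x (r : ℝ) v w, b x v (r • w) = r * b x v w
  horiz_right : ∀ x, x ≠ 0 → ∀ (t : ℂ) v, b x v (t • x) = 0
  smooth : ∀ v w, ContDiffOn ℝ ∞ (fun x => b x v w) {0}ᶜ
  invariant : ∀ t : ℂ, t ≠ 0 → ∀ x, x ≠ 0 → ∀ v w, b (t • x) (t • v) (t • w) = b x v w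

theorem IsBasic.isPairFamily {b : Fin l → E k → E k → E k → ℝ} (h : ∀ j, IsBasic (b j)) :
    IsPairFamily (finProdFinEquiv (m := l) (n := 2)).symm b where
  inj := finProdFinEquiv.symm.injective
  add_left _ j _ := (h j).add_left
  smul_left _ j _ := (h j).smul_left
  horiz_left _ j _ := (h j).horiz_left
  add_right _ j _ := (h j).add_right
  smul_right _ j _ := (h j).smul_right
  horiz_right _ j _ := (h j).horiz_right
  smooth j := (h j).smooth
  invariant j := (h j).invariant

/-- The exterior product of forms of degree two. -/
def wedgeForm (b : Fin l → E k → E k → E k → ℝ) (h : ∀ j, IsBasic (b j)) : Form k (l * 2) :=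
  (IsBasic.isPairFamily h).form

theorem wedgeForm_apply {b : Fin l → E k → E k → E k → ℝ} (h : ∀ j, IsBasic (b j)) {x : E k}
    (hx : x ≠ 0) (v : Fin (l * 2) → E k) :
    (wedgeForm b h).1 x v = wedge (fun j => b j x) fun p => v (finProdFinEquiv p) := by
  rw [wedgeForm, IsPairFamily.form_apply _ hx, IsPairFamily.altForm_multilinear, wedge]
  refine Fintype.sum_equiv (Equiv.permCongr finProdFinEquiv.symm) _ _ fun σ => ?_
  rw [Equiv.Perm.sign_permCongr]
  congr 1
  refine Finset.prod_congr rfl fun j _ => ?_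
  have h1 : ∀ p, slotExtend (finProdFinEquiv (m := l) (n := 2)).symm (fun a => v (σ a)) p =
      v (σ (finProdFinEquiv p)) := by
    intro p
    conv_lhs => rw [← Equiv.symm_apply_apply finProdFinEquiv p]
    rw [slotExtend_apply finProdFinEquiv.symm.injective]
  simp only [h1, Equiv.permCongr_apply, Equiv.symm_symm, Equiv.apply_symm_apply]

/-- Precomposing with the transposition reverses every sign and leaves the summands unchanged. -/
theorem sum_sign_eq_zero {X S : Type*} [Fintype S] [DecidableEq S] {F : (S → X) → ℝ} {p q : S}
    (hpq : p ≠ q) (hF : ∀ V : S → X, F (fun r => V (Equiv.swap p q r)) = F V) (V : S → X) :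
    ∑ τ : Equiv.Perm S, ((τ.sign : ℤ) : ℝ) * F (fun r => V (τ r)) = 0 := by
  have h1 : ∑ τ : Equiv.Perm S, ((τ.sign : ℤ) : ℝ) * F (fun r => V (τ r)) =
      ∑ τ : Equiv.Perm S, -(((τ.sign : ℤ) : ℝ) * F (fun r => V (τ r))) := by
    refine Fintype.sum_equiv (Equiv.mulRight (Equiv.swap p q)) _ _ fun τ => ?_
    simp only [Equiv.coe_mulRight, Equiv.Perm.sign_mul, Equiv.Perm.sign_swap hpq,
      Equiv.Perm.mul_apply, hF fun r => V (τ r)]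
    simp
  rw [Finset.sum_neg_distrib] at h1
  linarith

/-- Closedness is defined by matching on the degree, and `l * 2` is not syntactically a successor;
this restates it for a degree merely equal to one. -/
theorem Current.IsClosed.apply_eq_zero {m : ℕ} {T : Current k n} (hT : T.IsClosed) (h : n = m + 1)
    (ψ : Form k m) (η : Form k n)
    (hη : ∀ x, x ≠ 0 → ∀ v : Fin (m + 1) → E k,
      η.1 x (fun a => v (Fin.cast h a)) = extDeriv ψ.1 x v) : T.toLinearMap η = 0 := by
  subst h
  exact hT ψ η fun x hx => ContinuousAlternatingMap.ext fun v => hη x hx v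

end PairForms

/-! ### Closed currents vanish on products with an exact factor -/

section Exactness

open Finset

variable {k l : ℕ}

/-- Forms of degree one on projective space. -/
structure IsBasicOne (β : E k → E k → ℝ) : Prop where
  add : ∀ x v w, β x (v + w) = β x v + β x w
  smul : ∀ x (r : ℝ) v, β x (r • v) = r * β x v
  horiz : ∀ x, x ≠ 0 → ∀ t : ℂ, β x (t • x) = 0
  smooth : ∀ v, ContDiffOn ℝ ∞ (fun x => β x v) {0}ᶜ
  invariant : ∀ t : ℂ, t ≠ 0 → ∀ x, x ≠ 0 → ∀ v, β (t • x) (t • v) = β x v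

/-- The slots of the last arguments. -/
def succSlot (f : Fin (l * 2 + 1 + 1) ≃ Fin (l + 1) × Fin 2) (a : Fin (l * 2 + 1)) :
    Fin (l + 1) × Fin 2 := f a.succ

/-- The one-form occupies slot `(0, 1)`. Slot `(0, 0)` is left free for the direction of
differentiation, so the product with the two-forms has odd degree `2l + 1`. -/
theorem isPairFamily_cons {f : Fin (l * 2 + 1 + 1) ≃ Fin (l + 1) × Fin 2} (hf : f 0 = (0, 0))
    {β : E k → E k → ℝ} (hβ : IsBasicOne β) {b : Fin l → E k → E k → E k → ℝ}
    (hb : ∀ j, IsBasic (b j)) :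
    IsPairFamily (succSlot f)
      (Fin.cons (fun x _ w => β x w) b : Fin (l + 1) → E k → E k → E k → ℝ) := by
  have h0 : ∀ a, succSlot f a ≠ (0, 0) := fun a h =>
    Fin.succ_ne_zero a (f.injective (h.trans hf.symm))
  refine ⟨fun a a' h => Fin.succ_injective _ (f.injective h), ?_, ?_, ?_, ?_, ?_, ?_, ?_, ?_⟩
  · intro a j hs
    refine Fin.cases (fun hs => absurd hs (h0 a)) (fun i _ => ?_) j hs
    exact (hb i).add_left
  · intro a j hs
    refine Fin.cases (fun hs => absurd hs (h0 a)) (fun i _ => ?_) j hs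
    exact (hb i).smul_left
  · intro a j hs
    refine Fin.cases (fun hs => absurd hs (h0 a)) (fun i _ => ?_) j hs
    exact (hb i).horiz_left
  · intro a j _
    refine Fin.cases ?_ (fun i => ?_) j
    · exact fun x v w w' => hβ.add x w w'
    · exact (hb i).add_right
  · intro a j _
    refine Fin.cases ?_ (fun i => ?_) j
    · exact fun x r v w => hβ.smul x r w
    · exact (hb i).smul_right
  · intro a j _
    refine Fin.cases ?_ (fun i => ?_) j
    · exact fun x hx t v => hβ.horiz x hx t
    · exact (hb i).horiz_right
  · intro j
    refine Fin.cases ?_ (fun i => ?_) j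
    · exact fun v w => hβ.smooth w
    · exact (hb i).smooth
  · intro j
    refine Fin.cases ?_ (fun i => ?_) j
    · exact fun t ht x hx v w => hβ.invariant t ht x hx w
    · exact (hb i).invariant

theorem sum_sign_swap {X S : Type*} [Fintype S] [DecidableEq S] (F : (S → X) → ℝ) {p q : S}
    (hpq : p ≠ q) (V : S → X) :
    ∑ τ : Equiv.Perm S, ((τ.sign : ℤ) : ℝ) * F (fun r => V (τ (Equiv.swap p q r))) =
      -∑ τ : Equiv.Perm S, ((τ.sign : ℤ) : ℝ) * F (fun r => V (τ r)) := by
  rw [← Finset.sum_neg_distrib]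
  refine Fintype.sum_equiv (Equiv.mulRight (Equiv.swap p q)) _ _ fun τ => ?_
  simp only [Equiv.coe_mulRight, Equiv.Perm.sign_mul, Equiv.Perm.sign_swap hpq,
    Equiv.Perm.mul_apply]
  simp

theorem fderiv_prod_apply {ι : Type*} [Fintype ι] [DecidableEq ι] {g : ι → E k → ℝ} {x : E k}
    (hg : ∀ i, DifferentiableAt ℝ (g i) x) (w : E k) :
    fderiv ℝ (fun y => ∏ i, g i y) x w =
      ∑ i, (∏ j ∈ univ.erase i, g j x) * fderiv ℝ (g i) x w := by
  rw [(HasFDerivAt.finsetProd (u := univ) (g := g) fun i _ => (hg i).hasFDerivAt).fderiv,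
    _root_.sum_apply]
  rfl

/-- A form of degree two is locally the antisymmetrization of a derivative. -/
def IsLocallyExact (b : E k → E k → E k → ℝ) : Prop :=
  ∀ x, x ≠ 0 → ∃ S : E k → E k → E k → ℝ, (∀ w v u, S w v u = S v w u) ∧
    ∀ w v u, fderiv ℝ (fun y => b y v u) x w = S w v u - S w u v

/-- By the Leibniz rule `dβ ∧ b₁ ∧ ... ∧ b_l` is, up to the factor from the unnormalized product,
the differential of `β ∧ b₁ ∧ ... ∧ b_l`. The latter descends to projective space, so a closed
current vanishes on the former. -/
theorem apply_wedgeForm_cons_eq_zero {β : E k → E k → ℝ} (hβ : IsBasicOne β)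
    {db : E k → E k → E k → ℝ}
    (hd : ∀ x, x ≠ 0 → ∀ v w, db x v w =
      fderiv ℝ (fun y => β y w) x v - fderiv ℝ (fun y => β y v) x w)
    {b : Fin l → E k → E k → E k → ℝ} (hb : ∀ j, IsBasic (b j)) (hc : ∀ j, IsLocallyExact (b j))
    (h : ∀ j, IsBasic ((Fin.cons db b : Fin (l + 1) → E k → E k → E k → ℝ) j))
    {T : Current k ((l + 1) * 2)} (hT : T.IsClosed) :
    T.toLinearMap (wedgeForm (Fin.cons db b : Fin (l + 1) → E k → E k → E k → ℝ) h) = 0 := by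
  have hn : (l + 1) * 2 = l * 2 + 1 + 1 := by ring
  let f : Fin (l * 2 + 1 + 1) ≃ Fin (l + 1) × Fin 2 :=
    (finCongr hn.symm).trans finProdFinEquiv.symm
  have hf : f 0 = (0, 0) := by
    rw [← Equiv.eq_symm_apply]
    apply Fin.ext
    simp [f]
  have hfam := isPairFamily_cons hf hβ hb
  set c : Fin (l + 1) → E k → E k → E k → ℝ := Fin.cons (fun x _ w => β x w) b with hcdef
  have hdiff : ∀ j v w x, x ≠ 0 → DifferentiableAt ℝ (fun y => c j y v w) x := fun j v w x hx =>
    ((hfam.smooth j v w).contDiffAt (isOpen_compl_singleton.mem_nhds hx)).differentiableAt (by simp)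
  have key : ∀ x, x ≠ 0 → ∀ v : Fin (l * 2 + 1 + 1) → E k,
      (wedgeForm (Fin.cons db b : Fin (l + 1) → E k → E k → E k → ℝ) h).1 x
        (fun a => v (Fin.cast hn a)) = 2 * extDeriv hfam.form.1 x v := by
    intro x hx v
    let V : Fin (l + 1) × Fin 2 → E k := fun p => v (f.symm p)
    let G : Fin (l + 1) → (Fin (l + 1) × Fin 2 → E k) → ℝ := fun i V =>
      (∏ j ∈ univ.erase i, c j x (V (j, 0)) (V (j, 1))) *
        fderiv ℝ (fun y => c i y (V (i, 0)) (V (i, 1))) x (V (0, 0))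
    have h1 : extDeriv hfam.form.1 x v = ∑ i, ∑ τ : Equiv.Perm (Fin (l + 1) × Fin 2),
        ((τ.sign : ℤ) : ℝ) * G i (fun p => V (τ p)) := by
      have he : hfam.form.1 =ᶠ[𝓝 x] fun y => altForm (hfam.multilinear y) := by
        filter_upwards [isOpen_compl_singleton.mem_nhds hx] with y hy
        exact hfam.form_apply hy
      rw [he.extDeriv_eq, extDeriv_altForm, Finset.sum_comm]
      · refine Fintype.sum_equiv (Equiv.permCongr f) _ _ fun σ => ?_
        rw [Equiv.Perm.sign_permCongr, ← Finset.mul_sum]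
        congr 1
        simp only [hfam.multilinear_apply]
        set U := slotExtend (succSlot f) fun a => v (σ a.succ) with hU
        have hU1 : ∀ p, p ≠ (0, 0) → U p = V (Equiv.permCongr f σ p) := by
          intro p hp
          have hp' : f.symm p ≠ 0 := fun e => hp (by rw [← hf, ← e, Equiv.apply_symm_apply])
          obtain ⟨a, ha⟩ := Fin.exists_succ_eq.2 hp'
          have hpa : p = succSlot f a := by rw [succSlot, ha, Equiv.apply_symm_apply]
          rw [hU, hpa, slotExtend_apply hfam.inj]
          simp [V, succSlot]
        have h00 : v (σ 0) = V (Equiv.permCongr f σ (0, 0)) := by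
          simp [V, ← hf]
        have hcU : ∀ j y, c j y (U (j, 0)) (U (j, 1)) =
            c j y (V (Equiv.permCongr f σ (j, 0))) (V (Equiv.permCongr f σ (j, 1))) := by
          intro j y
          refine Fin.cases ?_ (fun i => ?_) j
          · change β y (U (0, 1)) = β y _
            rw [hU1 _ (by simp)]
          · rw [hU1 _ (by simp), hU1 _ (by simp)]
        simp only [hcU, h00]
        exact fderiv_prod_apply (fun i => hdiff i _ _ x hx) _
      · intro u
        exact ((hfam.contDiffOn_multilinear u).contDiffAt
          (isOpen_compl_singleton.mem_nhds hx)).differentiableAt (by simp)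
    -- The terms differentiating a factor `b i` vanish: its derivative is a difference of values of
    -- `S`, each symmetric in the direction of differentiation and one argument of the factor.
    have h2 : ∀ i : Fin l, ∑ τ : Equiv.Perm (Fin (l + 1) × Fin 2),
        ((τ.sign : ℤ) : ℝ) * G i.succ (fun p => V (τ p)) = 0 := by
      intro i
      obtain ⟨S, hS1, hS2⟩ := hc i x hx
      let R : (Fin (l + 1) × Fin 2 → E k) → ℝ := fun V =>
        ∏ j ∈ univ.erase i.succ, c j x (V (j, 0)) (V (j, 1))
      have hR : ∀ s V, R (fun r => V (Equiv.swap (0, 0) (i.succ, s) r)) = R V := by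
        intro s V
        refine Finset.prod_congr rfl fun j hj => ?_
        have hj' : j ≠ i.succ := Finset.ne_of_mem_erase hj
        have e1 : ∀ t, Equiv.swap ((0 : Fin (l + 1)), (0 : Fin 2)) (i.succ, s) (j, t) ≠ (j, t) →
            (j, t) = (0, 0) := by
          intro t ht
          by_contra hne
          exact ht (Equiv.swap_apply_of_ne_of_ne hne fun e => hj' (congrArg Prod.fst e))
        have e2 : Equiv.swap ((0 : Fin (l + 1)), (0 : Fin 2)) (i.succ, s) (j, 1) = (j, 1) := by
          by_contra hne
          simpa using e1 1 hne
        change c j x (V (Equiv.swap _ _ (j, 0))) (V (Equiv.swap _ _ (j, 1))) = _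
        rw [e2]
        refine Fin.cases (fun _ => rfl) (fun i' e1 => ?_) j e1
        have e3 : Equiv.swap ((0 : Fin (l + 1)), (0 : Fin 2)) (i.succ, s) (i'.succ, 0) =
            (i'.succ, 0) := by
          by_contra hne
          simpa using e1 0 hne
        rw [e3]
      have hG : ∀ V, G i.succ V = R V * S (V (0, 0)) (V (i.succ, 0)) (V (i.succ, 1)) -
          R V * S (V (0, 0)) (V (i.succ, 1)) (V (i.succ, 0)) := by
        intro V
        rw [← mul_sub, ← hS2]
        rfl
      simp only [hG, mul_sub, Finset.sum_sub_distrib]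
      have z : (0, 0) ≠ ((i.succ, 0) : Fin (l + 1) × Fin 2) := by
        simpa using (Fin.succ_ne_zero i).symm
      have z' : (0, 0) ≠ ((i.succ, 1) : Fin (l + 1) × Fin 2) := by simp
      refine (congrArg₂ (· - ·)
        (sum_sign_eq_zero (F := fun V => R V * S (V (0, 0)) (V (i.succ, 0)) (V (i.succ, 1))) z ?_ V)
        (sum_sign_eq_zero (F := fun V => R V * S (V (0, 0)) (V (i.succ, 1)) (V (i.succ, 0))) z' ?_
          V)).trans (sub_zero 0)
      · intro V
        simp only [hR]
        rw [Equiv.swap_apply_left, Equiv.swap_apply_right,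
          Equiv.swap_apply_of_ne_of_ne z'.symm (by simp), hS1]
      · intro V
        simp only [hR]
        rw [Equiv.swap_apply_left, Equiv.swap_apply_right,
          Equiv.swap_apply_of_ne_of_ne z.symm (by simp), hS1]
    have hG0 : ∀ V, G 0 V = (∏ j, b j x (V (j.succ, 0)) (V (j.succ, 1))) *
        fderiv ℝ (fun y => β y (V (0, 1))) x (V (0, 0)) := by
      intro V
      have : ∏ j ∈ univ.erase (0 : Fin (l + 1)), c j x (V (j, 0)) (V (j, 1)) =
          ∏ j : Fin l, b j x (V (j.succ, 0)) (V (j.succ, 1)) := by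
        rw [show univ.erase (0 : Fin (l + 1)) = univ.map ⟨Fin.succ, Fin.succ_injective _⟩ by
          ext j; simp [Fin.exists_succ_eq], Finset.prod_map]
        rfl
      simp only [G, this]
      rfl
    rw [h1, Fin.sum_univ_succ, Finset.sum_eq_zero (fun i _ => h2 i), add_zero, two_mul,
      wedgeForm_apply h hx, wedge]
    have z : ((0 : Fin (l + 1)), (0 : Fin 2)) ≠ (0, 1) := by simp
    have h3 := sum_sign_swap (G 0) z V
    -- The factor `db` is the derivative of `β` minus the same with its two arguments exchanged.
    -- After signed summation both parts contribute equally, whence the factor `2`.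
    have h4 : ∀ τ : Equiv.Perm (Fin (l + 1) × Fin 2),
        ∏ j, (Fin.cons db b : Fin (l + 1) → E k → E k → E k → ℝ) j x (V (τ (j, 0))) (V (τ (j, 1))) =
        G 0 (fun p => V (τ p)) - G 0 (fun r => V (τ (Equiv.swap (0, 0) (0, 1) r))) := by
      intro τ
      refine Eq.trans ?_ (congrArg₂ (· - ·) (hG0 fun p => V (τ p)).symm
        (hG0 fun r => V (τ (Equiv.swap (0, 0) (0, 1) r))).symm)
      rw [Fin.prod_univ_succ, Fin.cons_zero, hd x hx, Equiv.swap_apply_left,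
        Equiv.swap_apply_right]
      simp only [Fin.cons_succ]
      have e : ∀ (j : Fin l) (s : Fin 2), Equiv.swap ((0 : Fin (l + 1)), (0 : Fin 2)) (0, 1)
          (j.succ, s) = (j.succ, s) := fun j s =>
        Equiv.swap_apply_of_ne_of_ne (by simp) (by simp)
      simp only [e]
      ring
    have h5 : ∀ p, (fun p => v (Fin.cast hn (finProdFinEquiv p))) p = V p := fun p => rfl
    simp only [h4, mul_sub, Finset.sum_sub_distrib, h5]
    rw [h3]
    ring
  have := hT.apply_eq_zero hn hfam.form ((2 : ℝ)⁻¹ •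
    wedgeForm (Fin.cons db b : Fin (l + 1) → E k → E k → E k → ℝ) h) fun x hx v => by
      change (2 : ℝ)⁻¹ * (wedgeForm _ h).1 x _ = _
      rw [key x hx, inv_mul_cancel_left₀ two_ne_zero]
  rw [map_smul, smul_eq_mul] at this
  simpa using this

end Exactness

/-! ### The Fubini–Study form and its primitive on the punctured space -/

section FubiniStudy

open Finset

variable {k l : ℕ}

/-- The standard Hermitian product. -/
def hdot (x y : E k) : ℂ := ∑ i, (starRingEnd ℂ) (x i) * y i

/-- The square of the Euclidean norm. -/
def nsq (x : E k) : ℝ := ∑ i, Complex.normSq (x i)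

theorem hdot_add_left (x y z : E k) : hdot (x + y) z = hdot x z + hdot y z := by
  simp [hdot, add_mul, Finset.sum_add_distrib]

theorem hdot_add_right (x y z : E k) : hdot x (y + z) = hdot x y + hdot x z := by
  simp [hdot, mul_add, Finset.sum_add_distrib]

theorem hdot_sub_left (x y z : E k) : hdot (x - y) z = hdot x z - hdot y z := by
  simp [hdot, sub_mul, Finset.sum_sub_distrib]

theorem hdot_sub_right (x y z : E k) : hdot x (y - z) = hdot x y - hdot x z := by
  simp [hdot, mul_sub, Finset.sum_sub_distrib]

theorem hdot_smul_left (c : ℂ) (x y : E k) : hdot (c • x) y = (starRingEnd ℂ) c * hdot x y := by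
  simp [hdot, Finset.mul_sum, mul_assoc]

theorem hdot_smul_right (c : ℂ) (x y : E k) : hdot x (c • y) = c * hdot x y := by
  simp only [hdot, Finset.mul_sum, Pi.smul_apply, smul_eq_mul]
  exact Finset.sum_congr rfl fun i _ => by ring

theorem hdot_real_smul_left (c : ℝ) (x y : E k) : hdot (c • x) y = c * hdot x y := by
  simp [hdot, Finset.mul_sum, mul_assoc]

theorem hdot_real_smul_right (c : ℝ) (x y : E k) : hdot x (c • y) = c * hdot x y := by
  simp only [hdot, Finset.mul_sum, Pi.smul_apply, Complex.real_smul]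
  exact Finset.sum_congr rfl fun i _ => by ring

theorem conj_hdot (x y : E k) : (starRingEnd ℂ) (hdot x y) = hdot y x := by
  simp only [hdot, map_sum, map_mul, Complex.conj_conj]
  exact Finset.sum_congr rfl fun i _ => mul_comm _ _

theorem hdot_self (x : E k) : hdot x x = (nsq x : ℂ) := by
  simp only [hdot, nsq, Complex.ofReal_sum, Complex.normSq_eq_conj_mul_self]

theorem kahler_eq (x y : E k) : kahler x y = (hdot x y).im := by
  rw [kahler, hdot, Complex.im_sum]
  refine Finset.sum_congr rfl fun i _ => ?_
  simp [herm, Complex.mul_im]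
  ring

theorem nsq_pos {x : E k} (hx : x ≠ 0) : 0 < nsq x := by
  obtain ⟨i, hi⟩ := Function.ne_iff.1 hx
  exact Finset.sum_pos' (fun _ _ => Complex.normSq_nonneg _)
    ⟨i, mem_univ i, Complex.normSq_pos.2 hi⟩

theorem nsq_smul (c : ℂ) (x : E k) : nsq (c • x) = Complex.normSq c * nsq x := by
  simp [nsq, Finset.mul_sum]

theorem nsq_le (x : E k) : nsq x ≤ (k + 1) * ‖x‖ ^ 2 := by
  calc nsq x ≤ ∑ _i : Fin (k + 1), ‖x‖ ^ 2 := by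
        refine Finset.sum_le_sum fun i _ => ?_
        rw [Complex.normSq_eq_norm_sq]
        exact pow_le_pow_left₀ (norm_nonneg _) (norm_le_pi_norm x i) 2
    _ = _ := by simp

variable (k) in
/-- The imaginary part of the Hermitian product. -/
def imdot : E k →L[ℝ] E k →L[ℝ] ℝ :=
  (LinearMap.mk₂ ℝ (fun x y : E k => (hdot x y).im) (by simp [hdot_add_left])
    (by simp [hdot_real_smul_left]) (by simp [hdot_add_right])
    (by simp [hdot_real_smul_right])).toContinuousBilinearMap

theorem imdot_apply (x y : E k) : imdot k x y = (hdot x y).im := rfl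

variable (k) in
/-- The real part of the Hermitian product. -/
def redot : E k →L[ℝ] E k →L[ℝ] ℝ :=
  (LinearMap.mk₂ ℝ (fun x y : E k => (hdot x y).re) (by simp [hdot_add_left])
    (by simp [hdot_real_smul_left]) (by simp [hdot_add_right])
    (by simp [hdot_real_smul_right])).toContinuousBilinearMap

theorem redot_apply (x y : E k) : redot k x y = (hdot x y).re := rfl

theorem redot_self (x : E k) : redot k x x = nsq x := by
  rw [redot_apply, hdot_self, Complex.ofReal_re]

theorem hasFDerivAt_nsq (x : E k) : HasFDerivAt (nsq : E k → ℝ) ((2 : ℝ) • redot k x) x := by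
  have h : HasFDerivAt (fun y : E k => redot k y y) _ x :=
    (redot k).hasFDerivAt.clm_apply (hasFDerivAt_id x)
  rw [show (fun y : E k => redot k y y) = nsq from funext redot_self] at h
  refine h.congr_fderiv ?_
  ext v
  have e : redot k v x = redot k x v := by
    rw [redot_apply, redot_apply, ← conj_hdot x v, Complex.conj_re]
  simp [e]
  ring

theorem contDiff_nsq : ContDiff ℝ ∞ (nsq : E k → ℝ) := by
  rw [show (nsq : E k → ℝ) = fun y => redot k y y from funext fun y => (redot_self y).symm]
  exact (redot k).contDiff.clm_apply contDiff_id

/-- A primitive of the Fubini–Study form on the punctured space. -/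
def theta (x : E k) : E k →L[ℝ] ℝ := (nsq x)⁻¹ • imdot k x

theorem theta_apply (x v : E k) : theta x v = (nsq x)⁻¹ * (hdot x v).im := rfl

theorem contDiffOn_theta : ContDiffOn ℝ ∞ (theta : E k → E k →L[ℝ] ℝ) {0}ᶜ :=
  (contDiff_nsq.contDiffOn.inv fun _ hx => (nsq_pos hx).ne').smul (imdot k).contDiff.contDiffOn

/-- `theta` is not horizontal and does not descend, but its value on fibre directions is independent
of the point. This is what lets a combination with its pullback descend. -/
theorem theta_smul_self {x : E k} (hx : x ≠ 0) (c : ℂ) : theta x (c • x) = c.im := by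
  rw [theta_apply, hdot_smul_right, hdot_self, Complex.im_mul_ofReal]
  field_simp [(nsq_pos hx).ne']

theorem theta_smul {c : ℂ} (hc : c ≠ 0) (x v : E k) : theta (c • x) (c • v) = theta x v := by
  rw [theta_apply, theta_apply, nsq_smul, hdot_smul_right, hdot_smul_left, ← mul_assoc,
    Complex.mul_conj, Complex.im_ofReal_mul]
  have := Complex.normSq_pos.2 hc
  field_simp

/-- The exterior derivative of a form of degree one. -/
def dOne (τ : E k → E k →L[ℝ] ℝ) (x v w : E k) : ℝ := fderiv ℝ τ x v w - fderiv ℝ τ x w v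

theorem contDiffAt_of_contDiffOn {F : Type*} [NormedAddCommGroup F] [NormedSpace ℝ F]
    {f : E k → F} (h : ContDiffOn ℝ ∞ f {0}ᶜ) {x : E k} (hx : x ≠ 0) : ContDiffAt ℝ ∞ f x :=
  h.contDiffAt (isOpen_compl_singleton.mem_nhds hx)

theorem differentiableAt_of_contDiffOn {F : Type*} [NormedAddCommGroup F] [NormedSpace ℝ F]
    {f : E k → F} (h : ContDiffOn ℝ ∞ f {0}ᶜ) {x : E k} (hx : x ≠ 0) : DifferentiableAt ℝ f x :=
  (contDiffAt_of_contDiffOn h hx).differentiableAt (by simp)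

theorem contDiffOn_fderiv {F : Type*} [NormedAddCommGroup F] [NormedSpace ℝ F]
    {f : E k → F} (h : ContDiffOn ℝ ∞ f {0}ᶜ) : ContDiffOn ℝ ∞ (fderiv ℝ f) {0}ᶜ :=
  h.fderiv_of_isOpen isOpen_compl_singleton (by simp)

theorem fderiv_apply_const {τ : E k → E k →L[ℝ] ℝ} {x : E k} (h : DifferentiableAt ℝ τ x)
    (v w : E k) : fderiv ℝ (fun y => τ y w) x v = fderiv ℝ τ x v w := by
  rw [(h.hasFDerivAt.clm_apply (hasFDerivAt_const w x)).fderiv]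
  simp

theorem contDiffOn_dOne {τ : E k → E k →L[ℝ] ℝ} (h : ContDiffOn ℝ ∞ τ {0}ᶜ) (v w : E k) :
    ContDiffOn ℝ ∞ (fun x => dOne τ x v w) {0}ᶜ := by
  have h1 := contDiffOn_fderiv h
  exact ((h1.clm_apply contDiffOn_const).clm_apply contDiffOn_const).sub
    ((h1.clm_apply contDiffOn_const).clm_apply contDiffOn_const)

/-- The function `S` is the second derivative of the primitive, symmetric by Schwarz's theorem. -/
theorem isLocallyExact_dOne {τ : E k → E k →L[ℝ] ℝ} (h : ContDiffOn ℝ ∞ τ {0}ᶜ) :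
    IsLocallyExact (dOne τ) := by
  intro x hx
  have h1 := differentiableAt_of_contDiffOn (contDiffOn_fderiv h) hx
  have h2 : ∀ v u, HasFDerivAt (fun y => fderiv ℝ τ y v u)
      (((fderiv ℝ (fderiv ℝ τ) x).flip v).flip u) x := by
    intro v u
    have h3 := (h1.hasFDerivAt.clm_apply (hasFDerivAt_const v x)).clm_apply (hasFDerivAt_const u x)
    refine h3.congr_fderiv ?_
    ext w
    simp
  refine ⟨fun w v u => fderiv ℝ (fderiv ℝ τ) x w v u, fun w v u => ?_, fun w v u => ?_⟩
  · have h4 : IsSymmSndFDerivAt ℝ τ x :=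
      (contDiffAt_of_contDiffOn h hx).isSymmSndFDerivAt
      (by rw [minSmoothness_of_isRCLikeNormedField]; exact WithTop.coe_le_coe.2 le_top)
    simp only [h4.eq w v]
  · have h5 := ((h2 v u).sub (h2 u v)).fderiv
    change fderiv ℝ (fun y => fderiv ℝ τ y v u - fderiv ℝ τ y u v) x w = _
    rw [show (fun y => fderiv ℝ τ y v u - fderiv ℝ τ y u v) =
      (fun y => fderiv ℝ τ y v u) - fun y => fderiv ℝ τ y u v from rfl, h5]
    rfl

theorem isBasic_dOne {τ : E k → E k →L[ℝ] ℝ} (h : ContDiffOn ℝ ∞ τ {0}ᶜ)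
    (hh : ∀ x, x ≠ 0 → ∀ (t : ℂ) v, dOne τ x v (t • x) = 0)
    (hi : ∀ t : ℂ, t ≠ 0 → ∀ x, x ≠ 0 → ∀ v w, dOne τ (t • x) (t • v) (t • w) = dOne τ x v w) :
    IsBasic (dOne τ) where
  add_left x v v' w := by simp only [dOne, map_add, _root_.add_apply]; ring
  smul_left x r v w := by simp only [dOne, map_smul, _root_.smul_apply, smul_eq_mul]; ring
  horiz_left x hx t w := by
    rw [← neg_eq_zero, ← hh x hx t w, dOne, dOne]; ring
  add_right x v w w' := by simp only [dOne, map_add, _root_.add_apply]; ring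
  smul_right x r v w := by simp only [dOne, map_smul, _root_.smul_apply, smul_eq_mul]; ring
  horiz_right := hh
  smooth := contDiffOn_dOne h
  invariant := hi

/-- The Hermitian projection to the complement of a line. -/
def hproj (x : E k) : E k →ₗ[ℂ] E k where
  toFun v := v - ((nsq x : ℂ)⁻¹ * hdot x v) • x
  map_add' v w := by rw [hdot_add_right]; module
  map_smul' c v := by rw [hdot_smul_right, RingHom.id_apply]; module

theorem hproj_smul_self {x : E k} (hx : x ≠ 0) (c : ℂ) : hproj x (c • x) = 0 := by
  have h : (nsq x : ℂ) ≠ 0 := by exact_mod_cast (nsq_pos hx).ne'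
  change c • x - _ • x = 0
  rw [hdot_smul_right, hdot_self, mul_comm c, inv_mul_cancel_left₀ h, sub_self]

theorem hproj_smul {c : ℂ} (hc : c ≠ 0) (x v : E k) : hproj (c • x) (c • v) = c • hproj x v := by
  change c • v - _ • c • x = c • (v - _ • x)
  rw [nsq_smul, hdot_smul_right, hdot_smul_left, smul_sub, smul_smul, smul_smul,
    ← mul_assoc c (starRingEnd ℂ c), Complex.mul_conj]
  have : (Complex.normSq c : ℂ) ≠ 0 := by exact_mod_cast (Complex.normSq_pos.2 hc).ne'
  congr 2
  push_cast
  field_simp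

theorem hdot_hproj {x : E k} (hx : x ≠ 0) (v w : E k) : hdot (hproj x v) (hproj x w) =
    hdot v w - ((nsq x)⁻¹ : ℝ) * ((starRingEnd ℂ) (hdot x v) * hdot x w) := by
  have h : (nsq x : ℂ) ≠ 0 := by exact_mod_cast (nsq_pos hx).ne'
  change hdot (v - _ • x) (w - _ • x) = _
  simp only [hdot_sub_left, hdot_sub_right, hdot_smul_left, hdot_smul_right, hdot_self, map_mul,
    map_inv₀, Complex.conj_ofReal, ← conj_hdot x v, Complex.ofReal_inv]
  field_simp
  ring

/-- The terms from differentiating `(nsq x)⁻¹` are exactly the correction made by the orthogonal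
projection. The formula shows positivity, horizontality and invariance at once. -/
theorem dOne_theta {x : E k} (hx : x ≠ 0) (v w : E k) :
    dOne theta x v w = 2 * (nsq x)⁻¹ * kahler (hproj x v) (hproj x w) := by
  have hn := (nsq_pos hx).ne'
  have h : HasFDerivAt (theta : E k → E k →L[ℝ] ℝ) _ x :=
    ((hasDerivAt_inv hn).comp_hasFDerivAt x (hasFDerivAt_nsq x)).smul (imdot k).hasFDerivAt
  have h1 : ∀ v w, fderiv ℝ theta x v w = (nsq x)⁻¹ * (hdot v w).im -
      2 * (nsq x ^ 2)⁻¹ * (hdot x v).re * (hdot x w).im := by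
    intro v w
    rw [h.fderiv]
    simp only [_root_.add_apply, _root_.smul_apply, ContinuousLinearMap.smulRight_apply,
      imdot_apply, redot_apply, smul_eq_mul, Function.comp_apply]
    ring
  rw [dOne, h1, h1, kahler_eq, hdot_hproj hx, Complex.sub_im, Complex.im_ofReal_mul,
    Complex.mul_im, Complex.conj_re, Complex.conj_im, ← conj_hdot v w, Complex.conj_im]
  field_simp
  ring

theorem isBasic_dOne_theta : IsBasic (dOne (theta : E k → E k →L[ℝ] ℝ)) := by
  refine isBasic_dOne contDiffOn_theta (fun x hx t v => ?_) fun t ht x hx v w => ?_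
  · rw [dOne_theta hx, hproj_smul_self hx, kahler_eq, show (0 : E k) = (0 : ℂ) • x by simp,
      hdot_smul_right]
    simp
  · rw [dOne_theta hx, dOne_theta (smul_ne_zero ht hx), hproj_smul ht, hproj_smul ht, nsq_smul,
      kahler_eq, kahler_eq, hdot_smul_left, hdot_smul_right, ← mul_assoc, mul_comm (_ : ℂ) t,
      Complex.mul_conj, Complex.im_ofReal_mul]
    have := Complex.normSq_pos.2 ht
    field_simp

end FubiniStudy

/-! ### Pullback of forms and invariance of mass -/

section Pullback

open Finset

variable {k l n D : ℕ} {G : E k → E k} {g : P k → P k}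

namespace IsLift

theorem contDiff_real (h : IsLift D G g) : ContDiff ℝ ∞ G := h.contDiff.restrict_scalars ℝ

theorem hasFDerivAt_real (h : IsLift D G g) (x : E k) : HasFDerivAt G (fderiv ℝ G x) x :=
  ((h.contDiff_real.differentiable (by simp)) x).hasFDerivAt

theorem contDiff_fderiv (h : IsLift D G g) : ContDiff ℝ ∞ (fderiv ℝ G) :=
  h.contDiff_real.fderiv_right (by simp)

theorem fderiv_smul (h : IsLift D G g) (x : E k) (c : ℂ) (v : E k) :
    fderiv ℝ G x (c • v) = c • fderiv ℝ G x v := by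
  rw [((h.contDiff.differentiable (by simp)) x).fderiv_restrictScalars ℝ]
  exact map_smul (fderiv ℂ G x) c v

/-- Euler's identity, obtained by differentiating homogeneity along the ray through `x`. -/
theorem fderiv_self (h : IsLift D G g) (x : E k) : fderiv ℝ G x x = (D : ℂ) • G x := by
  have h1 : HasDerivAt (fun t : ℝ => G (((1 + t : ℝ) : ℂ) • x)) (fderiv ℝ G x x) 0 := by
    have h2 : HasDerivAt (fun t : ℝ => ((1 + t : ℝ) : ℂ) • x) x 0 := by
      have h3 : HasDerivAt (fun t : ℝ => (((1 + t : ℝ)) : ℂ)) 1 0 := by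
        simpa using ((hasDerivAt_id (0 : ℝ)).const_add 1).ofReal_comp
      simpa using h3.smul_const x
    have h4 : HasFDerivAt G (fderiv ℝ G x) (((1 + (0 : ℝ) : ℝ) : ℂ) • x) := by
      simpa using h.hasFDerivAt_real x
    exact h4.comp_hasDerivAt 0 h2
  have h5 : HasDerivAt (fun t : ℝ => G (((1 + t : ℝ) : ℂ) • x)) ((D : ℂ) • G x) 0 := by
    simp only [h.homog]
    have h3 : HasDerivAt (fun t : ℝ => (((1 + t : ℝ)) : ℂ) ^ D) D 0 := by
      simpa using (((hasDerivAt_id (0 : ℝ)).const_add 1).ofReal_comp).fun_pow D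
    exact h3.smul_const (G x)
  exact h1.unique h5

theorem fderiv_homog (h : IsLift D G g) (c : ℂ) (x v : E k) :
    fderiv ℝ G (c • x) (c • v) = c ^ D • fderiv ℝ G x v := by
  have h1 : HasDerivAt (fun t : ℝ => G (c • (x + t • v))) (fderiv ℝ G (c • x) (c • v)) 0 := by
    have h2 : HasDerivAt (fun t : ℝ => c • (x + t • v)) (c • v) 0 := by
      have h3 : HasDerivAt (fun t : ℝ => x + t • v) v 0 := by
        simpa using ((hasDerivAt_id (0 : ℝ)).smul_const v).const_add x
      exact h3.const_smul c
    have h4 : HasFDerivAt G (fderiv ℝ G (c • x)) (c • (x + (0 : ℝ) • v)) := by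
      simpa using h.hasFDerivAt_real (c • x)
    exact h4.comp_hasDerivAt 0 h2
  have h5 : HasDerivAt (fun t : ℝ => G (c • (x + t • v))) (c ^ D • fderiv ℝ G x v) 0 := by
    simp only [h.homog]
    have h3 : HasDerivAt (fun t : ℝ => x + t • v) v 0 := by
      simpa using ((hasDerivAt_id (0 : ℝ)).smul_const v).const_add x
    have h4 : HasFDerivAt G (fderiv ℝ G x) (x + (0 : ℝ) • v) := by
      simpa using h.hasFDerivAt_real x
    exact (h4.comp_hasDerivAt 0 h3).const_smul (c ^ D)
  exact h1.unique h5

end IsLift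

theorem contDiffOn_apply_form {s : Set (E k)} {φ : E k → E k [⋀^Fin n]→L[ℝ] ℝ}
    (hφ : ContDiffOn ℝ ∞ φ s) {u : Fin n → E k → E k} (hu : ∀ i, ContDiffOn ℝ ∞ (u i) s) :
    ContDiffOn ℝ ∞ (fun x => φ x fun i => u i x) s := by
  have h : ∀ x, (φ x fun i => u i x) = ∑ m : Fin n → Fin (k + 1) × Fin 2,
      (φ x fun a => rbasis (m a)) * ((n.factorial : ℝ)⁻¹ *
        ∑ σ : Equiv.Perm (Fin n), ((σ.sign : ℤ) : ℝ) * ∏ a, rcoord (m a) (u (σ a) x)) := by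
    intro x
    conv_lhs => rw [eq_sum_prodAlt (φ x)]
    simp only [ContinuousAlternatingMap.sum_apply, ContinuousAlternatingMap.smul_apply,
      prodAlt_apply, smul_eq_mul]
  simp only [h]
  have h1 : ∀ w : Fin n → E k, ContDiffOn ℝ ∞ (fun x => φ x w) s := fun w =>
    (ContinuousAlternatingMap.apply ℝ (E k) ℝ w).contDiff.comp_contDiffOn hφ
  refine ContDiffOn.sum fun m _ => (h1 _).mul (contDiffOn_const.mul (ContDiffOn.sum fun σ _ =>
    contDiffOn_const.mul (contDiffOn_prod fun a _ => ?_)))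
  exact (rcoord (m a)).contDiff.comp_contDiffOn (hu (σ a))

theorem form_ext {φ η : Form k n} (h : ∀ x, x ≠ 0 → ∀ v, φ.1 x v = η.1 x v) : φ = η := by
  apply Subtype.ext
  funext x
  by_cases hx : x = 0
  · rw [hx, φ.2.2.1, η.2.2.1]
  · exact ContinuousAlternatingMap.ext (h x hx)

/-- The pullback of a form. -/
def IsLift.pullbackForm (h : IsLift D G g) (φ : Form k n) : Form k n :=
  ⟨fun x => if x = 0 then 0 else (φ.1 (G x)).compContinuousLinearMap (fderiv ℝ G x), by
  obtain ⟨h1, h2, h3, h4⟩ := φ.2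
  refine ⟨?_, if_pos rfl, ?_, ?_⟩
  · refine ContDiffOn.congr (f := fun x =>
      (φ.1 (G x)).compContinuousLinearMap (fderiv ℝ G x)) ?_ fun x hx => if_neg hx
    refine contDiffOn_form fun v => ?_
    refine contDiffOn_apply_form (u := fun i x => fderiv ℝ G x (v i))
      (h1.comp h.contDiff_real.contDiffOn fun x hx => h.ne_zero x hx) fun i => ?_
    exact (h.contDiff_fderiv.clm_apply contDiff_const).contDiffOn
  · rintro x hx v ⟨i, c, hi⟩
    simp only [if_neg hx]
    refine h3 _ (h.ne_zero x hx) _ ⟨i, c * D, ?_⟩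
    change fderiv ℝ G x (v i) = _
    rw [hi, h.fderiv_smul, h.fderiv_self, smul_smul]
  · intro c hc x hx v
    simp only [if_neg hx, if_neg (smul_ne_zero hc hx)]
    change φ.1 (G (c • x)) (fun i => fderiv ℝ G (c • x) (c • v i)) = _
    simp only [h.fderiv_homog, h.homog]
    exact h4 _ (pow_ne_zero _ hc) _ (h.ne_zero x hx) _⟩

theorem IsLift.pullbackForm_apply (h : IsLift D G g) (φ : Form k n) {x : E k} (hx : x ≠ 0)
    (v : Fin n → E k) : (h.pullbackForm φ).1 x v = φ.1 (G x) fun i => fderiv ℝ G x (v i) := by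
  rw [show (h.pullbackForm φ).1 x = (φ.1 (G x)).compContinuousLinearMap (fderiv ℝ G x) from
    if_neg hx]
  rfl

/-- The pullback of forms. -/
def IsLift.pullback (h : IsLift D G g) : Form k n →ₗ[ℝ] Form k n where
  toFun := h.pullbackForm
  map_add' φ η := form_ext fun x hx v => by
    change _ = (h.pullbackForm φ).1 x v + (h.pullbackForm η).1 x v
    rw [h.pullbackForm_apply _ hx, h.pullbackForm_apply _ hx, h.pullbackForm_apply _ hx]
    rfl
  map_smul' r φ := form_ext fun x hx v => by
    change _ = r * (h.pullbackForm φ).1 x v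
    rw [h.pullbackForm_apply _ hx, h.pullbackForm_apply _ hx]
    rfl

theorem IsLift.pullback_eq (h : IsLift D G g) (φ : Form k n) {x : E k} (hx : x ≠ 0) :
    (h.pullback φ).1 x = (φ.1 (G x)).compContinuousLinearMap (fderiv ℝ G x) := if_neg hx

theorem IsLift.pullback_apply (h : IsLift D G g) (φ : Form k n) {x : E k} (hx : x ≠ 0)
    (v : Fin n → E k) : (h.pullback φ).1 x v = φ.1 (G x) fun i => fderiv ℝ G x (v i) := by
  rw [h.pullback_eq φ hx]; rfl

/-- The pullback of `theta`. -/
def thetaPull (G : E k → E k) (x : E k) : E k →L[ℝ] ℝ := (theta (G x)).comp (fderiv ℝ G x)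

theorem IsLift.contDiffOn_thetaPull (h : IsLift D G g) :
    ContDiffOn ℝ ∞ (thetaPull G) {0}ᶜ :=
  (contDiffOn_theta.comp h.contDiff_real.contDiffOn fun x hx => h.ne_zero x hx).clm_comp
    h.contDiff_fderiv.contDiffOn

/-- Pullback commutes with `d`: the second derivatives of `G` are symmetric and cancel. -/
theorem IsLift.dOne_thetaPull (h : IsLift D G g) {x : E k} (hx : x ≠ 0) (v w : E k) :
    dOne (thetaPull G) x v w = dOne theta (G x) (fderiv ℝ G x v) (fderiv ℝ G x w) := by
  have h1 := (differentiableAt_of_contDiffOn contDiffOn_theta (h.ne_zero x hx)).hasFDerivAt.comp x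
    (h.hasFDerivAt_real x)
  have h2 : HasFDerivAt (fderiv ℝ G) (fderiv ℝ (fderiv ℝ G) x) x :=
    ((h.contDiff_fderiv.differentiable (by simp)) x).hasFDerivAt
  have h3 : HasFDerivAt (thetaPull G) _ x := h1.clm_comp h2
  have h4 : ∀ v w, fderiv ℝ (thetaPull G) x v w = theta (G x) (fderiv ℝ (fderiv ℝ G) x v w) +
      fderiv ℝ theta (G x) (fderiv ℝ G x v) (fderiv ℝ G x w) := by
    intro v w
    rw [h3.fderiv]
    simp
  have h5 : IsSymmSndFDerivAt ℝ G x := h.contDiff_real.contDiffAt.isSymmSndFDerivAt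
    (by rw [minSmoothness_of_isRCLikeNormedField]; exact WithTop.coe_le_coe.2 le_top)
  rw [dOne, h4, h4, h5.eq v w, dOne]
  ring

theorem IsLift.isBasic_dOne_thetaPull (h : IsLift D G g) : IsBasic (dOne (thetaPull G)) := by
  refine isBasic_dOne h.contDiffOn_thetaPull (fun x hx t v => ?_) fun t ht x hx v w => ?_
  · rw [h.dOne_thetaPull hx, h.fderiv_smul, h.fderiv_self, smul_smul]
    exact isBasic_dOne_theta.horiz_right _ (h.ne_zero x hx) _ _
  · rw [h.dOne_thetaPull hx, h.dOne_thetaPull (smul_ne_zero ht hx), h.fderiv_homog, h.fderiv_homog,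
      h.homog]
    exact isBasic_dOne_theta.invariant _ (pow_ne_zero _ ht) _ (h.ne_zero x hx) _ _

/-- The primitive of the difference of the pullback of the Fubini–Study form and a multiple. -/
def thetaDiff (D : ℕ) (G : E k → E k) (x : E k) : E k →L[ℝ] ℝ := thetaPull G x - (D : ℝ) • theta x

theorem IsLift.contDiffOn_thetaDiff (h : IsLift D G g) : ContDiffOn ℝ ∞ (thetaDiff D G) {0}ᶜ :=
  h.contDiffOn_thetaPull.sub (contDiffOn_theta.const_smul (D : ℝ))

/-- By Euler's identity the pullback of `theta` takes the value `D * t.im` on the fibre direction `t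
• x`, which is exactly `D` times that of `theta`. The difference is therefore horizontal and is a
genuine one-form on projective space. -/
theorem IsLift.isBasicOne_thetaDiff (h : IsLift D G g) :
    IsBasicOne fun x v => thetaDiff D G x v where
  add x := map_add _
  smul x := map_smul _
  horiz x hx t := by
    change theta (G x) (fderiv ℝ G x (t • x)) - (D : ℝ) * theta x (t • x) = 0
    rw [h.fderiv_smul, h.fderiv_self, smul_smul, theta_smul_self hx, theta_smul_self
      (h.ne_zero x hx), ← Complex.ofReal_natCast, Complex.im_mul_ofReal]
    ring
  smooth v := h.contDiffOn_thetaDiff.clm_apply contDiffOn_const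
  invariant t ht x hx v := by
    change theta (G (t • x)) (fderiv ℝ G (t • x) (t • v)) - (D : ℝ) * theta (t • x) (t • v) =
      theta (G x) (fderiv ℝ G x v) - (D : ℝ) * theta x v
    rw [h.fderiv_homog, h.homog, theta_smul (pow_ne_zero _ ht), theta_smul ht]

theorem IsLift.dOne_thetaDiff (h : IsLift D G g) {x : E k} (hx : x ≠ 0) (v w : E k) :
    dOne (thetaDiff D G) x v w = dOne (thetaPull G) x v w - D * dOne theta x v w := by
  have h1 : HasFDerivAt (thetaDiff D G) (fderiv ℝ (thetaPull G) x - (D : ℝ) • fderiv ℝ theta x) x :=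
    (differentiableAt_of_contDiffOn h.contDiffOn_thetaPull hx).hasFDerivAt.sub
      ((differentiableAt_of_contDiffOn contDiffOn_theta hx).hasFDerivAt.const_smul (D : ℝ))
  rw [dOne, h1.fderiv, dOne, dOne]
  simp
  ring

theorem IsLift.isBasic_dOne_thetaDiff (h : IsLift D G g) : IsBasic (dOne (thetaDiff D G)) := by
  refine isBasic_dOne h.contDiffOn_thetaDiff (fun x hx t v => ?_) fun t ht x hx v w => ?_
  · rw [h.dOne_thetaDiff hx, h.isBasic_dOne_thetaPull.horiz_right x hx,
      isBasic_dOne_theta.horiz_right x hx, mul_zero, sub_zero]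
  · rw [h.dOne_thetaDiff hx, h.dOne_thetaDiff (smul_ne_zero ht hx),
      h.isBasic_dOne_thetaPull.invariant t ht x hx, isBasic_dOne_theta.invariant t ht x hx]

theorem IsLift.apply_wedgeForm_thetaDiff_eq_zero (h : IsLift D G g) (i : Fin l)
    {b : Fin l → E k → E k → E k → ℝ} (hi : b i = dOne (thetaDiff D G)) (hb : ∀ j, IsBasic (b j))
    (hc : ∀ j, IsLocallyExact (b j)) {T : Current k (l * 2)} (hT : T.IsClosed) :
    T.toLinearMap (wedgeForm b hb) = 0 := by
  obtain _ | l := l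
  · exact i.elim0
  let b' : Fin l → E k → E k → E k → ℝ := fun j => b (Equiv.swap 0 i j.succ)
  have e : ∀ j, (Fin.cons (dOne (thetaDiff D G)) b' : Fin (l + 1) → E k → E k → E k → ℝ) j =
      b (Equiv.swap 0 i j) := by
    intro j
    refine Fin.cases ?_ (fun j => rfl) j
    rw [Fin.cons_zero, Equiv.swap_apply_left, hi]
  have hb' : ∀ j, IsBasic ((Fin.cons (dOne (thetaDiff D G)) b' :
      Fin (l + 1) → E k → E k → E k → ℝ) j) := fun j => by rw [e]; exact hb _
  have heq : wedgeForm b hb = wedgeForm _ hb' := by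
    refine form_ext fun x hx v => ?_
    rw [wedgeForm_apply _ hx, wedgeForm_apply _ hx, ← wedge_permute (fun j => b j x)
      (Equiv.swap 0 i)]
    congr 1
    funext j
    rw [e]
  rw [heq]
  refine apply_wedgeForm_cons_eq_zero h.isBasicOne_thetaDiff (fun x hx v w => ?_)
    (fun j => hb _) (fun j => hc _) hb' hT
  have hd := differentiableAt_of_contDiffOn h.contDiffOn_thetaDiff hx
  rw [fderiv_apply_const hd, fderiv_apply_const hd, dOne]

theorem wedge_update {X R : Type*} [CommRing R] (b : Fin l → X → X → R) (i : Fin l) (r : R)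
    (f₁ f₂ f₃ : X → X → R) (hf : ∀ v w, f₁ v w = f₂ v w + r * f₃ v w) (u : Fin l × Fin 2 → X) :
    wedge (Function.update b i f₁) u =
      wedge (Function.update b i f₂) u + r * wedge (Function.update b i f₃) u := by
  simp only [wedge, Finset.mul_sum]
  rw [← Finset.sum_add_distrib]
  refine Finset.sum_congr rfl fun σ _ => ?_
  have h : ∀ f : X → X → R, ∏ j, Function.update b i f j (u (σ (j, 0))) (u (σ (j, 1))) =
      f (u (σ (i, 0))) (u (σ (i, 1))) *
        ∏ j ∈ univ.erase i, b j (u (σ (j, 0))) (u (σ (j, 1))) := by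
    intro f
    rw [← Finset.mul_prod_erase _ _ (mem_univ i), Function.update_self]
    congr 1
    exact Finset.prod_congr rfl fun j hj => by
      rw [Function.update_of_ne (Finset.ne_of_mem_erase hj)]
  rw [h, h, h, hf]
  ring

variable (k l) in
/-- The power of the Fubini–Study form. -/
def fubiniStudy : Form k (l * 2) :=
  wedgeForm (fun _ => dOne theta) fun _ => isBasic_dOne_theta

/-- In cohomology the pullback acts on the Fubini–Study class as multiplication by `D`. Factors are
pulled back one at a time, each replacement costing `D` plus an exact term on which `T` vanishes. -/
theorem IsLift.apply_pullback_fubiniStudy (h : IsLift D G g) {T : Current k (l * 2)}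
    (hT : T.IsClosed) : T.toLinearMap (h.pullback (fubiniStudy k l)) =
      (D : ℝ) ^ l * T.toLinearMap (fubiniStudy k l) := by
  let b : Finset (Fin l) → Fin l → E k → E k → E k → ℝ := fun s j =>
    if j ∈ s then dOne (thetaPull G) else dOne theta
  have hb : ∀ s j, IsBasic (b s j) := by
    intro s j
    simp only [b]
    split_ifs
    exacts [h.isBasic_dOne_thetaPull, isBasic_dOne_theta]
  have hc : ∀ s j, IsLocallyExact (b s j) := by
    intro s j
    simp only [b]
    split_ifs
    exacts [isLocallyExact_dOne h.contDiffOn_thetaPull, isLocallyExact_dOne contDiffOn_theta]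
  have key : ∀ s : Finset (Fin l), T.toLinearMap (wedgeForm (b s) (hb s)) =
      (D : ℝ) ^ #s * T.toLinearMap (fubiniStudy k l) := by
    intro s
    induction s using Finset.induction_on with
    | empty =>
      rw [Finset.card_empty, pow_zero, one_mul]
      congr 1
    | insert i s his ih =>
      have hu : ∀ j, IsBasic (Function.update (b s) i (dOne (thetaDiff D G)) j) := by
        intro j
        by_cases hj : j = i
        · subst hj; rw [Function.update_self]; exact h.isBasic_dOne_thetaDiff
        · rw [Function.update_of_ne hj]; exact hb s j
      have hcu : ∀ j, IsLocallyExact (Function.update (b s) i (dOne (thetaDiff D G)) j) := by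
        intro j
        by_cases hj : j = i
        · subst hj; rw [Function.update_self]; exact isLocallyExact_dOne h.contDiffOn_thetaDiff
        · rw [Function.update_of_ne hj]; exact hc s j
      have e : wedgeForm (b (insert i s)) (hb _) = wedgeForm _ hu + (D : ℝ) • wedgeForm (b s) (hb s) := by
        refine form_ext fun x hx v => ?_
        change _ = (wedgeForm _ hu).1 x v + (D : ℝ) * (wedgeForm (b s) (hb s)).1 x v
        rw [wedgeForm_apply _ hx, wedgeForm_apply _ hx, wedgeForm_apply _ hx]
        have h1 := wedge_update (fun j => b s j x) i (D : ℝ) (dOne (thetaPull G) x)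
          (dOne (thetaDiff D G) x) (dOne theta x)
          (fun v w => by rw [h.dOne_thetaDiff hx]; ring) fun p => v (finProdFinEquiv p)
        convert h1 using 2
        · funext j
          by_cases hj : j = i
          · subst hj; simp [b]
          · rw [Function.update_of_ne hj]; simp [b, hj]
        · congr 1
          funext j
          by_cases hj : j = i
          · subst hj; simp
          · rw [Function.update_of_ne hj, Function.update_of_ne hj]
        · congr 2
          funext j
          by_cases hj : j = i
          · subst hj; simp [b, his]
          · rw [Function.update_of_ne hj]
      rw [e, map_add, map_smul, h.apply_wedgeForm_thetaDiff_eq_zero i (by simp) hu hcu hT, ih,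
        Finset.card_insert_of_notMem his, pow_succ, zero_add, smul_eq_mul]
      ring
  have h2 := key univ
  rw [Finset.card_univ, Fintype.card_fin] at h2
  rw [← h2]
  congr 1
  refine form_ext fun x hx v => ?_
  rw [h.pullback_apply _ hx, fubiniStudy, wedgeForm_apply _ (h.ne_zero x hx), wedgeForm_apply _ hx,
    wedge_comp (fun _ => dOne theta (G x)) (fun y => fderiv ℝ G x y) fun p => v (finProdFinEquiv p)]
  congr 1
  funext j v w
  simp only [b, mem_univ, if_true]
  rw [h.dOne_thetaPull hx]

end Pullback

/-! ### Positive currents have order zero -/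

section OrderZero

open Finset

variable {k l n D : ℕ} {G : E k → E k} {g : P k → P k}

theorem mem_coneF_of_mem_strongPosCone {η : E k [⋀^Fin (l * 2)]→L[ℝ] ℝ}
    (h : η ∈ strongPosCone k l) : ⇑η ∈ coneF k l := by
  induction h using AddSubmonoid.closure_induction with
  | mem η hη => exact AddSubmonoid.subset_closure hη
  | zero => exact zero_mem _
  | add η η' _ _ h h' => exact add_mem h h'

theorem fubiniStudy_eq {x : E k} (hx : x ≠ 0) : ⇑((fubiniStudy k l).1 x) =
    (2 * (nsq x)⁻¹) ^ l • fun v : Fin (l * 2) → E k => kahlerPow l fun i => hproj x (v i) := by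
  funext v
  rw [fubiniStudy, wedgeForm_apply _ hx, Pi.smul_apply, smul_eq_mul, kahlerPow,
    wedge_comp (fun _ => kahler) (hproj x) fun p => v (finProdFinEquiv p)]
  have h := wedge_mul (fun _ : Fin l => 2 * (nsq x)⁻¹)
    (fun _ v w => kahler (hproj x v) (hproj x w)) fun p => v (finProdFinEquiv p)
  rw [Finset.prod_const, Finset.card_univ, Fintype.card_fin] at h
  rw [← h]
  congr 1
  funext _ v w
  exact dOne_theta hx v w

theorem fubiniStudy_mem_coneF {x : E k} (hx : x ≠ 0) : ⇑((fubiniStudy k l).1 x) ∈ coneF k l := by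
  rw [fubiniStudy_eq hx]
  have := nsq_pos hx
  exact smul_mem_coneF (by positivity) (comp_mem_coneF (hproj x) kahlerPow_mem_coneF)

theorem IsLift.pullback_mem_strongPosCone (h : IsLift D G g) {φ : Form k (l * 2)}
    (hφ : ∀ x, x ≠ 0 → φ.1 x ∈ strongPosCone k l) {x : E k} (hx : x ≠ 0) :
    (h.pullback φ).1 x ∈ strongPosCone k l := by
  apply mem_strongPosCone_of_mem_coneF
  let L : E k →ₗ[ℂ] E k :=
    { toFun := fderiv ℝ G x, map_add' := map_add _, map_smul' := h.fderiv_smul x }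
  have h1 := comp_mem_coneF L (mem_coneF_of_mem_strongPosCone (hφ (G x) (h.ne_zero x hx)))
  convert h1 using 1
  funext v
  exact h.pullback_apply φ hx v

/-- The action of a homothety of the tangent spaces on forms. -/
def rotate (c : ℂ) (hc : c ≠ 0) (φ : Form k n) : Form k n :=
  ⟨fun x => φ.1 (c⁻¹ • x), by
    obtain ⟨h1, h2, h3, h4⟩ := φ.2
    have hc' := inv_ne_zero hc
    refine ⟨?_, by simp only [smul_zero, h2], ?_, ?_⟩
    · refine h1.comp ?_ fun x hx => smul_ne_zero hc' hx
      exact (contDiff_id.const_smul c⁻¹).contDiffOn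
    · rintro x hx v ⟨i, t, hi⟩
      exact h3 _ (smul_ne_zero hc' hx) v ⟨i, t * c, by rw [hi, smul_smul, mul_assoc,
        mul_inv_cancel₀ hc, mul_one]⟩
    · intro t ht x hx v
      change φ.1 (c⁻¹ • t • x) _ = φ.1 (c⁻¹ • x) v
      rw [smul_comm c⁻¹ t x]
      exact h4 t ht _ (smul_ne_zero hc' hx) v⟩

theorem rotate_apply {c : ℂ} (hc : c ≠ 0) (φ : Form k n) (x : E k) (v : Fin n → E k) :
    (rotate c hc φ).1 x v = φ.1 x fun i => c • v i := by
  change φ.1 (c⁻¹ • x) v = _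
  by_cases hx : x = 0
  · rw [hx, smul_zero, φ.2.2.1]; rfl
  · rw [← φ.2.2.2.2 c hc _ (smul_ne_zero (inv_ne_zero hc) hx), smul_inv_smul₀ hc]

/-- Splitting each argument into its projection and a multiple of `x`, all terms containing a
multiple of `x` vanish by horizontality. -/
theorem apply_hproj (φ : Form k n) {x : E k} (hx : x ≠ 0) (v : Fin n → E k) :
    φ.1 x (fun i => hproj x (v i)) = φ.1 x v := by
  have h := (φ.1 x).toMultilinearMap.map_add_univ (fun i => hproj x (v i))
    fun i => ((nsq x : ℂ)⁻¹ * hdot x (v i)) • x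
  have h1 : ((fun i => hproj x (v i)) + fun i => ((nsq x : ℂ)⁻¹ * hdot x (v i)) • x) = v := by
    funext i
    exact sub_add_cancel _ _
  rw [h1, Finset.sum_eq_single univ] at h
  · rw [Finset.piecewise_univ] at h
    exact h.symm
  · intro s _ hs
    obtain ⟨i, hi⟩ : ∃ i, i ∉ s := by
      by_contra! hcon
      exact hs (Finset.eq_univ_iff_forall.2 hcon)
    exact φ.2.2.2.1 x hx _ ⟨i, _, Finset.piecewise_eq_of_notMem _ _ _ hi⟩
  · intro hcon
    exact absurd (mem_univ _) hcon

/-- Linear forms which are positive on strongly positive forms and invariant under rotations. -/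
structure IsPositiveBidim (T : Form k (l * 2) →ₗ[ℝ] ℝ) : Prop where
  bidim : ∀ c : ℂ, ‖c‖ = 1 → ∀ φ η : Form k (l * 2),
    (∀ (x : E k) (v : Fin (l * 2) → E k), η.1 x v = φ.1 x (fun i => c • v i)) → T η = T φ
  nonneg : ∀ φ : Form k (l * 2), (∀ x : E k, x ≠ 0 → φ.1 x ∈ strongPosCone k l) → 0 ≤ T φ

theorem mem_strongPosCone_of_norm_eq_one {φ : Form k (l * 2)}
    (h : ∀ x, ‖x‖ = 1 → ⇑(φ.1 x) ∈ coneF k l) {x : E k} (hx : x ≠ 0) :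
    φ.1 x ∈ strongPosCone k l := by
  apply mem_strongPosCone_of_mem_coneF
  have hn : (‖x‖ : ℂ) ≠ 0 := by exact_mod_cast norm_ne_zero_iff.2 hx
  have h1 : ‖(‖x‖ : ℂ)⁻¹ • x‖ = 1 := by
    rw [norm_smul, norm_inv, Complex.norm_real, norm_norm, inv_mul_cancel₀ (norm_ne_zero_iff.2 hx)]
  convert comp_mem_coneF ((‖x‖ : ℂ)⁻¹ • LinearMap.id) (h _ h1) using 1
  funext v
  exact (φ.2.2.2.2 _ (inv_ne_zero hn) x hx v).symm

theorem exists_norm_eq_one (k : ℕ) : ∃ x : E k, ‖x‖ = 1 := exists_norm_eq (E k) zero_le_one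

variable (k l) in
/-- Positive currents have order zero. -/
theorem exists_order_zero_bound : ∃ C : ℝ, ∀ T : Form k (l * 2) →ₗ[ℝ] ℝ, IsPositiveBidim T →
    ∀ (φ : Form k (l * 2)) (B : ℝ), (∀ x, ‖x‖ = 1 → ‖φ.1 x‖ ≤ B) →
      |T φ| ≤ C * B * T (fubiniStudy k l) := by
  have hζ := Complex.isPrimitiveRoot_exp (l * 2 + 1) (by omega)
  set ζ := Complex.exp (2 * Real.pi * Complex.I / (l * 2 + 1 : ℕ))
  have hζ0 : ζ ≠ 0 := hζ.ne_zero (by omega)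
  have hζ1 : ‖ζ‖ = 1 := hζ.norm'_eq_one (by omega)
  obtain ⟨C, hC, hbound⟩ := exists_bound_rotation k l hζ
  refine ⟨C * ((k + 1) / 2) ^ l, fun T hT φ B hB => ?_⟩
  have hB0 : 0 ≤ B := by
    obtain ⟨x, hx⟩ := exists_norm_eq_one k
    exact (norm_nonneg _).trans (hB x hx)
  -- The sum over rotations keeps only the `(l,l)` part, which the Kähler form dominates. `T` is
  -- invariant under rotations, so it sees this sum as `2l + 1` copies of `φ`.
  let φ' : Form k (l * 2) := ∑ t ∈ range (l * 2 + 1), rotate (ζ ^ t) (pow_ne_zero t hζ0) φ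
  have hφ' : ∀ x v, φ'.1 x v = ∑ t ∈ range (l * 2 + 1), φ.1 x fun i => ζ ^ t • v i := by
    intro x v
    simp only [φ', Submodule.coe_sum, Finset.sum_apply, ContinuousAlternatingMap.sum_apply]
    exact Finset.sum_congr rfl fun t _ => rotate_apply _ _ _ _
  have hTφ' : T φ' = (l * 2 + 1 : ℕ) * T φ := by
    simp only [φ', map_sum]
    rw [Finset.sum_congr rfl fun t _ => hT.bidim (ζ ^ t) (by rw [norm_pow, hζ1, one_pow]) φ
      (rotate (ζ ^ t) (pow_ne_zero t hζ0) φ) (rotate_apply _ _), Finset.sum_const, card_range,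
      nsmul_eq_mul]
  set M : ℝ := C * ((k + 1) / 2) ^ l * B with hM
  have hcone : ∀ x : E k, ‖x‖ = 1 → ∀ s : ℝ, (s = 1 ∨ s = -1) →
      ⇑((M • fubiniStudy k l + s • φ').1 x) ∈ coneF k l := by
    intro x hx s hs
    have hx0 : x ≠ 0 := norm_ne_zero_iff.1 (by rw [hx]; exact one_ne_zero)
    have hpos := nsq_pos hx0
    have hle : nsq x ≤ k + 1 := by simpa [hx] using nsq_le x
    have h1 : (C * B) • kahlerPow l +
        s • (fun v => ∑ t ∈ range (l * 2 + 1), φ.1 x fun i => ζ ^ t • v i) ∈ coneF k l := by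
      obtain ⟨h1, h2⟩ := hbound (φ.1 x) B (hB x hx)
      rcases hs with rfl | rfl
      · rwa [one_smul]
      · rwa [neg_one_smul, ← sub_eq_add_neg]
    have h2 := comp_mem_coneF (hproj x) h1
    -- In the sup norm the unit sphere satisfies `nsq x ≤ k + 1`, so `((k + 1) / 2) ^ l` dominates
    -- the factor `(nsq x / 2) ^ l` relating the Kähler power of projected vectors to the
    -- Fubini–Study power.
    have h3 : 0 ≤ C * B * (((k + 1) / 2) ^ l - (nsq x / 2) ^ l) := by
      refine mul_nonneg (mul_nonneg hC hB0) (sub_nonneg.2 ?_)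
      gcongr
    have h4 := add_mem (smul_mem_coneF h3 (fubiniStudy_mem_coneF hx0)) h2
    convert h4 using 1
    funext v
    change M * (fubiniStudy k l).1 x v + s * φ'.1 x v =
      C * B * (((k + 1) / 2) ^ l - (nsq x / 2) ^ l) * (fubiniStudy k l).1 x v +
      (C * B * kahlerPow l (fun i => hproj x (v i)) + s *
        ∑ t ∈ range (l * 2 + 1), φ.1 x fun i => ζ ^ t • hproj x (v i))
    have h5 : ∑ t ∈ range (l * 2 + 1), φ.1 x (fun i => ζ ^ t • hproj x (v i)) = φ'.1 x v := by
      rw [hφ']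
      refine Finset.sum_congr rfl fun t _ => ?_
      rw [← apply_hproj φ hx0 fun i => ζ ^ t • v i]
      simp only [map_smul]
    have h6 : kahlerPow l (fun i => hproj x (v i)) = (nsq x / 2) ^ l * (fubiniStudy k l).1 x v := by
      rw [fubiniStudy_eq hx0, Pi.smul_apply, smul_eq_mul, ← mul_assoc, ← mul_pow]
      rw [show nsq x / 2 * (2 * (nsq x)⁻¹) = 1 by field_simp, one_pow, one_mul]
    rw [h5, h6, hM]
    ring
  have hfin : ∀ s : ℝ, (s = 1 ∨ s = -1) → 0 ≤ M * T (fubiniStudy k l) + s * T φ' := by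
    intro s hs
    have := hT.nonneg (M • fubiniStudy k l + s • φ') fun x hx =>
      mem_strongPosCone_of_norm_eq_one (fun y hy => hcone y hy s hs) hx
    simpa using this
  have h1 := hfin 1 (Or.inl rfl)
  have h2 := hfin (-1) (Or.inr rfl)
  have h3 : |T φ'| ≤ M * T (fubiniStudy k l) := abs_le.2 ⟨by linarith, by linarith⟩
  rw [hTφ', abs_mul, Nat.abs_cast] at h3
  refine le_trans ?_ h3
  refine le_mul_of_one_le_left (abs_nonneg _) ?_
  exact_mod_cast Nat.le_add_left 1 (l * 2)

end OrderZero

/-! ### Push-forward of currents to the attracting set -/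

section Pushforward

open Filter Set

variable {k l n D : ℕ} {G : E k → E k} {g : P k → P k}

theorem exists_norm_le_on_sphere (φ : Form k n) : ∃ B : ℝ, ∀ x : E k, ‖x‖ = 1 → ‖φ.1 x‖ ≤ B := by
  have h : ContinuousOn φ.1 (Metric.sphere 0 1) := φ.2.1.continuousOn.mono fun x hx => by
    rw [mem_sphere_zero_iff_norm] at hx
    exact norm_ne_zero_iff.1 (by rw [hx]; exact one_ne_zero)
  obtain ⟨B, hB⟩ := (isCompact_sphere (0 : E k) 1).exists_bound_of_continuousOn h
  exact ⟨B, fun x hx => hB x (mem_sphere_zero_iff_norm.2 hx)⟩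

theorem Current.isClosed_of {T : Current k n} (h : ∀ m, n = m + 1 → ∀ (ψ : Form k m) (η : Form k n),
    (∀ x : E k, x ≠ 0 → ∀ v : Fin n → E k, ∀ w : Fin (m + 1) → E k,
      (∀ (i : Fin n) (j : Fin (m + 1)), (i : ℕ) = j → v i = w j) →
      η.1 x v = extDeriv ψ.1 x w) → T.toLinearMap η = 0) : T.IsClosed := by
  obtain _ | n := n
  · trivial
  · intro ψ η hη
    refine h n rfl ψ η fun x hx v w hvw => ?_
    rw [hη x hx, show v = w from funext fun i => hvw i i rfl]

theorem IsLift.isPositiveBidim_comp (h : IsLift D G g) {T : Form k (l * 2) →ₗ[ℝ] ℝ}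
    (hT : IsPositiveBidim T) : IsPositiveBidim (T ∘ₗ h.pullback) where
  bidim c hc φ η hη := by
    refine hT.bidim c hc _ _ fun x v => ?_
    by_cases hx : x = 0
    · rw [hx, (h.pullback η).2.2.1, (h.pullback φ).2.2.1]; rfl
    · rw [h.pullback_apply η hx, h.pullback_apply φ hx, hη]
      simp only [h.fderiv_smul]
  nonneg φ hφ := hT.nonneg _ fun x hx => h.pullback_mem_strongPosCone hφ hx

/-- The iterates map a trapping region into any neighbourhood of the attracting set. -/
theorem exists_forall_image_iterate_subset {U O : Set (P k)} (hg : Continuous g)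
    (hU : IsTrappingRegion g U) (hO : IsOpen O) (hAO : ⋂ n : ℕ, g^[n] '' U ⊆ O) :
    ∃ N, ∀ n ≥ N, g^[n] '' U ⊆ O := by
  obtain ⟨hUo, hK, hKU⟩ := hU
  set K := closure (g '' U) with hKdef
  have hgK : ∀ n, g^[n + 1] '' K ⊆ g^[n] '' K := by
    intro n
    rw [Function.iterate_succ, image_comp]
    exact image_mono ((image_mono hKU).trans subset_closure)
  have hanti : Antitone fun n => g^[n] '' K := antitone_nat_of_succ_le hgK
  -- The images of the compact set `closure (g '' U)` decrease, and their intersection lies in the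
  -- attracting set because this closure is contained in `U`.
  obtain ⟨N, hN⟩ := exists_subset_nhds_of_isCompact (V := fun n => g^[n] '' K)
    hanti.directed_ge (fun n => hK.image (hg.iterate n)) (U := O) fun x hx =>
      hO.mem_nhds (hAO (iInter_mono (fun n => image_mono hKU) hx))
  refine ⟨N + 1, fun n hn => ?_⟩
  obtain ⟨m, rfl⟩ : ∃ m, n = m + 1 := ⟨n - 1, by omega⟩
  rw [Function.iterate_succ, image_comp]
  exact (image_mono subset_closure).trans ((hanti (show N ≤ m by omega)).trans hN)

theorem IsLift.extDeriv_pullback_form {m : ℕ} (h : IsLift D G g) (ψ : Form k m) {x : E k} (hx : x ≠ 0) :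
    extDeriv (h.pullback ψ).1 x =
      (extDeriv ψ.1 (G x)).compContinuousLinearMap (fderiv ℝ G x) := by
  have he : (h.pullback ψ).1 =ᶠ[𝓝 x] fun y =>
      (ψ.1 (G y)).compContinuousLinearMap (fderiv ℝ G y) := by
    filter_upwards [isOpen_compl_singleton.mem_nhds hx] with y hy
    exact h.pullback_eq ψ hy
  rw [he.extDeriv_eq]
  exact extDeriv_pullback (r := ∞) (differentiableAt_of_contDiffOn ψ.2.1 (h.ne_zero x hx))
    h.contDiff_real.contDiffAt
    (by rw [minSmoothness_of_isRCLikeNormedField]; exact WithTop.coe_le_coe.2 le_top)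

theorem SupportsPositiveClosedCurrent.iInter_image (h : IsLift D G g) (hD : D ≠ 0)
    {U A : Set (P k)} (hU : IsTrappingRegion g U) (hAU : A ⊆ U)
    (hA : SupportsPositiveClosedCurrent A l) :
    SupportsPositiveClosedCurrent (⋂ n : ℕ, g^[n] '' U) l := by
  obtain ⟨T, hT0, hTpos, hTclosed, hTsupp⟩ := hA
  have hT : IsPositiveBidim T.toLinearMap := ⟨hTpos.1, hTpos.2⟩
  obtain ⟨C, hC⟩ := exists_order_zero_bound k l
  have hD' : (0 : ℝ) < D := by exact_mod_cast Nat.pos_of_ne_zero hD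
  -- The iterate of order `n` has degree `D ^ n`, so this normalization keeps the mass against the
  -- Fubini–Study power constant.
  let r : ℕ → ℝ := fun n => (((D : ℝ) ^ n) ^ l)⁻¹
  have hr : ∀ n, 0 ≤ r n := fun n => by positivity
  let S : ℕ → Form k (l * 2) →ₗ[ℝ] ℝ := fun n => r n • (T.toLinearMap ∘ₗ (h.iterate n).pullback)
  have hSapp : ∀ n φ, S n φ = r n * T.toLinearMap ((h.iterate n).pullback φ) := fun n φ => rfl
  have hSpos : ∀ n, IsPositiveBidim (S n) := by
    intro n
    have h1 := (h.iterate n).isPositiveBidim_comp hT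
    exact ⟨fun c hc φ η hη => congrArg (r n * ·) (h1.bidim c hc φ η hη),
      fun φ hφ => mul_nonneg (hr n) (h1.nonneg φ hφ)⟩
  have hSfs : ∀ n, S n (fubiniStudy k l) = T.toLinearMap (fubiniStudy k l) := by
    intro n
    rw [hSapp, (h.iterate n).apply_pullback_fubiniStudy hTclosed]
    push_cast
    exact inv_mul_cancel_left₀ (by positivity) _
  have hbd : ∀ n φ B, (∀ x : E k, ‖x‖ = 1 → ‖φ.1 x‖ ≤ B) →
      |S n φ| ≤ C * B * T.toLinearMap (fubiniStudy k l) := fun n φ B hB => by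
    rw [← hSfs n]
    exact hC (S n) (hSpos n) φ B hB
  have hlim : ∀ φ, ∃ s, Tendsto (fun n => S n φ) (hyperfilter ℕ : Filter ℕ) (𝓝 s) := by
    intro φ
    obtain ⟨B, hB⟩ := exists_norm_le_on_sphere φ
    -- A limit along a nonprincipal ultrafilter exists for every test form at once and is
    -- automatically linear, so no weak compactness theorem or extraction of subsequences is needed.
    obtain ⟨s, -, hs⟩ := (isCompact_Icc (a := -(C * B * T.toLinearMap (fubiniStudy k l)))
      (b := C * B * T.toLinearMap (fubiniStudy k l))).ultrafilter_le_nhds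
      ((hyperfilter ℕ).map fun n => S n φ) (by
        rw [le_principal_iff, Ultrafilter.coe_map, mem_map]
        exact univ_mem' fun n => abs_le.1 (hbd n φ B hB))
    exact ⟨s, hs⟩
  choose s hs using hlim
  let L : Form k (l * 2) →ₗ[ℝ] ℝ :=
    { toFun := s
      map_add' := fun φ η => tendsto_nhds_unique (hs _) (by
        simpa only [map_add] using (hs φ).add (hs η))
      map_smul' := fun c φ => tendsto_nhds_unique (hs _) (by
        simpa only [map_smul, RingHom.id_apply] using (hs φ).const_smul c) }
  have hLlim : ∀ φ, Tendsto (fun n => S n φ) (hyperfilter ℕ : Filter ℕ) (𝓝 (L φ)) := hs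
  have hconst : ∀ φ c, (∀ᶠ n in (hyperfilter ℕ : Filter ℕ), S n φ = c) → L φ = c := fun φ c hc =>
    tendsto_nhds_unique (hLlim φ) (tendsto_const_nhds.congr' (hc.mono fun _ h => h.symm))
  have hLbd : ∀ φ B, (∀ x : E k, ‖x‖ = 1 → ‖φ.1 x‖ ≤ B) →
      |L φ| ≤ C * B * T.toLinearMap (fubiniStudy k l) := fun φ B hB =>
    le_of_tendsto (hLlim φ).abs (Eventually.of_forall fun n => hbd n φ B hB)
  let Q : Current k (l * 2) :=
    ⟨L, 0, C * T.toLinearMap (fubiniStudy k l), fun φ B hB => by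
      refine (hLbd φ B fun x hx => ?_).trans_eq (by ring)
      have := hB 0 le_rfl x hx
      rwa [norm_iteratedFDeriv_zero] at this⟩
  refine ⟨Q, ?_, ⟨?_, ?_⟩, ?_, ?_⟩
  -- The limit keeps the mass of `T`; if that were zero, the order zero bound would make `T` vanish.
  · intro hL0
    have h1 : T.toLinearMap (fubiniStudy k l) = 0 := by
      rw [← hconst _ _ (Eventually.of_forall hSfs)]
      exact LinearMap.congr_fun hL0 _
    refine hT0 (LinearMap.ext fun φ => ?_)
    obtain ⟨B, hB⟩ := exists_norm_le_on_sphere φ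
    have h2 := hC _ hT φ B hB
    rw [h1, mul_zero] at h2
    exact abs_nonpos_iff.1 h2
  · intro c hc φ η hη
    refine tendsto_nhds_unique (hLlim η) ((hLlim φ).congr fun n => ?_)
    exact ((hSpos n).bidim c hc φ η hη).symm
  · intro φ hφ
    exact ge_of_tendsto (hLlim φ) (Eventually.of_forall fun n => (hSpos n).nonneg φ hφ)
  · refine Current.isClosed_of fun m hm ψ η hη => ?_
    refine hconst η 0 (Eventually.of_forall fun n => ?_)
    rw [hSapp, hTclosed.apply_eq_zero hm ((h.iterate n).pullback ψ) ((h.iterate n).pullback η),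
      mul_zero]
    intro x hx v
    rw [(h.iterate n).pullback_apply _ hx, (h.iterate n).extDeriv_pullback_form _ hx]
    refine hη _ ((h.iterate n).ne_zero x hx) _ _ fun i j hij => ?_
    have : Fin.cast hm i = j := Fin.ext hij
    rw [this]
    rfl
  · rintro φ ⟨O, hO, hAO, hφ⟩
    obtain ⟨N, hN⟩ := exists_forall_image_iterate_subset h.continuous hU hO hAO
    refine hconst φ 0 ?_
    have hev : ∀ᶠ n in (hyperfilter ℕ : Filter ℕ), N ≤ n :=
      Nat.hyperfilter_le_atTop (eventually_ge_atTop N)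
    refine hev.mono fun n hn => ?_
    -- For `n ≥ N` the iterate maps `U` into `O`, where `φ` vanishes. The pullback is then zero on
    -- the open set `U`, which contains `A`.
    rw [hSapp, hTsupp _ ⟨U, hU.1, hAU, fun x hx hxU => ?_⟩, mul_zero]
    refine ContinuousAlternatingMap.ext fun v => ?_
    have hGx := (h.iterate n).ne_zero x hx
    have h1 : Projectivization.mk ℂ (G^[n] x) hGx ∈ O := by
      rw [← proj_of_ne_zero, ← (h.iterate n).map_proj x hx, proj_of_ne_zero hx]
      exact hN n hn (mem_image_of_mem _ hxU)
    rw [(h.iterate n).pullback_apply _ hx, hφ _ hGx h1]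
    rfl

end Pushforward

theorem isOpen_setOf_isSmallTopDegreeOn (k d : ℕ) (hd : 1 ≤ d) :
    IsOpen {f : HolEnd k d | ∃ A : Set (P k), IsSmallTopDegreeOn f A} := by
  have hd0 : d ≠ 0 := by omega
  rw [isOpen_coinduced, isOpen_iff_eventually]
  rintro F ⟨A, -, U, ⟨hU, hA⟩, l, ⟨hl, hl'⟩, hsmall⟩
  have hL : (0 : ENNReal) < (d : ENNReal) ^ l :=
    ENNReal.pow_pos (by exact_mod_cast Nat.pos_of_ne_zero hd0) l
  obtain ⟨U', hU'U, hFU, hev⟩ := exists_stable_trappingRegion F hd0 hU hL hsmall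
  filter_upwards [hev] with F' hF'
  obtain ⟨htrap, hlim⟩ := hF'
  have hfor : IsTrappingRegionFor F'.map U' (⋂ n : ℕ, F'.map^[n] '' U') := ⟨htrap, rfl⟩
  have hAU' : A ⊆ U' := by
    rw [hA]
    refine (Set.iInter_subset _ 1).trans ?_
    rwa [Function.iterate_one]
  refine ⟨⋂ n : ℕ, F'.map^[n] '' U', ⟨U', hfor⟩, U', hfor, l, ⟨?_, fun l' hll' h => ?_⟩, hlim⟩
  · exact hl.iInter_image F'.isLift hd0 htrap hAU'
  · refine hl' l' hll' ?_
    rw [hA]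
    -- A current on the new attracting set lies in `U' ⊆ U`, so pushing it by the original map would
    -- give one of the same bidimension on `A`.
    refine h.iInter_image F.isLift hd0 hU ((Set.iInter_subset _ 0).trans ?_)
    rw [Function.iterate_zero, Set.image_id]
    exact hU'U

end ProjDyn

end

theorem mainTheorem8 (k d : ℕ) (hd : 1 ≤ d) :
    IsOpen {f : ProjDyn.HolEnd k d | ∃ A : Set (ProjDyn.P k), ProjDyn.IsSmallTopDegreeOn f A} :=
  ProjDyn.isOpen_setOf_isSmallTopDegreeOn k d hd
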